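/- Let $\mathbb D$ be the open unit disc and $dA=\frac{dx\,dy}{\pi}$. Let $v:\mathbb D\to(0,\infty)$ be a radial weight, i.e. $v$ is integrable over $\mathbb D$ and $v(z)=v(|z|)$ for all $z\in\mathbb D$, and put $\widehat v(r)=\int_r^1 v(s)\,ds$. Let $\mathcal D_v$ be the space of analytic functions $f$ on $\mathbb D$ with $$\|f\|_{\mathcal D_v}^2=|f(0)|^2+\int_{\mathbb D}|f'(z)|^2v(z)\,dA(z)<\infty.$$ Suppose that $v$ satisfies the doubling condition $\sup_{0<r<1}\widehat v(r)/\widehat v\left(\frac{1+r}{2}\right)<\infty$ and the Muckenhoupt type conditions $$\sup_{0<r<1}\left(\int_r^1\frac{\widehat v(s)}{(1-s)^2}\,ds\right)^{1/2}\left(\int_0^r\frac{1}{\widehat v(s)}\,ds\right)^{1/2}<\infty,$$ $$\sup_{0<r<1}\left(\int_0^r\frac{\widehat v(s)}{(1-s)^4}\,ds\right)^{1/2}\left(\int_r^1\frac{(1-s)^2}{\widehat v(s)}\,ds\right)^{1/2}<\infty.$$ Let $g$ be analytic on $\mathbb D$. Then for every $f\in\mathcal D_v$ and $z\in\mathbb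 D$ the integral $$\mathcal H_g(f)(z)=\int_0^1 f(t)\,g'(tz)\,dt$$ converges absolutely, and $\mathcal H_g$ is a compact operator on $\mathcal D_v$ (that is, it maps $\mathcal D_v$ into itself and is compact there) if and only if $g$ belongs to the little-oh mean Lipschitz space $b(2,\infty)$ (also denoted $\lambda(2,\frac12)$), i.e. $$\lim_{r\to1^-}M_2(r,g')\,(1-r)^{1/2}=0,\qquad M_2(r,g')=\left(\frac1{2\pi}\int_{-\pi}^{\pi}|g'(re^{i\theta})|^2\,d\theta\right)^{1/2}.$$ -/

import Mathlib

open MeasureTheory Set Filter Topology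
open scoped ENNReal

namespace DirichletHilbert

/-- The open unit disc of the complex plane. -/
def disc : Set ℂ := Metric.ball (0 : ℂ) 1

/-- A radial weight: a function that is positive and integrable on the unit disc and depends
there only on the modulus. The values outside the disc are irrelevant. -/
structure RadialWeight where
  toFun : ℂ → ℝ
  pos : ∀ z ∈ disc, 0 < toFun z
  integrable : IntegrableOn toFun disc
  radial : ∀ z ∈ disc, toFun z = toFun ((‖z‖ : ℝ) : ℂ)

/-- The tail `∫_r^1 v(s) ds`. -/
noncomputable def RadialWeight.hat (v : RadialWeight) (r : ℝ) : ℝ≥0∞ :=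
  ∫⁻ s in Ioo r 1, ENNReal.ofReal (v.toFun (s : ℂ))

/-- The class of radial weights whose tail is doubling. -/
def RadialWeight.IsDoubling (v : RadialWeight) : Prop :=
  (⨆ r ∈ Ioo (0 : ℝ) 1, v.hat r / v.hat ((1 + r) / 2)) < ⊤

/-- The constant `M₁(v)`, with values in `[0, ∞]`. -/
noncomputable def RadialWeight.muckenhouptOne (v : RadialWeight) : ℝ≥0∞ :=
  ⨆ r ∈ Ioo (0 : ℝ) 1,
    (∫⁻ s in Ioo r 1, v.hat s / ENNReal.ofReal ((1 - s) ^ 2)) ^ (1 / 2 : ℝ) *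
      (∫⁻ s in Ioo 0 r, 1 / v.hat s) ^ (1 / 2 : ℝ)

/-- The constant `M₂(v)`, with values in `[0, ∞]`. -/
noncomputable def RadialWeight.muckenhouptTwo (v : RadialWeight) : ℝ≥0∞ :=
  ⨆ r ∈ Ioo (0 : ℝ) 1,
    (∫⁻ s in Ioo 0 r, v.hat s / ENNReal.ofReal ((1 - s) ^ 4)) ^ (1 / 2 : ℝ) *
      (∫⁻ s in Ioo r 1, ENNReal.ofReal ((1 - s) ^ 2) / v.hat s) ^ (1 / 2 : ℝ)

/-- The integral mean `M₂(r, f)`. -/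
noncomputable def integralMean (r : ℝ) (f : ℂ → ℂ) : ℝ :=
  Real.sqrt ((1 / (2 * Real.pi)) *
    ∫ θ in (-Real.pi)..Real.pi, ‖f (r * Complex.exp (Complex.I * θ))‖ ^ 2)

/-- The little-oh mean Lipschitz space `b(2, ∞)`. -/
def IsLittleMeanLipschitz (g : ℂ → ℂ) : Prop :=
  DifferentiableOn ℂ g disc ∧
    Tendsto (fun r : ℝ => integralMean r (deriv g) * (1 - r) ^ (1 / 2 : ℝ)) (𝓝[<] 1) (𝓝 0)

/-- The value `∫_0^1 f(t) g'(tz) dt` of the generalized Hilbert operator. -/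
noncomputable def hilbertOp (g f : ℂ → ℂ) (z : ℂ) : ℂ :=
  ∫ t in (0 : ℝ)..1, f t * deriv g (t * z)

theorem isOpen_disc : IsOpen disc := Metric.isOpen_ball

theorem measurableSet_disc : MeasurableSet disc := isOpen_disc.measurableSet

theorem zero_mem_disc : (0 : ℂ) ∈ disc := Metric.mem_ball_self one_pos

theorem deriv_add_of_mem {f h : ℂ → ℂ} (hf : DifferentiableOn ℂ f disc)
    (hh : DifferentiableOn ℂ h disc) {z : ℂ} (hz : z ∈ disc) :
    deriv (f + h) z = deriv f z + deriv h z :=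
  deriv_add (hf.differentiableAt (isOpen_disc.mem_nhds hz))
    (hh.differentiableAt (isOpen_disc.mem_nhds hz))

theorem deriv_smul_of_mem {f : ℂ → ℂ} (hf : DifferentiableOn ℂ f disc) (c : ℂ) {z : ℂ}
    (hz : z ∈ disc) : deriv (c • f) z = c * deriv f z := by
  simpa using deriv_const_smul c (hf.differentiableAt (isOpen_disc.mem_nhds hz))

theorem RadialWeight.integrableOn_pairing (v : RadialWeight) {f h : ℂ → ℂ}
    (hf : IntegrableOn (fun z => ‖deriv f z‖ ^ 2 * v.toFun z) disc)
    (hh : IntegrableOn (fun z => ‖deriv h z‖ ^ 2 * v.toFun z) disc) :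
    IntegrableOn (fun z => starRingEnd ℂ (deriv f z) * deriv h z * (v.toFun z : ℂ)) disc := by
  refine Integrable.mono' (hf.add hh) ?_ ?_
  · refine AEStronglyMeasurable.mul ?_ ?_
    · exact ((Complex.continuous_conj.measurable.comp (measurable_deriv f)).mul
        (measurable_deriv h)).aestronglyMeasurable
    · exact Complex.continuous_ofReal.comp_aestronglyMeasurable v.integrable.aestronglyMeasurable
  · filter_upwards [ae_restrict_mem measurableSet_disc] with z hz
    have hv := v.pos z hz
    simp only [norm_mul, RCLike.norm_conj, Complex.norm_real, Real.norm_eq_abs, abs_of_pos hv,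
      Pi.add_apply]
    rw [← add_mul]
    refine mul_le_mul_of_nonneg_right ?_ hv.le
    nlinarith [sq_nonneg (‖deriv f z‖ - ‖deriv h z‖), norm_nonneg (deriv f z),
      norm_nonneg (deriv h z), mul_nonneg (norm_nonneg (deriv f z)) (norm_nonneg (deriv h z))]

/-- The analytic functions on the disc with finite weighted Dirichlet integral. An analytic
function on the disc is represented by its extension by zero to the plane, so that two elements
are equal exactly when they agree on the disc. -/
def dirichletSubmodule (v : RadialWeight) : Submodule ℂ (ℂ → ℂ) where
  carrier := {f | DifferentiableOn ℂ f disc ∧ (∀ z ∉ disc, f z = 0) ∧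
    IntegrableOn (fun z => ‖deriv f z‖ ^ 2 * v.toFun z) disc}
  zero_mem' := by
    refine ⟨differentiableOn_const 0, fun _ _ => rfl, ?_⟩
    have h : (fun z => ‖deriv (0 : ℂ → ℂ) z‖ ^ 2 * v.toFun z) = fun _ => (0 : ℝ) := by
      funext z
      simp
    rw [h]
    exact integrableOn_zero
  add_mem' := by
    rintro f h ⟨hf, hf0, hfi⟩ ⟨hh, hh0, hhi⟩
    refine ⟨hf.add hh, fun z hz => by simp [hf0 z hz, hh0 z hz], ?_⟩
    refine Integrable.mono' ((hfi.add hhi).const_mul 2) ?_ ?_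
    · exact ((measurable_deriv _).norm.pow_const 2).aestronglyMeasurable.mul
        v.integrable.aestronglyMeasurable
    · filter_upwards [ae_restrict_mem measurableSet_disc] with z hz
      have hv := v.pos z hz
      have hn := norm_add_le (deriv f z) (deriv h z)
      rw [deriv_add_of_mem hf hh hz, Real.norm_of_nonneg (by positivity), Pi.add_apply,
        ← add_mul, ← mul_assoc]
      refine mul_le_mul_of_nonneg_right ?_ hv.le
      nlinarith [sq_nonneg (‖deriv f z‖ - ‖deriv h z‖), norm_nonneg (deriv f z + deriv h z)]
  smul_mem' := by
    rintro c f ⟨hf, hf0, hfi⟩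
    refine ⟨hf.const_smul c, fun z hz => by simp [hf0 z hz], ?_⟩
    refine IntegrableOn.congr_fun (Integrable.const_mul hfi (‖c‖ ^ 2)) ?_ measurableSet_disc
    intro z hz
    simp only [deriv_smul_of_mem hf c hz, norm_mul]
    ring

/-- The weighted Dirichlet space `D_v`. -/
def DirichletSpace (v : RadialWeight) : Type := ↥(dirichletSubmodule v)

namespace DirichletSpace

variable {v : RadialWeight}

noncomputable instance : AddCommGroup (DirichletSpace v) :=
  inferInstanceAs (AddCommGroup ↥(dirichletSubmodule v))

noncomputable instance : Module ℂ (DirichletSpace v) :=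
  inferInstanceAs (Module ℂ ↥(dirichletSubmodule v))

/-- The underlying function, analytic on the disc. -/
def fn (f : DirichletSpace v) : ℂ → ℂ := f.1

theorem differentiableOn (f : DirichletSpace v) : DifferentiableOn ℂ f.fn disc := f.2.1

theorem integrableOn (f : DirichletSpace v) :
    IntegrableOn (fun z => ‖deriv f.fn z‖ ^ 2 * v.toFun z) disc := f.2.2.2

theorem fn_add (f h : DirichletSpace v) : (f + h).fn = f.fn + h.fn := rfl

theorem fn_smul (c : ℂ) (f : DirichletSpace v) : (c • f).fn = c • f.fn := rfl

theorem ext_disc {f h : DirichletSpace v} (H : ∀ z ∈ disc, f.fn z = h.fn z) : f = h := by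
  refine Subtype.ext (funext fun z => ?_)
  by_cases hz : z ∈ disc
  · exact H z hz
  · exact (f.2.2.1 z hz).trans (h.2.2.1 z hz).symm

/-- The inner product
`⟪f, h⟫ = conj (f 0) * h 0 + ∫_disc conj (f' z) * h' z * v z dA`, with `dA = dx dy / π`. -/
noncomputable def innerFn (f h : DirichletSpace v) : ℂ :=
  starRingEnd ℂ (f.fn 0) * h.fn 0 +
    (1 / Real.pi : ℝ) *
      ∫ z in disc, starRingEnd ℂ (deriv f.fn z) * deriv h.fn z * (v.toFun z : ℂ)

theorem innerFn_self (f : DirichletSpace v) :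
    innerFn f f = ((‖f.fn 0‖ ^ 2 +
      (1 / Real.pi) * ∫ z in disc, ‖deriv f.fn z‖ ^ 2 * v.toFun z : ℝ) : ℂ) := by
  unfold innerFn
  have h : ∀ z, starRingEnd ℂ (deriv f.fn z) * deriv f.fn z * (v.toFun z : ℂ)
      = ((‖deriv f.fn z‖ ^ 2 * v.toFun z : ℝ) : ℂ) := by
    intro z
    rw [Complex.conj_mul']
    push_cast
    ring
  simp only [h]
  rw [integral_complex_ofReal, Complex.conj_mul']
  push_cast
  ring

theorem integral_nonneg' (f : DirichletSpace v) :
    0 ≤ ∫ z in disc, ‖deriv f.fn z‖ ^ 2 * v.toFun z :=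
  setIntegral_nonneg measurableSet_disc fun z hz => mul_nonneg (sq_nonneg _) (v.pos z hz).le

theorem eq_zero_of_innerFn_self (f : DirichletSpace v) (hf : innerFn f f = 0) : f = 0 := by
  rw [innerFn_self, Complex.ofReal_eq_zero] at hf
  have hI := integral_nonneg' f
  have hpi : 0 < 1 / Real.pi := by positivity
  have h2 : 0 ≤ 1 / Real.pi * ∫ z in disc, ‖deriv f.fn z‖ ^ 2 * v.toFun z :=
    mul_nonneg hpi.le hI
  have h0 : f.fn 0 = 0 := by
    have : ‖f.fn 0‖ ^ 2 = 0 := le_antisymm (by linarith) (sq_nonneg _)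
    simpa using this
  have hint : ∫ z in disc, ‖deriv f.fn z‖ ^ 2 * v.toFun z = 0 := by
    have : 1 / Real.pi * ∫ z in disc, ‖deriv f.fn z‖ ^ 2 * v.toFun z = 0 :=
      le_antisymm (by nlinarith [sq_nonneg ‖f.fn 0‖]) h2
    exact (mul_eq_zero.mp this).resolve_left hpi.ne'
  have hae := (setIntegral_eq_zero_iff_of_nonneg_ae
    (by
      filter_upwards [ae_restrict_mem measurableSet_disc] with z hz
      exact mul_nonneg (sq_nonneg _) (v.pos z hz).le) f.integrableOn).mp hint
  have hd : deriv f.fn =ᵐ[volume.restrict disc] fun _ => (0 : ℂ) := by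
    filter_upwards [hae, ae_restrict_mem measurableSet_disc] with z hz hzd
    simpa [(v.pos z hzd).ne'] using hz
  have hd' : EqOn (deriv f.fn) (fun _ => (0 : ℂ)) disc :=
    Measure.eqOn_open_of_ae_eq hd isOpen_disc
      (f.differentiableOn.deriv isOpen_disc).continuousOn continuousOn_const
  refine ext_disc fun z hz => ?_
  have := isOpen_disc.is_const_of_deriv_eq_zero
    (convex_ball (0 : ℂ) 1).isPreconnected f.differentiableOn hd' hz zero_mem_disc
  rw [this, h0]
  rfl

/-- The inner product axioms. -/
@[reducible] noncomputable def core : InnerProductSpace.Core ℂ (DirichletSpace v) where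
  inner := innerFn
  conj_inner_symm f h := by
    unfold innerFn
    rw [map_add, map_mul, map_mul, ← integral_conj]
    simp only [map_mul, Complex.conj_conj, Complex.conj_ofReal]
    congr 1
    · ring
    · congr 1
      refine integral_congr_ae (Eventually.of_forall fun z => ?_)
      simp only
      ring
  re_inner_nonneg f := by
    rw [innerFn_self]
    have := integral_nonneg' f
    simp only [RCLike.re_to_complex, Complex.ofReal_re]
    positivity
  add_left f h k := by
    unfold innerFn
    have hI : ∫ z in disc, starRingEnd ℂ (deriv (f + h).fn z) * deriv k.fn z * (v.toFun z : ℂ)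
        = (∫ z in disc, starRingEnd ℂ (deriv f.fn z) * deriv k.fn z * (v.toFun z : ℂ)) +
          ∫ z in disc, starRingEnd ℂ (deriv h.fn z) * deriv k.fn z * (v.toFun z : ℂ) := by
      rw [← integral_add (v.integrableOn_pairing f.integrableOn k.integrableOn)
        (v.integrableOn_pairing h.integrableOn k.integrableOn)]
      refine setIntegral_congr_fun measurableSet_disc fun z hz => ?_
      simp only [fn_add, deriv_add_of_mem f.differentiableOn h.differentiableOn hz, map_add]
      ring
    rw [hI, fn_add, Pi.add_apply, map_add]
    ring
  smul_left f h c := by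
    unfold innerFn
    have hI : ∫ z in disc, starRingEnd ℂ (deriv (c • f).fn z) * deriv h.fn z * (v.toFun z : ℂ)
        = starRingEnd ℂ c *
          ∫ z in disc, starRingEnd ℂ (deriv f.fn z) * deriv h.fn z * (v.toFun z : ℂ) := by
      rw [← integral_const_mul]
      refine setIntegral_congr_fun measurableSet_disc fun z hz => ?_
      simp only [fn_smul, deriv_smul_of_mem f.differentiableOn c hz, map_mul]
      ring
    rw [hI, fn_smul, Pi.smul_apply, smul_eq_mul, map_mul]
    ring
  definite f hf := eq_zero_of_innerFn_self f hf

noncomputable instance : NormedAddCommGroup (DirichletSpace v) :=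
  core.toNormedAddCommGroup

noncomputable instance : InnerProductSpace ℂ (DirichletSpace v) :=
  InnerProductSpace.ofCore core.toCore

theorem norm_sq_eq (f : DirichletSpace v) :
    ‖f‖ ^ 2 = ‖f.fn 0‖ ^ 2 +
      (1 / Real.pi) * ∫ z in disc, ‖deriv f.fn z‖ ^ 2 * v.toFun z := by
  have h : (inner ℂ f f : ℂ) = innerFn f f := rfl
  rw [← inner_self_eq_norm_sq (𝕜 := ℂ) f, h, innerFn_self]
  simp only [RCLike.re_to_complex, Complex.ofReal_re]

end DirichletSpace

/-- The generalized Hilbert operator with symbol `g` maps `D_v` into itself, and is a compact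
operator there. -/
def IsCompactHilbertOp (g : ℂ → ℂ) (v : RadialWeight) : Prop :=
  ∃ T : DirichletSpace v →L[ℂ] DirichletSpace v,
    (∀ f : DirichletSpace v, ∀ z ∈ disc, (T f).fn z = hilbertOp g f.fn z) ∧ IsCompactOperator T

end DirichletHilbert

namespace DirichletHilbert

/-! Everything is read off Taylor coefficients. Let `a m` be those of `f`, `b n` those of `g'`, and
`κ n` twice the odd moment of `v` of order `2n + 1`. Parseval on circles turns the norm of `D_v`
into `∑ W n * |a n|²`, with `W 0 = 1` and `W (n + 1) = (n + 1)² κ n`. Integrating term by term, the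
`n`-th coefficient of `H_g f` is `b n * ∑ a m / (n + m + 1)`. In normalized monomials `H_g` is
therefore a Hilbert-type matrix on `ℓ²` whose `n`-th row is multiplied by `b n`
(`isCompactHilbertOp_iff`).

The hypotheses on `v` serve to produce one kernel bound, `IsHilbertRegular`: the matrix without `b`
is dominated by `(min / max)^δ / √((n+1)(m+1))` for some `δ > 0`. To get it, `κ n` is compared with
the tail of `v` at `1 - 1/(n+2)`. The second Muckenhoupt condition yields `∑_{m ≤ n} (m+1)² κ m ≲
(n+1)³ κ n`; the first, helped by the second and by doubling, yields `∑_{m ≥ n} κ m ≲ (n+1) κ n`.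
Such inequalities improve themselves: for small `ε`, `(n+1)^(1+ε) κ n` is almost decreasing and
`(n+1)^(3-ε) κ n` almost increasing (`power_comparison_tail`, `power_comparison_head`), which is the
kernel bound on the two sides of the diagonal.

Since `M₂(r, g')² = ∑ |b n|² r^(2n)`, the little-oh condition says that the Abel means of `|b n|²`
vanish. As the terms are nonnegative, this is the same as vanishing of the averages `(1/N) ∑_{n < N}
|b n|²` (`tendsto_abel_iff`).

Sufficiency is a Schur test in which only these averages enter (`schur_ratioKernel`): the norm is at
most a constant times the square root of their supremum. Cutting off finitely many rows is a finite
rank operation, and the remainder has small averages. For necessity, test on the normalized blocks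
`N^(-1/2) ∑_{N ≤ m < 2N} e_m`. Their images tend to zero in each coordinate, hence in norm by
compactness, while the kernel bound with its indices exchanged is a lower bound within the block. So
the dyadic averages of `|b n|²` vanish, and then all averages do. -/

/-! ### Polar coordinates, the radial profile of the weight and its moments -/

theorem norm_polar {p : ℝ × ℝ} (hp : 0 < p.1) : ‖Complex.polarCoord.symm p‖ = p.1 := by
  rw [Complex.norm_polarCoord_symm, abs_of_pos hp]

theorem lintegral_disc_eq_polar (G : ℂ → ℝ≥0∞) :
    ∫⁻ z in disc, G z = ∫⁻ p in Ioo (0 : ℝ) 1 ×ˢ Ioo (-Real.pi) Real.pi,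
      ENNReal.ofReal p.1 * G (Complex.polarCoord.symm p) := by
  rw [← lintegral_indicator measurableSet_disc, ← Complex.lintegral_comp_polarCoord_symm,
    polarCoord_target,
    ← lintegral_indicator (measurableSet_Ioi.prod measurableSet_Ioo),
    ← lintegral_indicator (measurableSet_Ioo.prod measurableSet_Ioo)]
  refine lintegral_congr fun p => ?_
  by_cases h1 : p ∈ Ioi (0 : ℝ) ×ˢ Ioo (-Real.pi) Real.pi
  · have h0 : 0 < p.1 := h1.1
    have hmem : Complex.polarCoord.symm p ∈ disc ↔ p.1 < 1 := by
      rw [disc, mem_ball_zero_iff, norm_polar h0]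
    rw [indicator_of_mem h1]
    by_cases h2 : p.1 < 1
    · have h3 : p ∈ Ioo (0 : ℝ) 1 ×ˢ Ioo (-Real.pi) Real.pi := ⟨⟨h0, h2⟩, h1.2⟩
      rw [indicator_of_mem h3, indicator_of_mem (hmem.2 h2), smul_eq_mul]
    · have h3 : p ∉ Ioo (0 : ℝ) 1 ×ˢ Ioo (-Real.pi) Real.pi := fun h => h2 h.1.2
      rw [indicator_of_notMem h3, indicator_of_notMem (fun h => h2 (hmem.1 h)), smul_zero]
  · have h3 : p ∉ Ioo (0 : ℝ) 1 ×ˢ Ioo (-Real.pi) Real.pi := fun h => h1 ⟨h.1.1, h.2⟩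
    rw [indicator_of_notMem h1, indicator_of_notMem h3]

/-- The values of the weight along the radius `[0, 1)`. -/
noncomputable def RadialWeight.ray (v : RadialWeight) (r : ℝ) : ℝ≥0∞ :=
  ENNReal.ofReal (v.toFun (r : ℂ))

theorem ofReal_mem_disc {r : ℝ} (h0 : 0 ≤ r) (h1 : r < 1) : (r : ℂ) ∈ disc := by
  rw [disc, mem_ball_zero_iff, Complex.norm_real, Real.norm_of_nonneg h0]
  exact h1

theorem RadialWeight.ofReal_toFun_polar (v : RadialWeight) {p : ℝ × ℝ} (hp : p.1 ∈ Ioo (0 : ℝ) 1) :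
    ENNReal.ofReal (v.toFun (Complex.polarCoord.symm p)) = v.ray p.1 := by
  have hm : Complex.polarCoord.symm p ∈ disc := by
    rw [disc, mem_ball_zero_iff, norm_polar hp.1]; exact hp.2
  rw [v.radial _ hm, norm_polar hp.1, RadialWeight.ray]

theorem RadialWeight.ray_pos (v : RadialWeight) {r : ℝ} (h0 : 0 ≤ r) (h1 : r < 1) :
    0 < v.ray r := ENNReal.ofReal_pos.2 (v.pos _ (ofReal_mem_disc h0 h1))

theorem volume_restrict_polarRect :
    (volume : Measure (ℝ × ℝ)).restrict (Ioo (0 : ℝ) 1 ×ˢ Ioo (-Real.pi) Real.pi) =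
      (volume.restrict (Ioo (0 : ℝ) 1)).prod (volume.restrict (Ioo (-Real.pi) Real.pi)) := by
  rw [Measure.prod_restrict, Measure.volume_eq_prod]

/-- The radius is a null set of the plane, so measurability on the disc does not restrict to it
directly. By Fubini some ray at angle `θ` meets the exceptional set in a null set, and radiality
carries the information from that ray to the real axis. -/
theorem RadialWeight.aemeasurable_ray (v : RadialWeight) :
    AEMeasurable v.ray (volume.restrict (Ioo (0 : ℝ) 1)) := by
  obtain ⟨w, hw, hvw⟩ := v.integrable.aestronglyMeasurable.aemeasurable
  obtain ⟨B, hB, hBm, hB0⟩ : ∃ B : Set ℂ, {z | v.toFun z ≠ w z} ⊆ B ∧ MeasurableSet B ∧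
      volume.restrict disc B = 0 := exists_measurable_superset_of_null hvw
  have h1 : ∫⁻ z in disc, B.indicator 1 z = 0 := by
    rw [lintegral_indicator_one hBm, hB0]
  have hsm : Measurable (fun p : ℝ × ℝ => Complex.polarCoord.symm p) := by
    simp only [Complex.polarCoord_symm_apply]
    fun_prop
  rw [lintegral_disc_eq_polar, volume_restrict_polarRect, lintegral_eq_zero_iff] at h1
  swap
  · exact (ENNReal.measurable_ofReal.comp measurable_fst).mul
      ((measurable_one.indicator hBm).comp hsm)
  have h2 : ∀ᵐ p ∂((volume.restrict (Ioo (0 : ℝ) 1)).prod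
      (volume.restrict (Ioo (-Real.pi) Real.pi))), 0 < p.1 → Complex.polarCoord.symm p ∉ B := by
    filter_upwards [h1] with p hp h0 hmem
    simp only [hmem, indicator_of_mem, Pi.one_apply, mul_one, Pi.zero_apply,
      ENNReal.ofReal_eq_zero] at hp
    linarith
  have h3 := Measure.ae_ae_of_ae_prod
    ((Measure.measurePreserving_swap (μ := volume.restrict (Ioo (-Real.pi) Real.pi))
      (ν := volume.restrict (Ioo (0 : ℝ) 1))).quasiMeasurePreserving.ae h2)
  have hne : (volume.restrict (Ioo (-Real.pi) Real.pi)) ≠ 0 := by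
    rw [Ne, Measure.restrict_eq_zero, Real.volume_Ioo]
    simp [Real.pi_pos]
  have : (ae (volume.restrict (Ioo (-Real.pi) Real.pi))).NeBot := ae_neBot.2 hne
  obtain ⟨θ, hθ⟩ := h3.exists
  refine ⟨fun r => ENNReal.ofReal (w (Complex.polarCoord.symm (r, θ))),
    ENNReal.measurable_ofReal.comp (hw.comp (hsm.comp (by fun_prop))), ?_⟩
  filter_upwards [hθ, ae_restrict_mem measurableSet_Ioo] with r hr hr1
  have h4 : v.toFun (Complex.polarCoord.symm (r, θ)) = w (Complex.polarCoord.symm (r, θ)) := by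
    by_contra hcon
    exact hr hr1.1 (hB hcon)
  rw [← h4, v.ofReal_toFun_polar (p := (r, θ)) hr1]

/-- Twice the odd moment of order `2 n + 1`. -/
noncomputable def RadialWeight.moment (v : RadialWeight) (n : ℕ) : ℝ≥0∞ :=
  2 * ∫⁻ r in Ioo (0 : ℝ) 1, ENNReal.ofReal (r ^ (2 * n + 1)) * v.ray r

theorem RadialWeight.hat_eq (v : RadialWeight) (r : ℝ) : v.hat r = ∫⁻ s in Ioo r 1, v.ray s := rfl

theorem RadialWeight.moment_antitone (v : RadialWeight) : Antitone v.moment := by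
  intro m n hmn
  refine mul_le_mul_right ?_ _
  refine setLIntegral_mono_ae' measurableSet_Ioo (Eventually.of_forall fun r hr => ?_)
  gcongr ?_ * _
  exact ENNReal.ofReal_le_ofReal (pow_le_pow_of_le_one hr.1.le hr.2.le (by omega))

theorem RadialWeight.moment_zero_lt_top (v : RadialWeight) : v.moment 0 < ⊤ := by
  have h : ∫⁻ z in disc, ENNReal.ofReal (v.toFun z) < ⊤ := by
    refine lt_of_le_of_lt (lintegral_mono fun z => ?_) v.integrable.2
    exact Real.ofReal_le_enorm _
  have h2 : ∫⁻ z in disc, ENNReal.ofReal (v.toFun z) =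
      (∫⁻ r in Ioo (0 : ℝ) 1, ENNReal.ofReal r * v.ray r) * ENNReal.ofReal (2 * Real.pi) := by
    rw [lintegral_disc_eq_polar]
    rw [setLIntegral_congr_fun (g := fun p : ℝ × ℝ => (ENNReal.ofReal p.1 * v.ray p.1) * 1)
      (measurableSet_Ioo.prod measurableSet_Ioo)
      (fun p hp => by simp only [v.ofReal_toFun_polar hp.1, mul_one])]
    rw [volume_restrict_polarRect, lintegral_prod_mul
      (f := fun r => ENNReal.ofReal r * v.ray r) (g := fun _ : ℝ => (1 : ℝ≥0∞))
      (ENNReal.measurable_ofReal.aemeasurable.mul v.aemeasurable_ray) aemeasurable_const]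
    congr 1
    simp only [lintegral_one, Measure.restrict_apply_univ, Real.volume_Ioo]
    congr 1; ring
  rw [h2] at h
  unfold RadialWeight.moment
  simp only [mul_zero, zero_add, pow_one]
  refine ENNReal.mul_lt_top (by simp) ?_
  rcases ENNReal.mul_lt_top_iff.1 h with h | h | h
  · exact h.1
  · simp [h]
  · exfalso
    rw [ENNReal.ofReal_eq_zero] at h
    linarith [Real.pi_pos]

theorem RadialWeight.moment_ne_top (v : RadialWeight) (n : ℕ) : v.moment n ≠ ⊤ :=
  ((v.moment_antitone n.zero_le).trans_lt v.moment_zero_lt_top).ne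

theorem RadialWeight.mul_hat_le_moment (v : RadialWeight) (n : ℕ) {r : ℝ} (hr : 0 ≤ r) :
    2 * ENNReal.ofReal (r ^ (2 * n + 1)) * v.hat r ≤ v.moment n := by
  rw [RadialWeight.moment, mul_assoc, v.hat_eq, ← lintegral_const_mul' _ _ ENNReal.ofReal_ne_top]
  refine mul_le_mul_right ?_ _
  refine (setLIntegral_mono_ae' measurableSet_Ioo (Eventually.of_forall fun s hs => ?_)).trans
    (lintegral_mono_set (Ioo_subset_Ioo_left hr))
  gcongr
  exact hs.1.le

theorem RadialWeight.hat_antitone (v : RadialWeight) : Antitone v.hat := fun _ _ h =>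
  lintegral_mono_set (Ioo_subset_Ioo_left h)

theorem RadialWeight.hat_pos (v : RadialWeight) {r : ℝ} (h0 : 0 ≤ r) (h1 : r < 1) :
    0 < v.hat r := by
  rw [v.hat_eq, pos_iff_ne_zero, Ne, lintegral_eq_zero_iff'
    (v.aemeasurable_ray.mono_measure (Measure.restrict_mono (Ioo_subset_Ioo_left h0) le_rfl))]
  intro h
  have hne : (volume.restrict (Ioo r 1)) ≠ 0 := by
    rw [Ne, Measure.restrict_eq_zero, Real.volume_Ioo]
    simp [h1]
  have : (ae (volume.restrict (Ioo r 1))).NeBot := ae_neBot.2 hne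
  obtain ⟨s, hs, hs1⟩ := (h.and (ae_restrict_mem measurableSet_Ioo)).exists
  exact (v.ray_pos (h0.trans hs1.1.le) hs1.2).ne' hs

/-- Integrability over the disc controls only `r v(r)` near the origin, so the tail from `0` itself
may be infinite. -/
theorem RadialWeight.hat_ne_top (v : RadialWeight) {r : ℝ} (h0 : 0 < r) : v.hat r ≠ ⊤ := by
  have h := (v.mul_hat_le_moment 0 h0.le).trans_lt v.moment_zero_lt_top
  rcases ENNReal.mul_lt_top_iff.1 h with h | h | h
  · exact h.2.ne
  · simp [h0.not_ge] at h
  · simp [h]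

theorem RadialWeight.moment_pos (v : RadialWeight) (n : ℕ) : 0 < v.moment n := by
  refine lt_of_lt_of_le ?_ (v.mul_hat_le_moment n (r := 1 / 2) (by norm_num))
  refine ENNReal.mul_pos (mul_ne_zero (by norm_num) ?_) (v.hat_pos (by norm_num) (by norm_num)).ne'
  exact (ENNReal.ofReal_pos.2 (by positivity)).ne'

/-! ### Tail estimates from doubling and the Muckenhoupt conditions -/

theorem RadialWeight.IsDoubling.exists_le {v : RadialWeight} (hv : v.IsDoubling) :
    ∃ D : ℝ≥0∞, D ≠ ⊤ ∧ ∀ r ∈ Ioo (0 : ℝ) 1, v.hat r ≤ D * v.hat ((1 + r) / 2) := by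
  refine ⟨_, hv.ne, fun r hr => ?_⟩
  have h := le_iSup₂ (f := fun r (_ : r ∈ Ioo (0 : ℝ) 1) => v.hat r / v.hat ((1 + r) / 2)) r hr
  rwa [ENNReal.div_le_iff (v.hat_pos (by linarith [hr.1]) (by linarith [hr.2])).ne'
    (v.hat_ne_top (by linarith [hr.1]))] at h

theorem mul_le_sq_of_rpow_half_mul_le {a b K : ℝ≥0∞}
    (h : a ^ (1 / 2 : ℝ) * b ^ (1 / 2 : ℝ) ≤ K) : a * b ≤ K ^ 2 := by
  rw [← ENNReal.mul_rpow_of_nonneg _ _ (by norm_num)] at h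
  calc a * b = ((a * b) ^ (1 / 2 : ℝ)) ^ (2 : ℕ) := by
        rw [← ENNReal.rpow_natCast, ← ENNReal.rpow_mul]; norm_num
    _ ≤ K ^ 2 := by gcongr

/-- The second factor of the first Muckenhoupt product is bounded below by its part over `(2r - 1,
r)`: there `(1 + s) / 2 ≥ r`, so doubling bounds `v.hat s` by a multiple of `v.hat r`. The
restriction `r ≥ 1/2` keeps that interval inside `(0, 1)`. -/
theorem RadialWeight.exists_tail_le {v : RadialWeight} (hv : v.IsDoubling)
    (hM : v.muckenhouptOne < ⊤) :
    ∃ C : ℝ≥0∞, C ≠ ⊤ ∧ ∀ r : ℝ, 1 / 2 ≤ r → r < 1 →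
      ENNReal.ofReal (1 - r) * ∫⁻ s in Ioo r 1, v.hat s / ENNReal.ofReal ((1 - s) ^ 2)
        ≤ C * v.hat r := by
  obtain ⟨D, hD, hdoub⟩ := hv.exists_le
  refine ⟨v.muckenhouptOne ^ 2 * D, ENNReal.mul_ne_top (ENNReal.pow_ne_top hM.ne) hD,
    fun r hr hr1 => ?_⟩
  set a := ∫⁻ s in Ioo r 1, v.hat s / ENNReal.ofReal ((1 - s) ^ 2) with ha
  have hr0 : 0 < r := by linarith
  have hab := mul_le_sq_of_rpow_half_mul_le (le_iSup₂ (f := fun r (_ : r ∈ Ioo (0 : ℝ) 1) =>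
    (∫⁻ s in Ioo r 1, v.hat s / ENNReal.ofReal ((1 - s) ^ 2)) ^ (1 / 2 : ℝ) *
      (∫⁻ s in Ioo 0 r, 1 / v.hat s) ^ (1 / 2 : ℝ)) r ⟨hr0, hr1⟩)
  change _ ≤ v.muckenhouptOne ^ 2 at hab
  have hpos := v.hat_pos hr0.le hr1
  have hDpos : D ≠ 0 := by
    rintro rfl
    have := hdoub r ⟨hr0, hr1⟩
    rw [zero_mul] at this
    exact hpos.not_ge this
  have hb : ENNReal.ofReal (1 - r) / (D * v.hat r) ≤ ∫⁻ s in Ioo 0 r, 1 / v.hat s := by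
    calc ENNReal.ofReal (1 - r) / (D * v.hat r)
        = ∫⁻ _ in Ioo (2 * r - 1) r, 1 / (D * v.hat r) := by
          rw [setLIntegral_const, Real.volume_Ioo, one_div, mul_comm (D * v.hat r)⁻¹,
            div_eq_mul_inv]
          congr 2; ring
      _ ≤ ∫⁻ s in Ioo (2 * r - 1) r, 1 / v.hat s := by
          refine setLIntegral_mono_ae' measurableSet_Ioo (Eventually.of_forall fun s hs => ?_)
          refine ENNReal.div_le_div_left ?_ _
          refine (hdoub s ⟨by linarith [hs.1], by linarith [hs.2]⟩).trans ?_
          gcongr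
          exact v.hat_antitone (by linarith [hs.1])
      _ ≤ _ := lintegral_mono_set (Ioo_subset_Ioo_left (by linarith))
  have hfin : D * v.hat r ≠ ⊤ := ENNReal.mul_ne_top hD (v.hat_ne_top hr0)
  have hne : D * v.hat r ≠ 0 := mul_ne_zero hDpos hpos.ne'
  calc ENNReal.ofReal (1 - r) * a
      = (a * (ENNReal.ofReal (1 - r) / (D * v.hat r))) * (D * v.hat r) := by
        rw [mul_assoc, ENNReal.div_mul_cancel hne hfin, mul_comm]
    _ ≤ v.muckenhouptOne ^ 2 * (D * v.hat r) := by
        gcongr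
        exact (mul_le_mul_right hb a).trans hab
    _ = _ := by ring

/-- Here the second factor is bounded below over `(r, (1 + r) / 2)`, where `1 - s ≥ (1 - r) / 2`.
Monotonicity of the tail suffices, without doubling; the constant is `8 = 4 * 2`. -/
theorem RadialWeight.exists_head_le {v : RadialWeight} (hM : v.muckenhouptTwo < ⊤) :
    ∃ C : ℝ≥0∞, C ≠ ⊤ ∧ ∀ r ∈ Ioo (0 : ℝ) 1,
      ENNReal.ofReal ((1 - r) ^ 3) * ∫⁻ s in Ioo 0 r, v.hat s / ENNReal.ofReal ((1 - s) ^ 4)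
        ≤ C * v.hat r := by
  refine ⟨8 * v.muckenhouptTwo ^ 2, ENNReal.mul_ne_top (by simp) (ENNReal.pow_ne_top hM.ne),
    fun r hr => ?_⟩
  obtain ⟨hr0, hr1⟩ := hr
  set a := ∫⁻ s in Ioo 0 r, v.hat s / ENNReal.ofReal ((1 - s) ^ 4) with ha
  have hab := mul_le_sq_of_rpow_half_mul_le (le_iSup₂ (f := fun r (_ : r ∈ Ioo (0 : ℝ) 1) =>
    (∫⁻ s in Ioo 0 r, v.hat s / ENNReal.ofReal ((1 - s) ^ 4)) ^ (1 / 2 : ℝ) *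
      (∫⁻ s in Ioo r 1, ENNReal.ofReal ((1 - s) ^ 2) / v.hat s) ^ (1 / 2 : ℝ)) r ⟨hr0, hr1⟩)
  change _ ≤ v.muckenhouptTwo ^ 2 at hab
  have hpos := v.hat_pos hr0.le hr1
  have hb : ENNReal.ofReal ((1 - r) ^ 3) / 8 / v.hat r ≤
      ∫⁻ s in Ioo r 1, ENNReal.ofReal ((1 - s) ^ 2) / v.hat s := by
    calc ENNReal.ofReal ((1 - r) ^ 3) / 8 / v.hat r
        = ∫⁻ _ in Ioo r ((1 + r) / 2), ENNReal.ofReal ((1 - r) ^ 2 / 4) / v.hat r := by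
          rw [setLIntegral_const, Real.volume_Ioo, div_eq_mul_inv, div_eq_mul_inv _ (v.hat r),
            mul_right_comm, ← ENNReal.ofReal_mul (by positivity)]
          congr 1
          rw [show (8 : ℝ≥0∞) = ENNReal.ofReal 8 by norm_num, ← ENNReal.ofReal_div_of_pos (by norm_num)]
          congr 1; ring
      _ ≤ ∫⁻ s in Ioo r ((1 + r) / 2), ENNReal.ofReal ((1 - s) ^ 2) / v.hat s := by
          refine setLIntegral_mono_ae' measurableSet_Ioo (Eventually.of_forall fun s hs => ?_)
          refine ENNReal.div_le_div (ENNReal.ofReal_le_ofReal ?_) (v.hat_antitone hs.1.le)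
          nlinarith [hs.1, hs.2]
      _ ≤ _ := lintegral_mono_set (Ioo_subset_Ioo_right (by linarith))
  have hfin := v.hat_ne_top hr0
  calc ENNReal.ofReal ((1 - r) ^ 3) * a
      = 8 * ((a * (ENNReal.ofReal ((1 - r) ^ 3) / 8 / v.hat r)) * v.hat r) := by
        rw [mul_assoc a, ENNReal.div_mul_cancel hpos.ne' hfin, mul_comm a, ← mul_assoc,
          ENNReal.mul_div_cancel (by norm_num) (by simp)]
    _ ≤ 8 * (v.muckenhouptTwo ^ 2 * v.hat r) := by
        gcongr
        exact (mul_le_mul_right hb a).trans hab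
    _ = _ := by ring

/-! ### Moments compared with tails at the nodes -/

theorem ofReal_pow_eq_lintegral (n : ℕ) {r : ℝ} (hr : 0 ≤ r) :
    ENNReal.ofReal (r ^ (2 * n + 1)) =
      ENNReal.ofReal (2 * n + 1) * ∫⁻ s in Ioo 0 r, ENNReal.ofReal (s ^ (2 * n)) := by
  rw [restrict_Ioo_eq_restrict_Ioc, ← ofReal_integral_eq_lintegral_ofReal,
    ← intervalIntegral.integral_of_le hr, integral_pow, ← ENNReal.ofReal_mul (by positivity)]
  · congr 1
    push_cast
    field_simp
    simp
  · exact (continuous_pow (2 * n)).integrableOn_Icc.mono_set Ioc_subset_Icc_self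
  · exact Eventually.of_forall fun s => (even_two_mul n).pow_nonneg s

/-- Tonelli on the triangle `s < r`, after writing `r^(2n+1)` as the integral of its derivative. -/
theorem RadialWeight.moment_eq_hat (v : RadialWeight) (n : ℕ) :
    v.moment n = 2 * ENNReal.ofReal (2 * n + 1) *
      ∫⁻ s in Ioo (0 : ℝ) 1, ENNReal.ofReal (s ^ (2 * n)) * v.hat s := by
  have hT : MeasurableSet {p : ℝ × ℝ | p.2 < p.1} := measurableSet_lt measurable_snd measurable_fst
  let F : ℝ → ℝ → ℝ≥0∞ := fun r s =>
    {p : ℝ × ℝ | p.2 < p.1}.indicator (fun p => ENNReal.ofReal (p.2 ^ (2 * n)) * v.ray p.1) (r, s)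
  have hF : AEMeasurable (Function.uncurry F)
      ((volume.restrict (Ioo (0 : ℝ) 1)).prod (volume.restrict (Ioo (0 : ℝ) 1))) := by
    refine AEMeasurable.indicator ?_ hT
    exact (by fun_prop : Measurable fun p : ℝ × ℝ => ENNReal.ofReal (p.2 ^ (2 * n))).aemeasurable.mul
      v.aemeasurable_ray.comp_fst
  have h1 : ∀ r ∈ Ioo (0 : ℝ) 1, ∫⁻ s in Ioo (0 : ℝ) 1, F r s =
      (∫⁻ s in Ioo 0 r, ENNReal.ofReal (s ^ (2 * n))) * v.ray r := by
    intro r hr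
    rw [← lintegral_mul_const _ (by fun_prop),
      ← lintegral_indicator measurableSet_Ioo, ← lintegral_indicator measurableSet_Ioo]
    refine lintegral_congr fun s => ?_
    simp only [F, indicator, mem_Ioo, mem_ofPred_eq]
    have := hr.2
    split_ifs <;> first | rfl | (exfalso; grind)
  have h2 : ∀ s ∈ Ioo (0 : ℝ) 1, ∫⁻ r in Ioo (0 : ℝ) 1, F r s =
      ENNReal.ofReal (s ^ (2 * n)) * v.hat s := by
    intro s hs
    rw [v.hat_eq, ← lintegral_const_mul' _ _ ENNReal.ofReal_ne_top,
      ← lintegral_indicator measurableSet_Ioo, ← lintegral_indicator measurableSet_Ioo]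
    refine lintegral_congr fun r => ?_
    simp only [F, indicator, mem_Ioo, mem_ofPred_eq]
    have := hs.1
    split_ifs <;> first | rfl | (exfalso; grind)
  rw [← setLIntegral_congr_fun measurableSet_Ioo h2, ← lintegral_lintegral_swap hF,
    setLIntegral_congr_fun measurableSet_Ioo h1, RadialWeight.moment, mul_assoc,
    ← lintegral_const_mul' _ _ ENNReal.ofReal_ne_top]
  congr 1
  refine setLIntegral_congr_fun measurableSet_Ioo fun r hr => ?_
  simp only [ofReal_pow_eq_lintegral n hr.1.le]
  ring

/-- With `t = √s` the left side is the fourth power of `(n+1)(1-t)tⁿ(1+t)`. The first three factors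
multiply to at most `1`, because `(n+1)tⁿ ≤ 1 + t + ⋯ + tⁿ`. The fourth power matches the weight
`(1-s)^(-4)` of the second Muckenhoupt condition. -/
theorem pow_mul_le_of_mem_unit (n : ℕ) {s : ℝ} (h0 : 0 ≤ s) (h1 : s ≤ 1) :
    s ^ (2 * n) * ((n + 1) * (1 - s)) ^ 4 ≤ 16 := by
  have key : ∀ t : ℝ, 0 ≤ t → t ≤ 1 → (n + 1) * (1 - t) * t ^ n ≤ 1 := by
    intro t ht0 ht1
    have hg := geom_sum_mul_neg t (n + 1)
    have hle : ((n : ℝ) + 1) * t ^ n ≤ ∑ i ∈ Finset.range (n + 1), t ^ i := by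
      have := Finset.card_nsmul_le_sum (Finset.range (n + 1)) (fun i => t ^ i) (t ^ n)
        (fun i hi => pow_le_pow_of_le_one ht0 ht1 (by grind))
      simpa using this
    nlinarith [mul_le_mul_of_nonneg_right hle (sub_nonneg.2 ht1), pow_nonneg ht0 (n + 1)]
  set t := Real.sqrt s with ht
  have ht0 : 0 ≤ t := Real.sqrt_nonneg s
  have hts : t ^ 2 = s := Real.sq_sqrt h0
  have ht1 : t ≤ 1 := Real.sqrt_le_one.2 h1
  have hk := key t ht0 ht1
  have hpn : 0 ≤ t ^ n := pow_nonneg ht0 n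
  have hn : (0 : ℝ) ≤ n + 1 := by positivity
  have hx : (n + 1) * (1 - t) * t ^ n * (1 + t) ≤ 2 := by
    have : 0 ≤ (n + 1) * (1 - t) * t ^ n := by
      have := sub_nonneg.2 ht1; positivity
    nlinarith
  have hx0 : 0 ≤ (n + 1) * (1 - t) * t ^ n * (1 + t) := by
    have := sub_nonneg.2 ht1; positivity
  calc s ^ (2 * n) * ((n + 1) * (1 - s)) ^ 4 = ((n + 1) * (1 - t) * t ^ n * (1 + t)) ^ 4 := by
        rw [← hts]; ring
    _ ≤ 2 ^ 4 := by gcongr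
    _ = 16 := by norm_num

/-- The radii `m / (m + 1)`. -/
noncomputable def node (m : ℕ) : ℝ := m / (m + 1)

theorem one_sub_node (m : ℕ) : 1 - node m = 1 / (m + 1) := by
  unfold node; field_simp; ring

theorem node_nonneg (m : ℕ) : 0 ≤ node m := by unfold node; positivity

theorem node_succ_pos (m : ℕ) : 0 < node (m + 1) := by unfold node; positivity

theorem node_lt_one (m : ℕ) : node m < 1 := by
  have h := one_sub_node m
  have : (0 : ℝ) < 1 / (m + 1) := by positivity
  linarith

theorem node_monotone : Monotone node := by
  intro m n h
  have h1 := one_sub_node m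
  have h2 := one_sub_node n
  have : (1 : ℝ) / (n + 1) ≤ 1 / (m + 1) := by gcongr
  linarith

theorem node_succ_sub (m : ℕ) : node (m + 1) - node m = 1 / ((m + 1) * (m + 2)) := by
  unfold node; push_cast; field_simp; ring

theorem half_le_node_succ (m : ℕ) : 1 / 2 ≤ node (m + 1) := by
  have h := one_sub_node (m + 1)
  have : (1 : ℝ) / ((m + 1 : ℕ) + 1) ≤ 1 / 2 := by gcongr; push_cast; linarith
  linarith

theorem one_le_nine_mul_node_pow (n : ℕ) : (1 : ℝ) ≤ 9 * node (n + 1) ^ (2 * n + 1) := by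
  have hx : (node (n + 1))⁻¹ ≤ Real.exp (1 / (n + 1)) := by
    have := Real.add_one_le_exp (1 / ((n : ℝ) + 1))
    refine le_trans (le_of_eq ?_) this
    unfold node; push_cast; field_simp; ring
  have hy : ((node (n + 1))⁻¹) ^ (2 * n + 1) ≤ 9 := by
    calc ((node (n + 1))⁻¹) ^ (2 * n + 1) ≤ Real.exp (1 / (n + 1)) ^ (2 * n + 1) := by
          have := node_nonneg (n + 1)
          gcongr
      _ = Real.exp ((2 * n + 1 : ℕ) * (1 / (n + 1))) := (Real.exp_nat_mul _ _).symm
      _ ≤ Real.exp 2 := by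
          refine Real.exp_le_exp.2 ?_
          push_cast
          rw [mul_one_div, div_le_iff₀ (by positivity)]
          linarith
      _ = Real.exp 1 ^ 2 := by rw [← Real.exp_nat_mul]; norm_num
      _ ≤ 3 ^ 2 := by gcongr; linarith [Real.exp_one_lt_d9]
      _ = 9 := by norm_num
  have hp : 0 < node (n + 1) ^ (2 * n + 1) := pow_pos (node_succ_pos n) _
  rw [inv_pow, inv_le_iff_one_le_mul₀ hp] at hy
  exact hy

/-- On `(node (n+1), 1)` the factor `r^(2n+1)` stays above `1/9`. The shift from `n` to `n + 1`
excludes the node `0`, where the tail may be infinite, and keeps the nodes at least `1/2`. -/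
theorem RadialWeight.hat_node_le_moment (v : RadialWeight) (n : ℕ) :
    v.hat (node (n + 1)) ≤ 9 * v.moment n := by
  have h1 := one_le_nine_mul_node_pow n
  calc v.hat (node (n + 1)) = 1 * v.hat (node (n + 1)) := (one_mul _).symm
    _ ≤ (9 * (2 * ENNReal.ofReal (node (n + 1) ^ (2 * n + 1)))) * v.hat (node (n + 1)) := by
        gcongr
        rw [show (9 : ℝ≥0∞) * (2 * ENNReal.ofReal (node (n + 1) ^ (2 * n + 1))) =
          ENNReal.ofReal (9 * (2 * node (n + 1) ^ (2 * n + 1))) by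
            rw [ENNReal.ofReal_mul (by norm_num), ENNReal.ofReal_mul (by norm_num)]; norm_num,
          ← ENNReal.ofReal_one]
        refine ENNReal.ofReal_le_ofReal ?_
        linarith
    _ ≤ 9 * v.moment n := by
        rw [mul_assoc]
        gcongr
        exact v.mul_hat_le_moment n (node_nonneg _)

/-- The integral of `s^(2n)` against the tail is split at the node. Below it, `s^(2n)` is dominated
by `16 / ((n+1)(1-s))⁴` and the head estimate applies; above it, the tail is at most its value at
the node. -/
theorem RadialWeight.exists_moment_le {v : RadialWeight} (hM : v.muckenhouptTwo < ⊤) :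
    ∃ C : ℝ≥0∞, C ≠ ⊤ ∧ ∀ n, v.moment n ≤ C * v.hat (node (n + 1)) := by
  obtain ⟨C, hC, hhead⟩ := v.exists_head_le hM
  refine ⟨2 * (256 * C + 2), by finiteness, fun n => ?_⟩
  set a := node (n + 1) with ha
  have ha0 : 0 < a := node_succ_pos n
  have ha1 : a < 1 := node_lt_one _
  have ha2 : 1 - a = 1 / (n + 2) := by rw [ha, one_sub_node]; push_cast; ring
  set J := ∫⁻ s in Ioo 0 a, v.hat s / ENNReal.ofReal ((1 - s) ^ 4) with hJ
  have hJle : ENNReal.ofReal ((1 - a) ^ 3) * J ≤ C * v.hat a := hhead a ⟨ha0, ha1⟩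
  have hI1 : ∫⁻ s in Ioo 0 a, ENNReal.ofReal (s ^ (2 * n)) * v.hat s ≤
      ENNReal.ofReal (16 / (n + 1) ^ 4) * J := by
    rw [hJ, ← lintegral_const_mul' _ _ ENNReal.ofReal_ne_top]
    refine setLIntegral_mono_ae' measurableSet_Ioo (Eventually.of_forall fun s hs => ?_)
    have hs1 : 0 < 1 - s := by linarith [hs.2]
    rw [div_eq_mul_inv (v.hat s), ← ENNReal.ofReal_inv_of_pos (by positivity), mul_left_comm,
      ← ENNReal.ofReal_mul (by positivity), mul_comm]
    refine mul_le_mul_right (ENNReal.ofReal_le_ofReal ?_) _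
    rw [← div_eq_mul_inv, div_div, ← mul_pow, le_div_iff₀ (by positivity)]
    exact pow_mul_le_of_mem_unit n hs.1.le (by linarith)
  have hI2 : ∫⁻ s in Ico a 1, ENNReal.ofReal (s ^ (2 * n)) * v.hat s ≤
      v.hat a * ENNReal.ofReal (1 - a) := by
    rw [← Real.volume_Ico, ← setLIntegral_const]
    refine setLIntegral_mono_ae' measurableSet_Ico (Eventually.of_forall fun s hs => ?_)
    have h0 : 0 ≤ s := ha0.le.trans hs.1
    calc ENNReal.ofReal (s ^ (2 * n)) * v.hat s ≤ 1 * v.hat a := by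
          refine mul_le_mul' ?_ (v.hat_antitone hs.1)
          rw [← ENNReal.ofReal_one]
          exact ENNReal.ofReal_le_ofReal (pow_le_one₀ h0 hs.2.le)
      _ = v.hat a := one_mul _
  have hsplit : ∫⁻ s in Ioo (0 : ℝ) 1, ENNReal.ofReal (s ^ (2 * n)) * v.hat s ≤
      (∫⁻ s in Ioo 0 a, ENNReal.ofReal (s ^ (2 * n)) * v.hat s) +
        ∫⁻ s in Ico a 1, ENNReal.ofReal (s ^ (2 * n)) * v.hat s := by
    rw [← Ioo_union_Ico_eq_Ioo ha0 ha1.le]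
    exact lintegral_union_le _ _ _
  have e1 : ENNReal.ofReal (2 * n + 1) * ENNReal.ofReal (16 / (n + 1) ^ 4) ≤
      256 * ENNReal.ofReal ((1 - a) ^ 3) := by
    rw [show (256 : ℝ≥0∞) = ENNReal.ofReal 256 by norm_num, ← ENNReal.ofReal_mul (by positivity),
      ← ENNReal.ofReal_mul (by positivity), ha2]
    refine ENNReal.ofReal_le_ofReal ?_
    rw [div_pow, mul_div_assoc', mul_div_assoc', div_le_div_iff₀ (by positivity) (by positivity)]
    have hn : (0 : ℝ) ≤ n := n.cast_nonneg
    have h3 : ((n : ℝ) + 2) ^ 3 ≤ (2 * (n + 1)) ^ 3 := by gcongr; linarith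
    calc (2 * (n : ℝ) + 1) * 16 * ((n : ℝ) + 2) ^ 3
        ≤ (2 * ((n : ℝ) + 1)) * 16 * (2 * ((n : ℝ) + 1)) ^ 3 := by
          gcongr; linarith
      _ = 256 * 1 ^ 3 * ((n : ℝ) + 1) ^ 4 := by ring
  have e2 : ENNReal.ofReal (2 * n + 1) * ENNReal.ofReal (1 - a) ≤ 2 := by
    rw [← ENNReal.ofReal_mul (by positivity), ha2, show (2 : ℝ≥0∞) = ENNReal.ofReal 2 by norm_num]
    refine ENNReal.ofReal_le_ofReal ?_
    rw [mul_one_div, div_le_iff₀ (by positivity)]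
    linarith
  rw [v.moment_eq_hat, mul_assoc, mul_assoc]
  refine mul_le_mul_right ?_ _
  calc ENNReal.ofReal (2 * n + 1) * ∫⁻ s in Ioo (0 : ℝ) 1, ENNReal.ofReal (s ^ (2 * n)) * v.hat s
      ≤ ENNReal.ofReal (2 * n + 1) * (ENNReal.ofReal (16 / (n + 1) ^ 4) * J +
          v.hat a * ENNReal.ofReal (1 - a)) := by
        gcongr
        exact hsplit.trans (add_le_add hI1 hI2)
    _ = (ENNReal.ofReal (2 * n + 1) * ENNReal.ofReal (16 / (n + 1) ^ 4)) * J +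
          (ENNReal.ofReal (2 * n + 1) * ENNReal.ofReal (1 - a)) * v.hat a := by ring
    _ ≤ 256 * ENNReal.ofReal ((1 - a) ^ 3) * J + 2 * v.hat a := by gcongr
    _ ≤ 256 * (C * v.hat a) + 2 * v.hat a := by rw [mul_assoc]; gcongr
    _ = (256 * C + 2) * v.hat a := by ring

/-! ### Doubling and summation inequalities for the moments -/

theorem sum_lintegral_Ioo_le {b : ℕ → ℝ} (hb : Monotone b) (f : ℝ → ℝ≥0∞) (n N : ℕ) :
    ∑ m ∈ Finset.Ico n N, ∫⁻ s in Ioo (b m) (b (m + 1)), f s ≤ ∫⁻ s in Ioo (b n) (b N), f s := by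
  have hd : (↑(Finset.Ico n N) : Set ℕ).PairwiseDisjoint fun m => Ioo (b m) (b (m + 1)) :=
    fun i _ j _ hij => hb.pairwise_disjoint_on_Ioo_succ hij
  rw [← lintegral_biUnion_finset hd (fun _ _ => measurableSet_Ioo)]
  refine lintegral_mono_set (iUnion₂_subset fun i hi => ?_)
  rw [Finset.mem_Ico] at hi
  exact Ioo_subset_Ioo (hb hi.1) (hb hi.2)

/-- Between consecutive nodes `1/(1-s) ≥ m + 1`, and the gap is `1/((m+1)(m+2))`; the factor `2`
absorbs `(m+2)/(m+1)`. The case `p = 0` serves the tail sums and `p = 2` the head sums. -/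
theorem RadialWeight.hat_node_succ_le (v : RadialWeight) (m p : ℕ) :
    ENNReal.ofReal (((m : ℝ) + 1) ^ p) * v.hat (node (m + 1)) ≤
      2 * ∫⁻ s in Ioo (node m) (node (m + 1)), v.hat s / ENNReal.ofReal ((1 - s) ^ (p + 2)) := by
  have hle : v.hat (node (m + 1)) * ENNReal.ofReal (((m : ℝ) + 1) ^ (p + 2)) *
      ENNReal.ofReal (1 / ((m + 1) * (m + 2))) ≤
      ∫⁻ s in Ioo (node m) (node (m + 1)), v.hat s / ENNReal.ofReal ((1 - s) ^ (p + 2)) := by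
    rw [← node_succ_sub, ← Real.volume_Ioo, ← setLIntegral_const]
    refine setLIntegral_mono_ae' measurableSet_Ioo (Eventually.of_forall fun s hs => ?_)
    have hs1 : 0 < 1 - s := by linarith [hs.2, node_lt_one (m + 1)]
    rw [div_eq_mul_inv, ← ENNReal.ofReal_inv_of_pos (by positivity), ← inv_pow]
    refine mul_le_mul' (v.hat_antitone hs.2.le) (ENNReal.ofReal_le_ofReal ?_)
    gcongr
    rw [le_inv_comm₀ (by positivity) hs1, ← one_div, ← one_sub_node]
    linarith [hs.1]
  refine le_trans ?_ (mul_le_mul_right hle 2)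
  rw [mul_assoc, ← ENNReal.ofReal_mul (by positivity), mul_left_comm, mul_comm]
  refine mul_le_mul_right ?_ _
  rw [show (2 : ℝ≥0∞) = ENNReal.ofReal 2 by norm_num, ← ENNReal.ofReal_mul (by positivity)]
  refine ENNReal.ofReal_le_ofReal ?_
  have hp : (0 : ℝ) ≤ ((m : ℝ) + 1) ^ p := by positivity
  rw [pow_add, mul_assoc, mul_left_comm]
  refine le_mul_of_one_le_right hp ?_
  rw [mul_one_div, mul_div_assoc', le_div_iff₀ (by positivity)]
  nlinarith [(m.cast_nonneg : (0 : ℝ) ≤ m)]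

theorem RadialWeight.exists_hat_node_succ_le {v : RadialWeight} (hv : v.IsDoubling) :
    ∃ D : ℝ≥0∞, D ≠ ⊤ ∧ ∀ n, ∀ m ≤ 2 * n + 2, v.hat (node (n + 1)) ≤ D * v.hat (node m) := by
  obtain ⟨D, hD, hd⟩ := hv.exists_le
  -- One doubling step from `node (n+1)` leads to `1 - 1/(2n+4)`, which lies beyond every node of
  -- index at most `2n + 2`.
  refine ⟨D, hD, fun n m hm => (hd _ ⟨node_succ_pos n, node_lt_one _⟩).trans ?_⟩
  gcongr
  refine v.hat_antitone ((node_monotone hm).trans ?_)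
  unfold node
  push_cast
  rw [div_le_iff₀ (by positivity), ← sub_nonneg]
  have : (1 + ((n : ℝ) + 1) / (n + 1 + 1)) / 2 * (2 * n + 2 + 1) - (2 * n + 2) =
    1 / (2 * (n + 2)) := by field_simp; ring
  rw [this]; positivity

theorem RadialWeight.exists_moment_le_double {v : RadialWeight} (hv : v.IsDoubling)
    (hM : v.muckenhouptTwo < ⊤) :
    ∃ C : ℝ≥0∞, C ≠ ⊤ ∧ ∀ n, v.moment n ≤ C * v.moment (2 * n + 1) := by
  obtain ⟨C, hC, h1⟩ := v.exists_moment_le hM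
  obtain ⟨D, hD, h2⟩ := v.exists_hat_node_succ_le hv
  refine ⟨C * (D * 9), by finiteness, fun n => ?_⟩
  calc v.moment n ≤ C * (D * (9 * v.moment (2 * n + 1))) := by
        refine (h1 n).trans ?_
        gcongr
        refine (h2 n (2 * n + 1 + 1) le_rfl).trans ?_
        gcongr
        exact v.hat_node_le_moment _
    _ = _ := by ring

theorem RadialWeight.exists_sum_moment_le {v : RadialWeight} (hv : v.IsDoubling)
    (hM1 : v.muckenhouptOne < ⊤) (hM2 : v.muckenhouptTwo < ⊤) :
    ∃ C : ℝ≥0∞, C ≠ ⊤ ∧ ∀ n N,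
      ∑ m ∈ Finset.Ico n N, v.moment m ≤ C * (ENNReal.ofReal (n + 2) * v.moment n) := by
  obtain ⟨C, hC, h1⟩ := v.exists_moment_le hM2
  obtain ⟨D, hD, h2⟩ := v.exists_hat_node_succ_le hv
  obtain ⟨E, hE, h3⟩ := v.exists_tail_le hv hM1
  refine ⟨C * (D * 2 * (E * 9)), by finiteness, fun n N => ?_⟩
  have hterm : ∀ m, v.moment m ≤ C * (D * (2 * ∫⁻ s in Ioo (node (m + 1)) (node (m + 2)),
      v.hat s / ENNReal.ofReal ((1 - s) ^ 2))) := by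
    intro m
    refine (h1 m).trans ?_
    gcongr
    -- Moving one node outwards by doubling lets the comparison intervals start at `node (n+1)`,
    -- exactly where the tail estimate is applied.
    refine (h2 m (m + 2) (by omega)).trans ?_
    gcongr
    simpa using v.hat_node_succ_le (m + 1) 0
  have hmono : Monotone fun m => node (m + 1) := fun i j h => node_monotone (by omega)
  have ht : ∫⁻ s in Ioo (node (n + 1)) 1, v.hat s / ENNReal.ofReal ((1 - s) ^ 2) ≤
      ENNReal.ofReal (n + 2) * (E * (9 * v.moment n)) := by
    have h4 := h3 (node (n + 1)) (half_le_node_succ n) (node_lt_one _)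
    have h5 : ENNReal.ofReal (n + 2) * ENNReal.ofReal (1 - node (n + 1)) = 1 := by
      rw [one_sub_node, ← ENNReal.ofReal_mul (by positivity), ← ENNReal.ofReal_one]
      congr 1; push_cast; field_simp; ring
    calc _ = ENNReal.ofReal (n + 2) * (ENNReal.ofReal (1 - node (n + 1)) *
          ∫⁻ s in Ioo (node (n + 1)) 1, v.hat s / ENNReal.ofReal ((1 - s) ^ 2)) := by
          rw [← mul_assoc, h5, one_mul]
      _ ≤ _ := by
          refine mul_le_mul_right (h4.trans ?_) _
          gcongr
          exact v.hat_node_le_moment n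
  calc ∑ m ∈ Finset.Ico n N, v.moment m
      ≤ ∑ m ∈ Finset.Ico n N, C * (D * (2 * ∫⁻ s in Ioo (node (m + 1)) (node (m + 2)),
          v.hat s / ENNReal.ofReal ((1 - s) ^ 2))) := Finset.sum_le_sum fun m _ => hterm m
    _ = C * (D * (2 * ∑ m ∈ Finset.Ico n N, ∫⁻ s in Ioo (node (m + 1)) (node (m + 2)),
          v.hat s / ENNReal.ofReal ((1 - s) ^ 2))) := by simp only [Finset.mul_sum]
    _ ≤ C * (D * (2 * (ENNReal.ofReal (n + 2) * (E * (9 * v.moment n))))) := by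
        gcongr
        refine (sum_lintegral_Ioo_le hmono _ n N).trans ((lintegral_mono_set ?_).trans ht)
        exact Ioo_subset_Ioo_right (node_lt_one _).le
    _ = _ := by ring

theorem RadialWeight.exists_sum_sq_moment_le {v : RadialWeight} (hM2 : v.muckenhouptTwo < ⊤) :
    ∃ C : ℝ≥0∞, C ≠ ⊤ ∧ ∀ n : ℕ,
      ∑ m ∈ Finset.range (n + 1), ENNReal.ofReal (((m : ℝ) + 1) ^ 2) * v.moment m ≤
        C * (ENNReal.ofReal (((n : ℝ) + 2) ^ 3) * v.moment n) := by
  obtain ⟨C, hC, h1⟩ := v.exists_moment_le hM2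
  obtain ⟨E, hE, h3⟩ := v.exists_head_le hM2
  refine ⟨C * (2 * (E * 9)), by finiteness, fun n => ?_⟩
  have hterm : ∀ m : ℕ, ENNReal.ofReal (((m : ℝ) + 1) ^ 2) * v.moment m ≤
      C * (2 * ∫⁻ s in Ioo (node m) (node (m + 1)),
        v.hat s / ENNReal.ofReal ((1 - s) ^ 4)) := by
    intro m
    calc ENNReal.ofReal (((m : ℝ) + 1) ^ 2) * v.moment m
        ≤ ENNReal.ofReal (((m : ℝ) + 1) ^ 2) * (C * v.hat (node (m + 1))) := by
          gcongr; exact h1 m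
      _ = C * (ENNReal.ofReal (((m : ℝ) + 1) ^ 2) * v.hat (node (m + 1))) := by ring
      _ ≤ _ := mul_le_mul_right (v.hat_node_succ_le m 2) _
  have ht : ∫⁻ s in Ioo 0 (node (n + 1)), v.hat s / ENNReal.ofReal ((1 - s) ^ 4) ≤
      ENNReal.ofReal (((n : ℝ) + 2) ^ 3) * (E * (9 * v.moment n)) := by
    have h4 := h3 (node (n + 1)) ⟨node_succ_pos n, node_lt_one _⟩
    have h5 : ENNReal.ofReal (((n : ℝ) + 2) ^ 3) * ENNReal.ofReal ((1 - node (n + 1)) ^ 3) = 1 := by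
      rw [one_sub_node, ← ENNReal.ofReal_mul (by positivity), ← ENNReal.ofReal_one]
      congr 1; push_cast; field_simp; ring
    calc _ = ENNReal.ofReal (((n : ℝ) + 2) ^ 3) * (ENNReal.ofReal ((1 - node (n + 1)) ^ 3) *
          ∫⁻ s in Ioo 0 (node (n + 1)), v.hat s / ENNReal.ofReal ((1 - s) ^ 4)) := by
          rw [← mul_assoc, h5, one_mul]
      _ ≤ _ := by
          refine mul_le_mul_right (h4.trans ?_) _
          gcongr
          exact v.hat_node_le_moment n
  rw [Finset.range_eq_Ico]
  calc ∑ m ∈ Finset.Ico 0 (n + 1), ENNReal.ofReal (((m : ℝ) + 1) ^ 2) * v.moment m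
      ≤ ∑ m ∈ Finset.Ico 0 (n + 1), C * (2 * ∫⁻ s in Ioo (node m) (node (m + 1)),
          v.hat s / ENNReal.ofReal ((1 - s) ^ 4)) := Finset.sum_le_sum fun m _ => hterm m
    _ = C * (2 * ∑ m ∈ Finset.Ico 0 (n + 1), ∫⁻ s in Ioo (node m) (node (m + 1)),
          v.hat s / ENNReal.ofReal ((1 - s) ^ 4)) := by simp only [Finset.mul_sum]
    _ ≤ C * (2 * (ENNReal.ofReal (((n : ℝ) + 2) ^ 3) * (E * (9 * v.moment n)))) := by
        gcongr
        refine (sum_lintegral_Ioo_le node_monotone _ 0 (n + 1)).trans ?_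
        simpa [node] using ht
    _ = _ := by ring

/-! ### Self-improvement of the summation inequalities to power bounds -/

theorem rpow_succ_le {ε : ℝ} (h0 : 0 ≤ ε) (h1 : ε ≤ 1) {x : ℝ} (hx : 0 < x) :
    (x + 1) ^ ε ≤ x ^ ε * (1 + ε / x) := by
  have hi : 0 < x⁻¹ := inv_pos.2 hx
  have h := rpow_one_add_le_one_add_mul_self (s := x⁻¹) (by linarith) h0 h1
  have e : x + 1 = x * (1 + x⁻¹) := by field_simp
  rw [e, Real.mul_rpow hx.le (by linarith), div_eq_mul_inv]
  gcongr

section PowerComparison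

variable {κ : ℕ → ℝ} {A B D : ℝ}

/-- The tail sums `U n` are comparable to `(n+1) κ n`: from above by `hA`, from below by doubling.
With `x = ε/(n+1)`, `hA` gives `x U n ≤ κ n`, so `U (n+1) ≤ (1-x) U n`, while `(n+1)^ε` grows by at
most `1 + x`. Hence `U n (n+1)^ε` decreases. -/
theorem power_comparison_tail (hpos : ∀ n, 0 < κ n) (hanti : Antitone κ)
    (hD : ∀ n, κ n ≤ D * κ (2 * n + 1))
    (hA : ∀ n N, ∑ m ∈ Finset.Ico n N, κ m ≤ A * ((n + 1) * κ n)) {ε : ℝ} (hε0 : 0 ≤ ε)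
    (hε1 : ε ≤ 1) (hεA : ε * A ≤ 1) {n m : ℕ} (hnm : n ≤ m) :
    (m + 1) * κ m * ((m : ℝ) + 1) ^ ε ≤ D * A * ((n + 1) * κ n * ((n : ℝ) + 1) ^ ε) := by
  have hsum : ∀ n, Summable fun k => κ (n + k) := fun n => by
    refine summable_of_sum_range_le (c := A * ((n + 1) * κ n)) (fun k => (hpos _).le) fun N => ?_
    have h := hA n (n + N)
    rwa [Finset.sum_Ico_eq_sum_range, Nat.add_sub_cancel_left] at h
  set U : ℕ → ℝ := fun n => ∑' k, κ (n + k) with hU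
  have hUle : ∀ n : ℕ, U n ≤ A * ((n + 1) * κ n) := fun n => by
    refine (hsum n).tsum_le_of_sum_range_le fun N => ?_
    have h := hA n (n + N)
    rwa [Finset.sum_Ico_eq_sum_range, Nat.add_sub_cancel_left] at h
  have hUsucc : ∀ n, U n = κ n + U (n + 1) := fun n => by
    rw [hU]
    simp only
    rw [(hsum n).tsum_eq_zero_add]
    simp only [add_zero, add_assoc, add_comm 1]
  have hU0 : ∀ n, 0 ≤ U n := fun n => tsum_nonneg fun k => (hpos _).le
  have hD0 : 0 ≤ D := by
    by_contra hcon
    nlinarith [hD 0, hpos 0, hpos (2 * 0 + 1)]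
  have hanti' : Antitone fun n : ℕ => U n * ((n : ℝ) + 1) ^ ε := by
    refine antitone_nat_of_succ_le fun n => ?_
    have hn : (0 : ℝ) < n + 1 := by positivity
    have h1 := rpow_succ_le hε0 hε1 hn
    have hp : 0 < ((n : ℝ) + 1) ^ ε := by positivity
    set x := ε / ((n : ℝ) + 1) with hx
    have hx0 : 0 ≤ x := by positivity
    have h2 : x * U n ≤ κ n := by
      calc x * U n ≤ x * (A * ((n + 1) * κ n)) := by gcongr; exact hUle n
        _ = (ε * A) * κ n := by rw [hx]; field_simp
        _ ≤ 1 * κ n := by gcongr; exact (hpos n).le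
        _ = κ n := one_mul _
    have h3 : U (n + 1) ≤ U n * (1 - x) := by linarith [hUsucc n]
    push_cast
    calc U (n + 1) * ((n : ℝ) + 1 + 1) ^ ε ≤ U (n + 1) * (((n : ℝ) + 1) ^ ε * (1 + x)) := by
          gcongr; exact hU0 _
      _ ≤ (U n * (1 - x)) * (((n : ℝ) + 1) ^ ε * (1 + x)) := by gcongr
      _ = U n * ((n : ℝ) + 1) ^ ε * (1 - x ^ 2) := by ring
      _ ≤ U n * ((n : ℝ) + 1) ^ ε * 1 := by
          have := hU0 n
          gcongr
          linarith [sq_nonneg x]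
      _ = _ := mul_one _
  have hlow : (m + 1) * κ m ≤ D * U m := by
    have h1 : ((m : ℝ) + 1) * κ (2 * m + 1) ≤ U m := by
      have h2 : ∑ k ∈ Finset.range (m + 1), κ (m + k) ≤ U m :=
        (hsum m).sum_le_tsum _ fun k _ => (hpos _).le
      have h3 := Finset.card_nsmul_le_sum (Finset.range (m + 1)) (fun k => κ (m + k))
        (κ (2 * m + 1)) (fun k hk => hanti (by have := Finset.mem_range.1 hk; omega))
      rw [Finset.card_range, nsmul_eq_mul] at h3
      push_cast at h3
      linarith
    calc (m + 1) * κ m ≤ (m + 1) * (D * κ (2 * m + 1)) := by gcongr; exact hD m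
      _ = D * ((m + 1) * κ (2 * m + 1)) := by ring
      _ ≤ _ := by gcongr
  calc (m + 1) * κ m * ((m : ℝ) + 1) ^ ε ≤ D * U m * ((m : ℝ) + 1) ^ ε := by gcongr
    _ = D * (U m * ((m : ℝ) + 1) ^ ε) := by ring
    _ ≤ D * (U n * ((n : ℝ) + 1) ^ ε) := by gcongr D * ?_; exact hanti' hnm
    _ ≤ D * (A * ((n + 1) * κ n) * ((n : ℝ) + 1) ^ ε) := by gcongr; exact hUle n
    _ = _ := by ring

/-- The mirror image, with partial sums `V n` that grow by at least the factor `1 + ε/(n+2)`, so `V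
n / (n+2)^ε` increases. Monotonicity of `κ` replaces doubling in the lower bound `V n ≥ (n+1)³ κ n /
3`; the constant `6` is this `3` times the cost of replacing `n + 2` by `n + 1`. -/
theorem power_comparison_head (hpos : ∀ n, 0 < κ n) (hanti : Antitone κ)
    (hB : ∀ n : ℕ, ∑ m ∈ Finset.range (n + 1), ((m : ℝ) + 1) ^ 2 * κ m ≤
      B * (((n : ℝ) + 1) ^ 3 * κ n)) {ε : ℝ} (hε0 : 0 ≤ ε)
    (hε1 : ε ≤ 1) (hεB : ε * B ≤ 1) (hB0 : 0 ≤ B) {n m : ℕ} (hnm : n ≤ m) :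
    ((n : ℝ) + 1) ^ 3 * κ n * ((m : ℝ) + 1) ^ ε ≤
      6 * B * (((m : ℝ) + 1) ^ 3 * κ m * ((n : ℝ) + 1) ^ ε) := by
  set V : ℕ → ℝ := fun n => ∑ m ∈ Finset.range (n + 1), ((m : ℝ) + 1) ^ 2 * κ m with hV
  have hV0 : ∀ n, 0 ≤ V n := fun n => Finset.sum_nonneg fun k _ => by have := hpos k; positivity
  have hVsucc : ∀ n : ℕ, V (n + 1) = V n + ((n : ℝ) + 2) ^ 2 * κ (n + 1) := fun n => by
    rw [hV]
    simp only
    rw [Finset.sum_range_succ]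
    push_cast
    ring
  have hmono : Monotone fun n : ℕ => V n / ((n : ℝ) + 2) ^ ε := by
    refine monotone_nat_of_le_succ fun n => ?_
    have hn : (0 : ℝ) < n + 2 := by positivity
    have h1 := rpow_succ_le hε0 hε1 hn
    push_cast
    rw [div_le_div_iff₀ (by positivity) (by positivity)]
    set x := ε / ((n : ℝ) + 2) with hx
    have hx0 : 0 ≤ x := by positivity
    have h2 : x * V (n + 1) ≤ ((n : ℝ) + 2) ^ 2 * κ (n + 1) := by
      have hb := hB (n + 1)
      push_cast at hb
      have hk := hpos (n + 1)
      calc x * V (n + 1) ≤ x * (B * (((n : ℝ) + 1 + 1) ^ 3 * κ (n + 1))) := by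
            gcongr
        _ = (ε * B) * (((n : ℝ) + 2) ^ 2 * κ (n + 1)) := by
            rw [hx]; field_simp; ring
        _ ≤ 1 * (((n : ℝ) + 2) ^ 2 * κ (n + 1)) := by gcongr
        _ = _ := one_mul _
    have h3 : V n ≤ V (n + 1) := by
      have := hVsucc n
      have hk := hpos (n + 1)
      have : 0 ≤ ((n : ℝ) + 2) ^ 2 * κ (n + 1) := by positivity
      linarith
    have h4 : V n * (1 + x) ≤ V (n + 1) := by
      have := mul_le_mul_of_nonneg_left h3 hx0
      linarith [hVsucc n]
    calc V n * ((n : ℝ) + 1 + 2) ^ ε = V n * ((n : ℝ) + 2 + 1) ^ ε := by ring_nf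
      _ ≤ V n * (((n : ℝ) + 2) ^ ε * (1 + x)) := by gcongr; exact hV0 n
      _ = V n * (1 + x) * ((n : ℝ) + 2) ^ ε := by ring
      _ ≤ _ := by gcongr
  have hlow : ((n : ℝ) + 1) ^ 3 * κ n ≤ 3 * V n := by
    have h1 : ∀ n : ℕ, ((n : ℝ) + 1) ^ 3 ≤ 3 * ∑ m ∈ Finset.range (n + 1), ((m : ℝ) + 1) ^ 2 := by
      intro n
      induction n with
      | zero => simp
      | succ k ih =>
        rw [Finset.sum_range_succ]
        push_cast
        nlinarith [(k.cast_nonneg : (0 : ℝ) ≤ k)]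
    have h2 : (∑ m ∈ Finset.range (n + 1), ((m : ℝ) + 1) ^ 2) * κ n ≤ V n := by
      rw [Finset.sum_mul]
      refine Finset.sum_le_sum fun k hk => ?_
      gcongr
      exact hanti (by have := Finset.mem_range.1 hk; omega)
    have := mul_le_mul_of_nonneg_right (h1 n) (hpos n).le
    linarith
  have hcmp := hmono hnm
  simp only at hcmp
  rw [div_le_div_iff₀ (by positivity) (by positivity)] at hcmp
  have h2n : ((n : ℝ) + 2) ^ ε ≤ 2 * ((n : ℝ) + 1) ^ ε := by
    calc ((n : ℝ) + 2) ^ ε ≤ (2 * ((n : ℝ) + 1)) ^ ε := by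
          gcongr
          linarith [(n.cast_nonneg : (0 : ℝ) ≤ n)]
      _ = 2 ^ ε * ((n : ℝ) + 1) ^ ε := Real.mul_rpow (by norm_num) (by positivity)
      _ ≤ 2 * ((n : ℝ) + 1) ^ ε := by
          gcongr
          simpa using Real.rpow_le_rpow_of_exponent_le (x := 2) (by norm_num) hε1
  have hVn := hV0 n
  have hVm := hV0 m
  calc ((n : ℝ) + 1) ^ 3 * κ n * ((m : ℝ) + 1) ^ ε ≤ 3 * V n * ((m : ℝ) + 2) ^ ε := by
        gcongr
        norm_num
    _ = 3 * (V n * ((m : ℝ) + 2) ^ ε) := by ring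
    _ ≤ 3 * (V m * ((n : ℝ) + 2) ^ ε) := by gcongr
    _ ≤ 3 * (B * (((m : ℝ) + 1) ^ 3 * κ m) * (2 * ((n : ℝ) + 1) ^ ε)) := by
        have hb := hB m
        have hk := hpos m
        gcongr
    _ = _ := by ring

end PowerComparison

/-! ### The kernel bound for the Hilbert matrix -/

/-- The kernel `(min / max) ^ δ` on the positive integers, shifted by one. -/
noncomputable def ratioKernel (δ : ℝ) (n m : ℕ) : ℝ :=
  if n ≤ m then (((n : ℝ) + 1) / (m + 1)) ^ δ else (((m : ℝ) + 1) / (n + 1)) ^ δ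

theorem ratioKernel_pos (δ : ℝ) (n m : ℕ) : 0 < ratioKernel δ n m := by
  unfold ratioKernel; split_ifs <;> positivity

theorem ratioKernel_comm (δ : ℝ) (n m : ℕ) : ratioKernel δ n m = ratioKernel δ m n := by
  unfold ratioKernel
  rcases lt_trichotomy n m with h | h | h
  · simp [h.le, h.not_ge]
  · simp [h]
  · simp [h.le, h.not_ge]

theorem ratioKernel_sq (δ : ℝ) (n m : ℕ) : ratioKernel δ n m ^ 2 = ratioKernel (2 * δ) n m := by
  unfold ratioKernel
  split_ifs <;> rw [mul_comm, Real.rpow_mul (by positivity), Real.rpow_two]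

theorem ratioKernel_le_one {δ : ℝ} (hδ : 0 ≤ δ) (n m : ℕ) : ratioKernel δ n m ≤ 1 := by
  unfold ratioKernel
  split_ifs with h
  · refine Real.rpow_le_one (by positivity) ?_ hδ
    rw [div_le_one (by positivity)]
    exact_mod_cast Nat.succ_le_succ h
  · refine Real.rpow_le_one (by positivity) ?_ hδ
    rw [div_le_one (by positivity)]
    exact_mod_cast Nat.succ_le_succ (not_le.1 h).le

/-- The weights `1, κ 0, 4 κ 1, 9 κ 2, …` of the coefficients in the Dirichlet norm. -/
noncomputable def coeffWeight (κ : ℕ → ℝ) : ℕ → ℝ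
  | 0 => 1
  | n + 1 => ((n : ℝ) + 1) ^ 2 * κ n

/-- The regularity of a weight sequence that makes the Hilbert matrix a bounded operator. -/
def IsHilbertRegular (W : ℕ → ℝ) (C δ : ℝ) : Prop :=
  (∀ n, 0 < W n) ∧ 0 < C ∧ 0 < δ ∧ δ ≤ 1 ∧ ∀ n m : ℕ,
    Real.sqrt (W n) / (Real.sqrt (W m) * (n + m + 1)) ≤
      C * (ratioKernel δ n m / (Real.sqrt (n + 1) * Real.sqrt (m + 1)))

theorem coeffWeight_pos {κ : ℕ → ℝ} (hpos : ∀ n, 0 < κ n) (n : ℕ) : 0 < coeffWeight κ n := by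
  cases n with
  | zero => exact one_pos
  | succ n => have := hpos n; simp only [coeffWeight]; positivity

/-- Doubling and monotonicity make `coeffWeight κ n` comparable to `(n+1)² κ n`, despite the index
shift. The squared bound then follows from the head comparison for `n ≤ m` and from the tail
comparison for `m < n`; taking square roots halves the exponent. -/
theorem exists_isHilbertRegular {κ : ℕ → ℝ} (hpos : ∀ n, 0 < κ n) (hanti : Antitone κ) {A B D : ℝ}
    (hD : ∀ n, κ n ≤ D * κ (2 * n + 1))
    (hA : ∀ n N, ∑ m ∈ Finset.Ico n N, κ m ≤ A * ((n + 1) * κ n))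
    (hB : ∀ n : ℕ, ∑ m ∈ Finset.range (n + 1), ((m : ℝ) + 1) ^ 2 * κ m ≤
      B * (((n : ℝ) + 1) ^ 3 * κ n)) :
    ∃ C δ, IsHilbertRegular (coeffWeight κ) C δ := by
  have hk0 := hpos 0
  have hA1 : 1 ≤ A := by
    have h := hA 0 1
    simp only [Nat.Ico_zero_eq_range, Finset.range_one, Finset.sum_singleton] at h
    by_contra hcon
    push_cast at h
    nlinarith
  have hB1 : 1 ≤ B := by
    have h := hB 0
    simp only [zero_add, Finset.range_one, Finset.sum_singleton] at h
    by_contra hcon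
    push_cast at h
    nlinarith
  have hD1 : 1 ≤ D := by
    have h := hD 0
    have h2 := hanti (Nat.zero_le (2 * 0 + 1))
    have h3 := hpos (2 * 0 + 1)
    by_contra hcon
    nlinarith
  -- A single exponent small enough for both comparisons, which ask for `ε * A ≤ 1` and `ε * B ≤ 1`.
  set ε := 1 / (A + B) with hε
  have hε0 : 0 < ε := by positivity
  have hεA : ε * A ≤ 1 := by rw [hε, one_div_mul_eq_div, div_le_one (by positivity)]; linarith
  have hεB : ε * B ≤ 1 := by rw [hε, one_div_mul_eq_div, div_le_one (by positivity)]; linarith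
  have hε1 : ε ≤ 1 := by nlinarith
  have htail := fun (n m : ℕ) (h : n ≤ m) =>
    power_comparison_tail hpos hanti hD hA hε0.le hε1 hεA h
  have hhead := fun (n m : ℕ) (h : n ≤ m) =>
    power_comparison_head hpos hanti hB hε0.le hε1 hεB (by linarith) h
  set W := coeffWeight κ with hW
  have hWpos := coeffWeight_pos hpos
  set E := 1 / κ 0 + κ 0 + 4 + D with hE
  have hE1 : 1 / κ 0 ≤ E := by have : 0 < 1 / κ 0 := by positivity
                               linarith
  have hE2 : κ 0 ≤ E := by have : 0 < 1 / κ 0 := by positivity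
                           linarith
  have hE3 : 4 ≤ E := by have : 0 < 1 / κ 0 := by positivity
                         linarith
  have hE4 : D ≤ E := by have : 0 < 1 / κ 0 := by positivity
                         linarith
  have hEpos : 0 < E := by linarith
  have hW1 : ∀ n : ℕ, W n ≤ E * (((n : ℝ) + 1) ^ 2 * κ n) := by
    intro n
    cases n with
    | zero =>
      simp only [hW, coeffWeight, Nat.cast_zero, zero_add, one_pow, one_mul]
      rwa [← div_le_iff₀ hk0]
    | succ n =>
      have h1 : κ n ≤ D * κ (n + 1) := (hD n).trans (by gcongr; exact hanti (by omega))
      have hk := hpos (n + 1)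
      have hk' := hpos n
      simp only [hW, coeffWeight]
      push_cast
      calc ((n : ℝ) + 1) ^ 2 * κ n ≤ ((n : ℝ) + 1 + 1) ^ 2 * (E * κ (n + 1)) := by
            gcongr
            · linarith
            · exact h1.trans (by gcongr)
        _ = _ := by ring
  have hW2 : ∀ n : ℕ, ((n : ℝ) + 1) ^ 2 * κ n ≤ E * W n := by
    intro n
    cases n with
    | zero => simpa [hW, coeffWeight] using hE2
    | succ n =>
      have h1 : κ (n + 1) ≤ κ n := hanti (by omega)
      have hk := hpos n
      have hk' := hpos (n + 1)
      simp only [hW, coeffWeight]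
      push_cast
      calc ((n : ℝ) + 1 + 1) ^ 2 * κ (n + 1) ≤ (2 * ((n : ℝ) + 1)) ^ 2 * κ n := by
            gcongr
            linarith [(n.cast_nonneg : (0 : ℝ) ≤ n)]
        _ = 4 * (((n : ℝ) + 1) ^ 2 * κ n) := by ring
        _ ≤ _ := by gcongr
  set G := (D * A + 6 * B) * E ^ 2 with hG
  have hGpos : 0 < G := by positivity
  have hDA : 0 ≤ D * A := by positivity
  have key : ∀ n m : ℕ, W n * ((n + 1) * (m + 1)) ≤
      G * ratioKernel ε n m * (W m * ((n : ℝ) + m + 1) ^ 2) := by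
    intro n m
    have hWm : 0 < W m := hWpos m
    have hkm := hpos m
    have hn : (0 : ℝ) ≤ n := n.cast_nonneg
    have hm : (0 : ℝ) ≤ m := m.cast_nonneg
    unfold ratioKernel
    split_ifs with h
    · have h1 := hhead n m h
      have h2 : ((n : ℝ) + 1) ^ 3 * κ n ≤
          6 * B * (((m : ℝ) + 1) ^ 3 * κ m) * (((n : ℝ) + 1) / (m + 1)) ^ ε := by
        rw [Real.div_rpow (by positivity) (by positivity), mul_div_assoc', le_div_iff₀ (by positivity)]
        linarith
      calc W n * ((n + 1) * (m + 1)) ≤ E * (((n : ℝ) + 1) ^ 2 * κ n) * ((n + 1) * (m + 1)) := by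
            gcongr; exact hW1 n
        _ = E * (m + 1) * (((n : ℝ) + 1) ^ 3 * κ n) := by ring
        _ ≤ E * (m + 1) * (6 * B * (((m : ℝ) + 1) ^ 3 * κ m) * (((n : ℝ) + 1) / (m + 1)) ^ ε) := by
            gcongr
        _ = E * (6 * B) * (((n : ℝ) + 1) / (m + 1)) ^ ε *
              (((m : ℝ) + 1) ^ 2 * κ m * ((m : ℝ) + 1) ^ 2) := by ring
        _ ≤ E * (D * A + 6 * B) * (((n : ℝ) + 1) / (m + 1)) ^ ε *
              (E * W m * ((n : ℝ) + m + 1) ^ 2) := by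
            refine mul_le_mul (by gcongr; linarith) (mul_le_mul (hW2 m) ?_ (by positivity)
              (by positivity)) (by positivity) (by positivity)
            gcongr
            linarith
        _ = _ := by rw [hG]; ring
    · have h1 := htail m n (not_le.1 h).le
      have h2 : ((n : ℝ) + 1) * κ n ≤
          D * A * (((m : ℝ) + 1) * κ m) * (((m : ℝ) + 1) / (n + 1)) ^ ε := by
        rw [Real.div_rpow (by positivity) (by positivity), mul_div_assoc', le_div_iff₀ (by positivity)]
        linarith
      calc W n * ((n + 1) * (m + 1)) ≤ E * (((n : ℝ) + 1) ^ 2 * κ n) * ((n + 1) * (m + 1)) := by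
            gcongr; exact hW1 n
        _ = E * (m + 1) * ((n : ℝ) + 1) ^ 2 * (((n : ℝ) + 1) * κ n) := by ring
        _ ≤ E * (m + 1) * ((n : ℝ) + 1) ^ 2 *
              (D * A * (((m : ℝ) + 1) * κ m) * (((m : ℝ) + 1) / (n + 1)) ^ ε) := by gcongr
        _ = E * (D * A) * (((m : ℝ) + 1) / (n + 1)) ^ ε *
              (((m : ℝ) + 1) ^ 2 * κ m * ((n : ℝ) + 1) ^ 2) := by ring
        _ ≤ E * (D * A + 6 * B) * (((m : ℝ) + 1) / (n + 1)) ^ ε *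
              (E * W m * ((n : ℝ) + m + 1) ^ 2) := by
            refine mul_le_mul (by gcongr; linarith) (mul_le_mul (hW2 m) ?_ (by positivity)
              (by positivity)) (by positivity) (by positivity)
            gcongr
            linarith
        _ = _ := by rw [hG]; ring
  refine ⟨Real.sqrt G, ε / 2, hWpos, Real.sqrt_pos.2 hGpos, by positivity, by linarith,
    fun n m => ?_⟩
  have hWn : 0 < W n := hWpos n
  have hWm : 0 < W m := hWpos m
  have hr := ratioKernel_pos (ε / 2) n m
  refine le_of_sq_le_sq ?_ (by positivity)
  rw [div_pow, mul_pow, mul_pow, div_pow, mul_pow, ratioKernel_sq, Real.sq_sqrt hWn.le,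
    Real.sq_sqrt hWm.le, Real.sq_sqrt hGpos.le, Real.sq_sqrt (by positivity),
    Real.sq_sqrt (by positivity), mul_div_cancel₀ _ (two_ne_zero' ℝ), mul_div_assoc',
    div_le_div_iff₀ (by positivity) (by positivity)]
  exact key n m

/-! ### A Schur test under averaged control of the rows -/

theorem sum_mul_le_of_antitone {x φ : ℕ → ℝ} {B : ℝ} (hφ : Antitone φ) (hφ0 : ∀ n, 0 ≤ φ n)
    (hx : ∀ N : ℕ, ∑ n ∈ Finset.range N, x n ≤ B * N) (N : ℕ) :
    ∑ n ∈ Finset.range N, x n * φ n ≤ B * ∑ n ∈ Finset.range N, φ n := by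
  -- Summation by parts, with the nonnegative boundary term retained so that the induction closes.
  have key : ∀ N : ℕ, φ N * (B * N - ∑ n ∈ Finset.range N, x n) ≤
      B * ∑ n ∈ Finset.range N, φ n - ∑ n ∈ Finset.range N, x n * φ n := by
    intro N
    induction N with
    | zero => simp
    | succ N ih =>
      have h1 := hx (N + 1)
      rw [Finset.sum_range_succ, Finset.sum_range_succ, Finset.sum_range_succ]
      rw [Finset.sum_range_succ] at h1
      have h2 := mul_le_mul_of_nonneg_right (hφ N.le_succ) (sub_nonneg.2 h1)
      push_cast at h2 ⊢
      refine h2.trans ?_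
      linarith
  have h1 := key N
  have h2 := mul_nonneg (hφ0 N) (sub_nonneg.2 (hx N))
  linarith

theorem div_succ_rpow_le {δ : ℝ} (h0 : 0 ≤ δ) (h1 : δ ≤ 1) (n : ℕ) :
    ((n : ℝ) / (n + 1)) ^ δ ≤ 1 - δ / (n + 1) := by
  have hle : (1 : ℝ) / (n + 1) ≤ 1 := by
    rw [div_le_one (by positivity)]; linarith [(n.cast_nonneg : (0 : ℝ) ≤ n)]
  have h := rpow_one_add_le_one_add_mul_self (s := -(1 / ((n : ℝ) + 1))) (by linarith) h0 h1
  have e : (n : ℝ) / (n + 1) = 1 + -(1 / ((n : ℝ) + 1)) := by field_simp; ring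
  rw [e]
  refine h.trans (le_of_eq ?_)
  ring

/-- Below `m` the expression is a multiple of `(n+1)^(δ-1)`, which decreases because `δ ≤ 1`. This
monotonicity is what allows averaged bounds on the rows to replace pointwise ones. -/
theorem antitone_ratioKernel_div {δ : ℝ} (h0 : 0 ≤ δ) (h1 : δ ≤ 1) (m : ℕ) :
    Antitone fun n : ℕ => ratioKernel δ n m / ((n : ℝ) + 1) := by
  refine antitone_nat_of_succ_le fun n => ?_
  unfold ratioKernel
  push_cast
  have hn : (0 : ℝ) ≤ n := n.cast_nonneg
  have hm : (0 : ℝ) ≤ m := m.cast_nonneg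
  rcases lt_or_ge n m with h | h
  · rw [if_pos (Nat.succ_le_of_lt h), if_pos h.le, Real.div_rpow (by positivity) (by positivity),
      Real.div_rpow (by positivity) (by positivity), 
      div_right_comm (((n : ℝ) + 1 + 1) ^ δ), div_right_comm (((n : ℝ) + 1) ^ δ)]
    refine div_le_div_of_nonneg_right ?_ (show (0 : ℝ) ≤ ((m : ℝ) + 1) ^ δ by positivity)
    rw [← Real.rpow_sub_one (show (n : ℝ) + 1 + 1 ≠ 0 by positivity),
      ← Real.rpow_sub_one (show (n : ℝ) + 1 ≠ 0 by positivity)]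
    exact Real.rpow_le_rpow_of_nonpos (by positivity) (by linarith) (by linarith)
  · rw [if_neg (by omega)]
    have e : (if n ≤ m then (((n : ℝ) + 1) / (m + 1)) ^ δ else (((m : ℝ) + 1) / (n + 1)) ^ δ) =
        (((m : ℝ) + 1) / (n + 1)) ^ δ := by
      split_ifs with h'
      · rw [le_antisymm h' h]
      · rfl
    rw [e]
    gcongr <;> linarith

/-- A discrete form of integrating `x^(δ-1)` up to `m` and `x^(-δ-1)` beyond it. Each part
contributes at most `1/δ`, and Bernoulli's inequality makes the increments telescope. -/
theorem sum_ratioKernel_div_le {δ : ℝ} (h0 : 0 < δ) (h1 : δ ≤ 1) (m N : ℕ) :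
    ∑ n ∈ Finset.range N, ratioKernel δ n m / ((n : ℝ) + 1) ≤ 2 / δ := by
  have hm : (0 : ℝ) < m + 1 := by positivity
  have head : ∀ N : ℕ, N ≤ m + 1 →
      δ * ∑ n ∈ Finset.range N, ratioKernel δ n m / ((n : ℝ) + 1) ≤ ((N : ℝ) / (m + 1)) ^ δ := by
    intro N
    induction N with
    | zero => intro _; simpa using by positivity
    | succ n ih =>
      intro hn
      have ih := ih (by omega)
      rw [Finset.sum_range_succ, ratioKernel, if_pos (by omega), mul_add]
      push_cast
      have hk := div_succ_rpow_le h0.le h1 n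
      have e : ((n : ℝ) / (m + 1)) ^ δ = (((n : ℝ) + 1) / (m + 1)) ^ δ * ((n : ℝ) / (n + 1)) ^ δ := by
        rw [← Real.mul_rpow (by positivity) (by positivity)]
        congr 1; field_simp
      have hp : (0 : ℝ) ≤ (((n : ℝ) + 1) / (m + 1)) ^ δ := by positivity
      have h2 := mul_le_mul_of_nonneg_left hk hp
      rw [← e] at h2
      have e2 : δ * ((((n : ℝ) + 1) / (m + 1)) ^ δ / (n + 1)) =
        (((n : ℝ) + 1) / (m + 1)) ^ δ * (δ / (n + 1)) := by ring
      rw [e2]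
      linarith
  have tail : ∀ N : ℕ, m + 1 ≤ N →
      δ * ∑ n ∈ Finset.range N, ratioKernel δ n m / ((n : ℝ) + 1) ≤
        2 - (((m : ℝ) + 1) / N) ^ δ := by
    intro N hN
    induction N, hN using Nat.le_induction with
    | base =>
      have := head (m + 1) le_rfl
      push_cast at this ⊢
      rw [div_self hm.ne', Real.one_rpow] at this ⊢
      linarith
    | succ n hn ih =>
      rw [Finset.sum_range_succ, ratioKernel, if_neg (by omega), mul_add]
      push_cast
      have hn0 : (0 : ℝ) < n := by exact_mod_cast (by omega : 0 < n)
      have hk := div_succ_rpow_le h0.le h1 n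
      have e : (((m : ℝ) + 1) / (n + 1)) ^ δ = (((m : ℝ) + 1) / n) ^ δ * ((n : ℝ) / (n + 1)) ^ δ := by
        rw [← Real.mul_rpow (by positivity) (by positivity)]
        congr 1; field_simp
      set x := δ / ((n : ℝ) + 1)
      have hx : 0 ≤ x := by positivity
      have hp : (0 : ℝ) ≤ (((m : ℝ) + 1) / n) ^ δ := by positivity
      have h2 : (((m : ℝ) + 1) / (n + 1)) ^ δ * (1 + x) ≤ (((m : ℝ) + 1) / n) ^ δ := by
        rw [e]
        calc (((m : ℝ) + 1) / n) ^ δ * ((n : ℝ) / (n + 1)) ^ δ * (1 + x)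
            ≤ (((m : ℝ) + 1) / n) ^ δ * (1 - x) * (1 + x) := by gcongr
          _ = (((m : ℝ) + 1) / n) ^ δ * (1 - x ^ 2) := by ring
          _ ≤ (((m : ℝ) + 1) / n) ^ δ * 1 := by gcongr; linarith [sq_nonneg x]
          _ = _ := mul_one _
      have e2 : δ * ((((m : ℝ) + 1) / (n + 1)) ^ δ / (n + 1)) =
        (((m : ℝ) + 1) / (n + 1)) ^ δ * x := by simp only [x]; ring
      rw [e2]
      linarith
  rw [le_div_iff₀' h0]
  rcases le_total N (m + 1) with h | h
  · refine (head N h).trans (le_trans (Real.rpow_le_one (by positivity) ?_ h0.le) one_le_two)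
    rw [div_le_one hm]
    exact_mod_cast h
  · refine (tail N h).trans ?_
    have : (0 : ℝ) ≤ (((m : ℝ) + 1) / N) ^ δ := by positivity
    linarith

theorem tsum_mul_ratioKernel_le {δ B : ℝ} (h0 : 0 < δ) (h1 : δ ≤ 1) {x : ℕ → ℝ}
    (hx0 : ∀ n, 0 ≤ x n) (hx : ∀ N : ℕ, ∑ n ∈ Finset.range N, x n ≤ B * N) (m : ℕ) :
    ∑' n, ENNReal.ofReal (x n * (ratioKernel δ n m / ((n : ℝ) + 1))) ≤
      ENNReal.ofReal (B * (2 / δ)) := by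
  have hφ0 : ∀ n : ℕ, 0 ≤ ratioKernel δ n m / ((n : ℝ) + 1) := fun n => by
    have := ratioKernel_pos δ n m
    positivity
  have hB : 0 ≤ B := by
    have := hx 1
    simp only [Finset.range_one, Finset.sum_singleton, Nat.cast_one, mul_one] at this
    exact (hx0 0).trans this
  refine ENNReal.tsum_le_of_sum_range_le fun N => ?_
  rw [← ENNReal.ofReal_sum_of_nonneg fun n _ => mul_nonneg (hx0 n) (hφ0 n)]
  refine ENNReal.ofReal_le_ofReal ?_
  refine (sum_mul_le_of_antitone (antitone_ratioKernel_div h0.le h1 m) hφ0 hx N).trans ?_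
  gcongr
  exact sum_ratioKernel_div_le h0 h1 m N

theorem tsum_mul_sq_le_tsum_sq_mul_tsum_sq (f g : ℕ → ℝ≥0∞) :
    (∑' i, f i * g i) ^ 2 ≤ (∑' i, f i ^ 2) * ∑' i, g i ^ 2 := by
  have h := ENNReal.lintegral_mul_le_Lp_mul_Lq Measure.count Real.HolderConjugate.two_two
    (measurable_of_countable f).aemeasurable (measurable_of_countable g).aemeasurable
  simp only [lintegral_count, Pi.mul_apply, ENNReal.rpow_two] at h
  have e : ∀ a : ℝ≥0∞, (a ^ (1 / 2 : ℝ)) ^ 2 = a := fun a => by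
    rw [← ENNReal.rpow_natCast, ← ENNReal.rpow_mul]; norm_num
  calc (∑' i, f i * g i) ^ 2 ≤ ((∑' i, f i ^ 2) ^ (1 / 2 : ℝ) * (∑' i, g i ^ 2) ^ (1 / 2 : ℝ)) ^ 2 := by
        gcongr
    _ = _ := by rw [mul_pow, e, e]

/-- Cauchy–Schwarz with the kernel split as `√(k/(m+1))` times `c n √(k/(n+1))`. All of `c n` goes
into the second factor, so after exchanging sums it appears as `∑ c n² k/(n+1)`, which needs only
the averages of `c n²`. -/
theorem schur_ratioKernel {δ B : ℝ} (h0 : 0 < δ) (h1 : δ ≤ 1) {c : ℕ → ℝ} (hc0 : ∀ n, 0 ≤ c n)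
    (hc : ∀ N : ℕ, ∑ n ∈ Finset.range N, c n ^ 2 ≤ B * N) (x : ℕ → ℝ≥0∞) :
    ∑' n, (∑' m, ENNReal.ofReal (c n * (ratioKernel δ n m /
      (Real.sqrt (n + 1) * Real.sqrt (m + 1)))) * x m) ^ 2 ≤
      ENNReal.ofReal ((2 / δ) ^ 2 * B) * ∑' m, x m ^ 2 := by
  have hB : 0 ≤ B := by
    have := hc 1
    simp only [Finset.range_one, Finset.sum_singleton, Nat.cast_one, mul_one] at this
    exact (sq_nonneg _).trans this
  have hrow : ∀ n, (∑' m, ENNReal.ofReal (c n * (ratioKernel δ n m /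
      (Real.sqrt (n + 1) * Real.sqrt (m + 1)))) * x m) ^ 2 ≤
      ENNReal.ofReal (2 / δ) *
        ∑' m, ENNReal.ofReal (c n ^ 2 * (ratioKernel δ n m / (n + 1))) * x m ^ 2 := by
    intro n
    have hsplit : ∀ m, ENNReal.ofReal (c n * (ratioKernel δ n m /
        (Real.sqrt (n + 1) * Real.sqrt (m + 1)))) * x m =
        ENNReal.ofReal (Real.sqrt (ratioKernel δ n m / (m + 1))) *
          (ENNReal.ofReal (c n * Real.sqrt (ratioKernel δ n m / (n + 1))) * x m) := by
      intro m
      have hr := (ratioKernel_pos δ n m).le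
      rw [← mul_assoc, ← ENNReal.ofReal_mul (Real.sqrt_nonneg _)]
      congr 2
      rw [Real.sqrt_div hr, Real.sqrt_div hr]
      nth_rw 1 [← Real.mul_self_sqrt hr]
      field_simp
    simp only [hsplit]
    refine (tsum_mul_sq_le_tsum_sq_mul_tsum_sq _ _).trans ?_
    have e1 : ∀ m : ℕ, ENNReal.ofReal (Real.sqrt (ratioKernel δ n m / (m + 1))) ^ 2 =
        ENNReal.ofReal (1 * (ratioKernel δ m n / (m + 1))) := fun m => by
      have hr := (ratioKernel_pos δ n m).le
      rw [← ENNReal.ofReal_pow (Real.sqrt_nonneg _), Real.sq_sqrt (by positivity), one_mul,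
        ratioKernel_comm]
    have e2 : ∀ m : ℕ, (ENNReal.ofReal (c n * Real.sqrt (ratioKernel δ n m / (n + 1))) * x m) ^ 2 =
        ENNReal.ofReal (c n ^ 2 * (ratioKernel δ n m / (n + 1))) * x m ^ 2 := fun m => by
      have hr := (ratioKernel_pos δ n m).le
      rw [mul_pow, ← ENNReal.ofReal_pow (mul_nonneg (hc0 n) (Real.sqrt_nonneg _)), mul_pow,
        Real.sq_sqrt (by positivity)]
    simp only [e1, e2]
    refine mul_le_mul_left ?_ _
    have := tsum_mul_ratioKernel_le (B := 1) h0 h1 (x := fun _ => 1) (by simp) (by simp) n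
    simpa using this
  calc _ ≤ ∑' n, ENNReal.ofReal (2 / δ) *
        ∑' m, ENNReal.ofReal (c n ^ 2 * (ratioKernel δ n m / (n + 1))) * x m ^ 2 :=
        ENNReal.tsum_le_tsum hrow
    _ = ENNReal.ofReal (2 / δ) * ∑' m, (∑' n, ENNReal.ofReal (c n ^ 2 *
          (ratioKernel δ n m / (n + 1)))) * x m ^ 2 := by
        rw [ENNReal.tsum_mul_left, ENNReal.tsum_comm]
        simp only [ENNReal.tsum_mul_right]
    _ ≤ ENNReal.ofReal (2 / δ) * ∑' m, ENNReal.ofReal (B * (2 / δ)) * x m ^ 2 := by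
        refine mul_le_mul_right (ENNReal.tsum_le_tsum fun m => ?_) _
        refine mul_le_mul_left ?_ _
        exact tsum_mul_ratioKernel_le h0 h1 (fun n => sq_nonneg _) hc m
    _ = _ := by
        rw [ENNReal.tsum_mul_left, ← mul_assoc, ← ENNReal.ofReal_mul (by positivity)]
        congr 2; ring

/-! ### Matrix operators on square summable sequences, and sufficiency -/

/-- The Hilbert space of square summable complex sequences. -/
abbrev SeqSpace : Type := lp (fun _ : ℕ => ℂ) 2

theorem tsum_enorm_sq (x : SeqSpace) : ∑' n, ‖x n‖ₑ ^ 2 = ENNReal.ofReal (‖x‖ ^ 2) := by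
  have h := lp.hasSum_norm (p := 2) (by norm_num) x
  simp only [ENNReal.toReal_ofNat, Real.rpow_two] at h
  rw [← h.tsum_eq, ENNReal.ofReal_tsum_of_nonneg (fun _ => sq_nonneg _) h.summable]
  refine tsum_congr fun n => ?_
  rw [ENNReal.ofReal_pow (norm_nonneg _), ofReal_norm]

theorem memℓp_two_of_tsum_ne_top {y : ℕ → ℂ} (h : ∑' n, ‖y n‖ₑ ^ 2 ≠ ⊤) : Memℓp y 2 := by
  refine memℓp_gen ?_
  simp only [ENNReal.toReal_ofNat, Real.rpow_two]
  have h2 := ENNReal.summable_toReal h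
  refine h2.congr fun n => ?_
  rw [ENNReal.toReal_pow, toReal_enorm]

theorem norm_le_of_tsum_enorm_sq_le {x : SeqSpace} {M : ℝ} (hM : 0 ≤ M)
    (h : ∑' n, ‖x n‖ₑ ^ 2 ≤ ENNReal.ofReal (M ^ 2)) : ‖x‖ ≤ M := by
  rw [tsum_enorm_sq, ENNReal.ofReal_le_ofReal_iff (sq_nonneg _)] at h
  exact le_of_sq_le_sq h hM

theorem exists_matrix_operator {K : ℕ → ℕ → ℂ} {M : ℝ} (hM : 0 ≤ M)
    (h : ∀ x : SeqSpace, ∑' n, (∑' m, ‖K n m‖ₑ * ‖x m‖ₑ) ^ 2 ≤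
      ENNReal.ofReal (M ^ 2 * ‖x‖ ^ 2)) :
    ∃ T : SeqSpace →L[ℂ] SeqSpace,
      (∀ x n, HasSum (fun m => K n m * x m) (T x n)) ∧ ‖T‖ ≤ M := by
  have hsum : ∀ (x : SeqSpace) n, Summable fun m => K n m * x m := by
    intro x n
    have h1 : (∑' m, ‖K n m‖ₑ * ‖x m‖ₑ) ^ 2 ≠ ⊤ :=
      ((ENNReal.le_tsum n).trans (h x)).trans_lt ENNReal.ofReal_lt_top |>.ne
    have h2 : ∑' m, ‖K n m * x m‖ₑ ≠ ⊤ := by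
      simp only [enorm_mul]
      intro htop
      rw [htop] at h1
      simp at h1
    have h3 := ENNReal.summable_toReal h2
    simp only [toReal_enorm] at h3
    exact h3.of_norm
  have hbd : ∀ x : SeqSpace, ∑' n, ‖∑' m, K n m * x m‖ₑ ^ 2 ≤ ENNReal.ofReal ((M * ‖x‖) ^ 2) := by
    intro x
    rw [mul_pow]
    refine le_trans (ENNReal.tsum_le_tsum fun n => ?_) (h x)
    gcongr
    refine enorm_tsum_le_tsum_enorm.trans (le_of_eq ?_)
    simp only [enorm_mul]
  let T₀ : SeqSpace →ₗ[ℂ] SeqSpace :=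
    { toFun := fun x => ⟨fun n => ∑' m, K n m * x m,
        memℓp_two_of_tsum_ne_top ((hbd x).trans_lt ENNReal.ofReal_lt_top).ne⟩
      map_add' := fun x y => by
        refine lp.ext (funext fun n => ?_)
        simp only [lp.coeFn_add, Pi.add_apply, mul_add]
        exact (hsum x n).tsum_add (hsum y n)
      map_smul' := fun a x => by
        refine lp.ext (funext fun n => ?_)
        simp only [lp.coeFn_smul, Pi.smul_apply, smul_eq_mul, RingHom.id_apply]
        rw [← tsum_mul_left]
        exact tsum_congr fun m => by ring }
  refine ⟨T₀.mkContinuous M fun x => ?_, fun x n => (hsum x n).hasSum,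
    LinearMap.mkContinuous_norm_le _ hM _⟩
  exact norm_le_of_tsum_enorm_sq_le (by positivity) (hbd x)

/-- The matrix, in the normalized monomials, of the operator with Taylor coefficients
`c n * ∑ a m / (n + m + 1)`. -/
noncomputable def hilbertMatrix (W : ℕ → ℝ) (c : ℕ → ℂ) (n m : ℕ) : ℂ :=
  ((Real.sqrt (W n) / (Real.sqrt (W m) * (n + m + 1)) : ℝ) : ℂ) * c n

theorem exists_hilbertMatrix_operator {W : ℕ → ℝ} {C δ : ℝ} (hW : IsHilbertRegular W C δ)
    {c : ℕ → ℂ} {B : ℝ} (hB : 0 ≤ B)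
    (hc : ∀ N : ℕ, ∑ n ∈ Finset.range N, ‖c n‖ ^ 2 ≤ B * N) :
    ∃ T : SeqSpace →L[ℂ] SeqSpace,
      (∀ x n, HasSum (fun m => hilbertMatrix W c n m * x m) (T x n)) ∧
        ‖T‖ ≤ C * (2 / δ) * Real.sqrt B := by
  obtain ⟨hpos, hC, hδ0, hδ1, hK⟩ := hW
  refine exists_matrix_operator (by positivity) fun x => ?_
  have hle : ∀ n m, ‖hilbertMatrix W c n m‖ₑ ≤ ENNReal.ofReal C * ENNReal.ofReal (‖c n‖ *
      (ratioKernel δ n m / (Real.sqrt (n + 1) * Real.sqrt (m + 1)))) := by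
    intro n m
    rw [← ENNReal.ofReal_mul hC.le, ← ofReal_norm]
    refine ENNReal.ofReal_le_ofReal ?_
    rw [hilbertMatrix, norm_mul, Complex.norm_real, Real.norm_of_nonneg (by positivity)]
    calc _ ≤ C * (ratioKernel δ n m / (Real.sqrt (n + 1) * Real.sqrt (m + 1))) * ‖c n‖ := by
          gcongr; exact hK n m
      _ = _ := by ring
  calc ∑' n, (∑' m, ‖hilbertMatrix W c n m‖ₑ * ‖x m‖ₑ) ^ 2
      ≤ ∑' n, (ENNReal.ofReal C * ∑' m, ENNReal.ofReal (‖c n‖ *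
          (ratioKernel δ n m / (Real.sqrt (n + 1) * Real.sqrt (m + 1)))) * ‖x m‖ₑ) ^ 2 := by
        refine ENNReal.tsum_le_tsum fun n => ?_
        gcongr
        rw [← ENNReal.tsum_mul_left]
        refine ENNReal.tsum_le_tsum fun m => ?_
        rw [← mul_assoc]
        gcongr
        exact hle n m
    _ = ENNReal.ofReal C ^ 2 * ∑' n, (∑' m, ENNReal.ofReal (‖c n‖ *
          (ratioKernel δ n m / (Real.sqrt (n + 1) * Real.sqrt (m + 1)))) * ‖x m‖ₑ) ^ 2 := by
        simp only [mul_pow, ENNReal.tsum_mul_left]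
    _ ≤ ENNReal.ofReal C ^ 2 * (ENNReal.ofReal ((2 / δ) ^ 2 * B) * ∑' m, ‖x m‖ₑ ^ 2) := by
        gcongr
        exact schur_ratioKernel hδ0 hδ1 (fun n => norm_nonneg _) hc _
    _ = _ := by
        rw [tsum_enorm_sq, ← ENNReal.ofReal_pow hC.le, ← ENNReal.ofReal_mul (by positivity),
          ← ENNReal.ofReal_mul (by positivity)]
        congr 1
        rw [mul_pow, mul_pow, Real.sq_sqrt hB]
        ring

/-- The `n`-th coordinate of a square summable sequence. -/
noncomputable def coordCLM (n : ℕ) : SeqSpace →L[ℂ] ℂ :=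
  LinearMap.mkContinuous
    { toFun := fun x => x n, map_add' := fun _ _ => rfl, map_smul' := fun _ _ => rfl } 1
    (fun x => (lp.norm_apply_le_norm (by norm_num) x n).trans (one_mul _).ge)

theorem isCompactOperator_smulRight (φ : SeqSpace →L[ℂ] ℂ) (e : SeqSpace) :
    IsCompactOperator (φ.smulRight e) := by
  have h : IsCompactOperator (ContinuousLinearMap.toSpanSingleton ℂ e) :=
    isCompactOperator_of_locallyCompactSpace_rng _
  exact h.comp_clm φ

/-- Keeping the first `L` rows gives a finite rank operator. The discarded part is the same matrix
with `c` set to zero below `L`; its averages are at most those of `c` at lengths `N ≥ L`, so its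
norm tends to zero. -/
theorem isCompactOperator_of_tendsto_zero {W : ℕ → ℝ} {C δ : ℝ} (hW : IsHilbertRegular W C δ)
    {c : ℕ → ℂ}
    (hc : Tendsto (fun N : ℕ => (∑ n ∈ Finset.range N, ‖c n‖ ^ 2) / N) atTop (𝓝 0)) :
    ∃ T : SeqSpace →L[ℂ] SeqSpace,
      (∀ x n, HasSum (fun m => hilbertMatrix W c n m * x m) (T x n)) ∧ IsCompactOperator T := by
  have hS : ∀ (c : ℕ → ℂ) (B : ℝ), (∀ N : ℕ, (∑ n ∈ Finset.range N, ‖c n‖ ^ 2) / N ≤ B) →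
      ∀ N : ℕ, ∑ n ∈ Finset.range N, ‖c n‖ ^ 2 ≤ B * N := by
    intro c B h N
    rcases N.eq_zero_or_pos with rfl | hN
    · simp
    · exact (div_le_iff₀ (by exact_mod_cast hN)).1 (h N)
  obtain ⟨B, hB⟩ := hc.bddAbove_range
  have hB' : ∀ N : ℕ, (∑ n ∈ Finset.range N, ‖c n‖ ^ 2) / N ≤ B := fun N => hB ⟨N, rfl⟩
  have hB0 : 0 ≤ B := by simpa using hB' 0
  obtain ⟨T, hT, -⟩ := exists_hilbertMatrix_operator hW hB0 (hS c B hB')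
  refine ⟨T, hT, ?_⟩
  let F : ℕ → SeqSpace →L[ℂ] SeqSpace := fun L =>
    ∑ n ∈ Finset.range L, ((coordCLM n).comp T).smulRight (lp.single 2 n (1 : ℂ))
  have hF : ∀ L x n, F L x n = if n < L then T x n else 0 := by
    intro L x n
    have e : F L x = ∑ k ∈ Finset.range L, T x k • (lp.single 2 k (1 : ℂ) : SeqSpace) := by
      simp only [F, _root_.sum_apply]
      rfl
    rw [e, lp.coeFn_sum, Finset.sum_apply]
    simp only [lp.coeFn_smul, Pi.smul_apply, lp.single_apply, Pi.single_apply, smul_eq_mul,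
      mul_ite, mul_one, mul_zero, Finset.sum_ite_eq, Finset.mem_range]
  have hcpt : ∀ L, IsCompactOperator (F L) := by
    intro L
    exact Submodule.sum_mem (compactOperator (RingHom.id ℂ) SeqSpace SeqSpace)
      fun n _ => isCompactOperator_smulRight _ _
  refine isCompactOperator_of_tendsto (l := atTop) (F := F) ?_ (Eventually.of_forall hcpt)
  rw [tendsto_iff_norm_sub_tendsto_zero]
  obtain ⟨hpos, hC, hδ0, hδ1, hK⟩ := hW
  rw [Metric.tendsto_atTop]
  intro ε hε
  -- Chosen so that the norm bound `C * (2 / δ) * √η` equals `ε / 2`.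
  set η := (ε / 2 / (C * (2 / δ))) ^ 2 with hη
  have hη0 : 0 < η := by positivity
  obtain ⟨L₀, hL₀⟩ := Metric.tendsto_atTop.1 hc η hη0
  refine ⟨L₀, fun L hL => ?_⟩
  let c' : ℕ → ℂ := fun n => if n < L then 0 else c n
  have hc' : ∀ N : ℕ, ∑ n ∈ Finset.range N, ‖c' n‖ ^ 2 ≤ η * N := by
    refine hS c' η fun N => ?_
    rcases lt_or_ge N L with h | h
    · have : ∑ n ∈ Finset.range N, ‖c' n‖ ^ 2 = 0 := by
        refine Finset.sum_eq_zero fun n hn => ?_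
        simp only [c', if_pos ((Finset.mem_range.1 hn).trans h), norm_zero]
        norm_num
      rw [this, zero_div]
      exact hη0.le
    · have h1 := hL₀ N (hL.trans h)
      rw [Real.dist_eq, sub_zero] at h1
      refine le_trans ?_ ((le_abs_self _).trans h1.le)
      gcongr with n hn
      simp only [c']
      split_ifs <;> simp
  obtain ⟨T', hT', hTn⟩ := exists_hilbertMatrix_operator ⟨hpos, hC, hδ0, hδ1, hK⟩
    hη0.le hc'
  have hdiff : F L - T = -T' := by
    refine ContinuousLinearMap.ext fun x => lp.ext (funext fun n => ?_)
    have h1 : (F L - T) x n = F L x n - T x n := rfl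
    have h2 : (-T') x n = -(T' x n) := rfl
    rw [h1, h2, hF]
    split_ifs with h
    · have : HasSum (fun m => hilbertMatrix W c' n m * x m) 0 := by
        simp only [hilbertMatrix, c', if_pos h, mul_zero, zero_mul]
        exact hasSum_zero
      rw [(hT' x n).unique this, sub_self, neg_zero]
    · have : HasSum (fun m => hilbertMatrix W c' n m * x m) (T x n) := by
        simp only [hilbertMatrix, c', if_neg h]
        exact hT x n
      rw [(hT' x n).unique this, zero_sub]
  rw [hdiff, norm_neg, Real.dist_eq, sub_zero, abs_norm]
  refine hTn.trans_lt ?_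
  rw [hη, Real.sqrt_sq (by positivity), mul_div_cancel₀ _ (by positivity)]
  linarith

/-! ### Abel means, averages and dyadic averages -/

theorem sum_truncation_le {c : ℕ → ℝ} {η : ℝ} (hη : 0 ≤ η) {L : ℕ} (hc0 : ∀ n, 0 ≤ c n)
    (hL : ∀ N ≥ L, (∑ n ∈ Finset.range N, c n) / N ≤ η) (N : ℕ) :
    ∑ n ∈ Finset.range N, (if n < L then 0 else c n) ≤ η * N := by
  rcases lt_or_ge N L with h | h
  · rw [Finset.sum_eq_zero fun n hn => if_pos ((Finset.mem_range.1 hn).trans h)]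
    positivity
  · rcases N.eq_zero_or_pos with rfl | hN
    · simp
    rw [← div_le_iff₀ (by exact_mod_cast hN)]
    refine le_trans ?_ (hL N h)
    gcongr with n hn
    split_ifs
    exacts [hc0 n, le_rfl]

/-- From Abel means to averages, positivity permits evaluating at `r = 1 - 1/(n+2)`, where `r^(2k) ≥
1/9` for all `k ≤ n`. Conversely, the first `L` terms contribute a bounded amount, killed by `1 -
r`, and the rest is summed by parts against the decreasing `r^(2k)`. -/
theorem tendsto_abel_iff {c : ℕ → ℝ} (hc0 : ∀ n, 0 ≤ c n) {F : ℝ → ℝ}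
    (hF : ∀ r ∈ Ioo (0 : ℝ) 1, HasSum (fun n => c n * r ^ (2 * n)) (F r)) :
    Tendsto (fun r => F r * (1 - r)) (𝓝[<] 1) (𝓝 0) ↔
      Tendsto (fun N : ℕ => (∑ n ∈ Finset.range N, c n) / N) atTop (𝓝 0) := by
  have hIoo : ∀ᶠ r : ℝ in 𝓝[<] 1, r ∈ Ioo (0 : ℝ) 1 :=
    Ioo_mem_nhdsLT (by norm_num)
  constructor
  · intro h
    rw [← tendsto_add_atTop_iff_nat 1]
    have hnode : Tendsto (fun n : ℕ => node (n + 1)) atTop (𝓝[<] 1) := by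
      rw [tendsto_nhdsWithin_iff]
      refine ⟨?_, Eventually.of_forall fun n => node_lt_one _⟩
      have h1 : Tendsto (fun n : ℕ => 1 - 1 / (((n + 1 : ℕ) : ℝ) + 1)) atTop (𝓝 (1 - 0)) :=
        (((tendsto_one_div_add_atTop_nhds_zero_nat (𝕜 := ℝ)).comp
          (tendsto_add_atTop_nat 1))).const_sub 1
      rw [sub_zero] at h1
      refine h1.congr fun n => ?_
      rw [← one_sub_node]; ring
    have h2 : Tendsto (fun n : ℕ => 18 * (F (node (n + 1)) * (1 - node (n + 1)))) atTop (𝓝 0) := by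
      simpa using (h.comp hnode).const_mul 18
    refine squeeze_zero (fun n => ?_) (fun n => ?_) h2
    · exact div_nonneg (Finset.sum_nonneg fun k _ => hc0 k) (Nat.cast_nonneg _)
    · set r := node (n + 1) with hr
      have hr0 : 0 < r := node_succ_pos n
      have hr1 : r < 1 := node_lt_one _
      have h9 := one_le_nine_mul_node_pow n
      have h3 : ∑ k ∈ Finset.range (n + 1), c k ≤ 9 * F r := by
        calc ∑ k ∈ Finset.range (n + 1), c k
            ≤ ∑ k ∈ Finset.range (n + 1), 9 * (c k * r ^ (2 * k)) := by
              refine Finset.sum_le_sum fun k hk => ?_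
              have h4 : r ^ (2 * n + 1) ≤ r ^ (2 * k) :=
                pow_le_pow_of_le_one hr0.le hr1.le (by have := Finset.mem_range.1 hk; omega)
              nlinarith [mul_le_mul_of_nonneg_left h4 (hc0 k), mul_le_mul_of_nonneg_left h9 (hc0 k)]
          _ = 9 * ∑ k ∈ Finset.range (n + 1), c k * r ^ (2 * k) := by rw [Finset.mul_sum]
          _ ≤ 9 * F r := by
              gcongr
              exact sum_le_hasSum _ (fun k _ => mul_nonneg (hc0 k) (by positivity)) (hF r ⟨hr0, hr1⟩)
      have hF0 : 0 ≤ F r := (hF r ⟨hr0, hr1⟩).nonneg fun k => mul_nonneg (hc0 k) (by positivity)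
      have h5 : 1 / (n + 1 : ℝ) ≤ 2 * (1 - r) := by
        rw [hr, one_sub_node]
        push_cast
        rw [mul_one_div, div_le_div_iff₀ (by positivity) (by positivity)]
        linarith [(n.cast_nonneg : (0 : ℝ) ≤ n)]
      push_cast
      calc (∑ k ∈ Finset.range (n + 1), c k) / ((n : ℝ) + 1) ≤ 9 * F r / (n + 1) := by gcongr
        _ = 9 * F r * (1 / (n + 1)) := by ring
        _ ≤ 9 * F r * (2 * (1 - r)) := by gcongr
        _ = _ := by ring
  · intro h
    rw [Metric.tendsto_nhds]
    intro ε hε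
    obtain ⟨L, hL⟩ := Metric.tendsto_atTop.1 h (ε / 2) (by positivity)
    have hL' : ∀ N ≥ L, (∑ n ∈ Finset.range N, c n) / N ≤ ε / 2 := fun N hN => by
      have := hL N hN
      rw [Real.dist_eq, sub_zero] at this
      exact (le_abs_self _).trans this.le
    set S := ∑ n ∈ Finset.range L, c n with hS
    have hlim : Tendsto (fun r : ℝ => S * (1 - r) + ε / 2) (𝓝[<] 1) (𝓝 (ε / 2)) := by
      have : Tendsto (fun r : ℝ => S * (1 - r) + ε / 2) (𝓝 1) (𝓝 (S * (1 - 1) + ε / 2)) :=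
        (by fun_prop : Continuous fun r : ℝ => S * (1 - r) + ε / 2).tendsto 1
      simp only [sub_self, mul_zero, zero_add] at this
      exact this.mono_left nhdsWithin_le_nhds
    filter_upwards [hIoo, hlim.eventually_lt_const (half_lt_self hε)] with r hr hlt
    have hF0 : 0 ≤ F r := (hF r hr).nonneg fun k => mul_nonneg (hc0 k) (by have := hr.1; positivity)
    have h1r : 0 < 1 - r := by linarith [hr.2]
    rw [Real.dist_eq, sub_zero, abs_of_nonneg (by positivity)]
    refine lt_of_le_of_lt ?_ hlt
    have hx1 : r ^ 2 < 1 := by nlinarith [hr.1, hr.2]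
    have hbound : F r ≤ S + ε / 2 * (1 - r ^ 2)⁻¹ := by
      refine hasSum_le_of_sum_le (hF r hr) fun s => ?_
      obtain ⟨N, hN⟩ := s.exists_nat_subset_range
      have hnn : ∀ k, 0 ≤ c k * r ^ (2 * k) := fun k =>
        mul_nonneg (hc0 k) (by have := hr.1; positivity)
      calc ∑ k ∈ s, c k * r ^ (2 * k) ≤ ∑ k ∈ Finset.range N, c k * r ^ (2 * k) :=
            Finset.sum_le_sum_of_subset_of_nonneg hN fun k _ _ => hnn k
        _ ≤ ∑ k ∈ Finset.range N, ((if k < L then c k else 0) +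
              (if k < L then 0 else c k) * r ^ (2 * k)) := by
            refine Finset.sum_le_sum fun k _ => ?_
            split_ifs
            · have : r ^ (2 * k) ≤ 1 := pow_le_one₀ hr.1.le hr.2.le
              nlinarith [hc0 k]
            · linarith
        _ = ∑ k ∈ Finset.range N, (if k < L then c k else 0) +
              ∑ k ∈ Finset.range N, (if k < L then 0 else c k) * r ^ (2 * k) :=
            Finset.sum_add_distrib
        _ ≤ S + ε / 2 * ∑ k ∈ Finset.range N, r ^ (2 * k) := by
            refine add_le_add ?_ ?_
            · rw [← Finset.sum_filter]
              refine Finset.sum_le_sum_of_subset_of_nonneg ?_ fun k _ _ => hc0 k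
              intro k hk
              exact Finset.mem_range.2 (Finset.mem_filter.1 hk).2
            · refine sum_mul_le_of_antitone ?_ (fun k => by have := hr.1; positivity)
                (sum_truncation_le (by positivity) hc0 hL') N
              intro i j hij
              exact pow_le_pow_of_le_one hr.1.le hr.2.le (by omega)
        _ ≤ S + ε / 2 * (1 - r ^ 2)⁻¹ := by
            gcongr
            rw [← tsum_geometric_of_lt_one (by positivity) hx1]
            simp only [pow_mul]
            exact (summable_geometric_of_lt_one (by positivity) hx1).sum_le_tsum _
              fun k _ => by positivity
    have h2 : (1 - r ^ 2)⁻¹ * (1 - r) ≤ 1 := by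
      rw [inv_mul_le_iff₀ (by linarith)]
      nlinarith [hr.1, hr.2]
    calc F r * (1 - r) ≤ (S + ε / 2 * (1 - r ^ 2)⁻¹) * (1 - r) := by gcongr
      _ = S * (1 - r) + ε / 2 * ((1 - r ^ 2)⁻¹ * (1 - r)) := by ring
      _ ≤ S * (1 - r) + ε / 2 * 1 := by gcongr
      _ = _ := by ring

theorem tendsto_average_of_dyadic {c : ℕ → ℝ} (hc0 : ∀ n, 0 ≤ c n)
    (h : Tendsto (fun N : ℕ => (∑ n ∈ Finset.Ico N (2 * N), c n) / N) atTop (𝓝 0)) :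
    Tendsto (fun N : ℕ => (∑ n ∈ Finset.range N, c n) / N) atTop (𝓝 0) := by
  rw [Metric.tendsto_atTop]
  intro ε hε
  obtain ⟨N₀, hN₀⟩ := Metric.tendsto_atTop.1 h (ε / 8) (by positivity)
  set S := ∑ n ∈ Finset.range (2 * N₀ + 2), c n with hS
  have hS0 : 0 ≤ S := Finset.sum_nonneg fun n _ => hc0 n
  have key : ∀ M : ℕ, ∑ n ∈ Finset.range M, c n ≤ S + ε / 2 * M := by
    intro M
    induction M using Nat.strong_induction_on with
    | _ M ih =>
      rcases le_or_gt M (2 * N₀ + 2) with hM | hM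
      · have : ∑ n ∈ Finset.range M, c n ≤ S :=
          Finset.sum_le_sum_of_subset_of_nonneg (Finset.range_mono hM) fun n _ _ => hc0 n
        have : 0 ≤ ε / 2 * (M : ℝ) := by positivity
        linarith
      -- Induct from half the length, rounded up. The step closes because `(ε/2 + ε/8) N ≤ (ε/2) M`,
      -- that is `5 N ≤ 4 M`, which rounding up respects since `M ≥ 3`.
      · obtain ⟨N, hN⟩ : ∃ N, N = (M + 1) / 2 := ⟨_, rfl⟩
        have hNpos : 0 < N := by omega
        have h1 := ih N (by omega)
        have h2 := hN₀ N (by omega)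
        rw [Real.dist_eq, sub_zero] at h2
        have h3 := (le_abs_self _).trans h2.le
        rw [div_le_iff₀ (by exact_mod_cast hNpos)] at h3
        have h4 : ∑ n ∈ Finset.range M, c n ≤ ∑ n ∈ Finset.range (2 * N), c n :=
          Finset.sum_le_sum_of_subset_of_nonneg (Finset.range_mono (by omega)) fun n _ _ => hc0 n
        rw [← Finset.sum_range_add_sum_Ico _ (by omega : N ≤ 2 * N)] at h4
        have h5 : (5 * N : ℝ) ≤ 4 * M := by exact_mod_cast (by omega : 5 * N ≤ 4 * M)
        nlinarith
  have hlim : Tendsto (fun M : ℕ => S / M) atTop (𝓝 0) := tendsto_const_div_atTop_nhds_zero_nat S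
  obtain ⟨M₀, hM₀⟩ := Metric.tendsto_atTop.1 hlim (ε / 2) (by positivity)
  refine ⟨M₀ + 1, fun M hM => ?_⟩
  have hMpos : (0 : ℝ) < M := by exact_mod_cast (by omega : 0 < M)
  have h1 := hM₀ M (by omega)
  rw [Real.dist_eq, sub_zero, abs_of_nonneg (by positivity)] at h1
  rw [Real.dist_eq, sub_zero,
    abs_of_nonneg (div_nonneg (Finset.sum_nonneg fun n _ => hc0 n) hMpos.le)]
  calc (∑ n ∈ Finset.range M, c n) / M ≤ (S + ε / 2 * M) / M := by gcongr; exact key M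
    _ = S / M + ε / 2 := by field_simp
    _ < ε := by linarith

/-! ### Necessity: testing on dyadic blocks -/

/-- The images lie in a compact set, and coordinatewise convergence leaves `0` as the only possible
subsequential limit. -/
theorem tendsto_zero_of_isCompactOperator {T : SeqSpace →L[ℂ] SeqSpace} (hT : IsCompactOperator T)
    {x : ℕ → SeqSpace} (hx : ∀ k, ‖x k‖ ≤ 1) (h : ∀ n, Tendsto (fun k => T (x k) n) atTop (𝓝 0)) :
    Tendsto (fun k => T (x k)) atTop (𝓝 0) := by
  obtain ⟨K, hK, hsub⟩ := IsCompactOperator.image_closedBall_subset_compact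
    (f := (T : SeqSpace →ₗ[ℂ] SeqSpace)) hT 1
  refine tendsto_of_subseq_tendsto fun ns hns => ?_
  obtain ⟨y, -, ms, hms, hlim⟩ := hK.tendsto_subseq (x := fun k => T (x (ns k)))
    fun k => hsub ⟨x (ns k), mem_closedBall_zero_iff.2 (hx _), rfl⟩
  refine ⟨ms, ?_⟩
  have hy : y = 0 := by
    refine lp.ext (funext fun n => ?_)
    have h1 : Tendsto (fun k => T (x (ns (ms k))) n) atTop (𝓝 (y n)) :=
      ((coordCLM n).continuous.tendsto y).comp hlim
    exact tendsto_nhds_unique h1 ((h n).comp (hns.comp hms.tendsto_atTop))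
  rw [← hy]
  exact hlim

theorem tendsto_average_of_isCompactOperator {W : ℕ → ℝ} {C δ : ℝ} (hW : IsHilbertRegular W C δ)
    {c : ℕ → ℂ} {T : SeqSpace →L[ℂ] SeqSpace}
    (hT : ∀ x n, HasSum (fun m => hilbertMatrix W c n m * x m) (T x n))
    (hcpt : IsCompactOperator T) :
    Tendsto (fun N : ℕ => (∑ n ∈ Finset.range N, ‖c n‖ ^ 2) / N) atTop (𝓝 0) := by
  obtain ⟨hpos, hC, hδ0, hδ1, hK⟩ := hW
  let x : ℕ → SeqSpace := fun N =>
    ∑ m ∈ Finset.Ico N (2 * N), lp.single 2 m (((Real.sqrt N)⁻¹ : ℝ) : ℂ)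
  have hxm : ∀ N m, x N m = if m ∈ Finset.Ico N (2 * N) then (((Real.sqrt N)⁻¹ : ℝ) : ℂ) else 0 := by
    intro N m
    simp only [x]
    rw [lp.coeFn_sum, Finset.sum_apply]
    simp only [lp.single_apply, Pi.single_apply, Finset.sum_ite_eq]
  have hnorm : ∀ N, ‖x N‖ ≤ 1 := by
    intro N
    have h := lp.norm_sum_single (E := fun _ : ℕ => ℂ) (p := 2) (by norm_num)
      (fun _ => (((Real.sqrt N)⁻¹ : ℝ) : ℂ)) (Finset.Ico N (2 * N))
    simp only [ENNReal.toReal_ofNat, Real.rpow_two, Complex.norm_real, Real.norm_eq_abs, sq_abs,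
      inv_pow, Real.sq_sqrt N.cast_nonneg, Finset.sum_const, Nat.card_Ico, nsmul_eq_mul] at h
    refine le_of_sq_le_sq ?_ zero_le_one
    change ‖∑ m ∈ Finset.Ico N (2 * N), lp.single 2 m (((Real.sqrt N)⁻¹ : ℝ) : ℂ)‖ ^ 2 ≤ 1 ^ 2
    rw [h, one_pow, two_mul, Nat.add_sub_cancel]
    exact mul_inv_le_one
  have hTx : ∀ N n, T (x N) n = ((∑ m ∈ Finset.Ico N (2 * N),
      Real.sqrt (W n) / (Real.sqrt (W m) * (n + m + 1)) * (Real.sqrt N)⁻¹ : ℝ) : ℂ) * c n := by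
    intro N n
    refine (hT (x N) n).unique ?_
    have e : ((∑ m ∈ Finset.Ico N (2 * N),
        Real.sqrt (W n) / (Real.sqrt (W m) * (n + m + 1)) * (Real.sqrt N)⁻¹ : ℝ) : ℂ) * c n =
        ∑ m ∈ Finset.Ico N (2 * N), hilbertMatrix W c n m * x N m := by
      rw [Complex.ofReal_sum, Finset.sum_mul]
      refine Finset.sum_congr rfl fun m hm => ?_
      rw [hxm, if_pos hm, hilbertMatrix]
      push_cast
      ring
    rw [e]
    exact hasSum_sum_of_ne_finset_zero fun m hm => by rw [hxm, if_neg hm, mul_zero]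
  have hnonneg : ∀ N n, 0 ≤ ∑ m ∈ Finset.Ico N (2 * N),
      Real.sqrt (W n) / (Real.sqrt (W m) * (n + m + 1)) * (Real.sqrt N)⁻¹ :=
    fun N n => Finset.sum_nonneg fun m _ => by positivity
  -- For fixed `n < N` the kernel over the block is at most `C ((n+1)/N)^δ / √N`. There are `N`
  -- terms with a further factor `N^(-1/2)`, so the decay is exactly that of `((n+1)/N)^δ`, and `δ >
  -- 0` is essential.
  have hcoord : ∀ n, Tendsto (fun N => T (x N) n) atTop (𝓝 0) := by
    intro n
    have hlim : Tendsto (fun N : ℕ => C * (((n : ℝ) + 1) / N) ^ δ * ‖c n‖) atTop (𝓝 0) := by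
      have h1 : Tendsto (fun N : ℕ => (((n : ℝ) + 1) / N) ^ δ) atTop (𝓝 (0 ^ δ)) :=
        (tendsto_const_div_atTop_nhds_zero_nat _).rpow_const (Or.inr hδ0.le)
      rw [Real.zero_rpow hδ0.ne'] at h1
      simpa using (h1.const_mul C).mul_const ‖c n‖
    refine squeeze_zero_norm' ?_ hlim
    filter_upwards [eventually_gt_atTop n] with N hN
    have hN0 : (0 : ℝ) < N := by exact_mod_cast (by omega : 0 < N)
    rw [hTx, norm_mul, Complex.norm_real, Real.norm_of_nonneg (hnonneg N n)]
    gcongr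
    calc ∑ m ∈ Finset.Ico N (2 * N),
          Real.sqrt (W n) / (Real.sqrt (W m) * (n + m + 1)) * (Real.sqrt N)⁻¹
        ≤ ∑ m ∈ Finset.Ico N (2 * N), C * (((n : ℝ) + 1) / N) ^ δ * (N : ℝ)⁻¹ := by
          refine Finset.sum_le_sum fun m hm => ?_
          have hm1 : N ≤ m := (Finset.mem_Ico.1 hm).1
          have hm2 : (N : ℝ) ≤ m + 1 := by
            have : (N : ℝ) ≤ m := by exact_mod_cast hm1
            linarith
          have hr : ratioKernel δ n m ≤ (((n : ℝ) + 1) / N) ^ δ := by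
            rw [ratioKernel, if_pos (by omega)]
            gcongr
          have hd : Real.sqrt N ≤ Real.sqrt (n + 1) * Real.sqrt (m + 1) := by
            have h1 : 1 ≤ Real.sqrt ((n : ℝ) + 1) :=
              Real.one_le_sqrt.2 (by linarith [(n.cast_nonneg : (0 : ℝ) ≤ n)])
            have h2 : Real.sqrt N ≤ Real.sqrt ((m : ℝ) + 1) := Real.sqrt_le_sqrt hm2
            nlinarith [Real.sqrt_nonneg ((m : ℝ) + 1)]
          have hs : 0 < Real.sqrt N := Real.sqrt_pos.2 hN0
          calc _ ≤ C * (ratioKernel δ n m / (Real.sqrt (n + 1) * Real.sqrt (m + 1))) *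
                (Real.sqrt N)⁻¹ := by gcongr; exact hK n m
            _ ≤ C * ((((n : ℝ) + 1) / N) ^ δ / Real.sqrt N) * (Real.sqrt N)⁻¹ := by gcongr
            _ = C * (((n : ℝ) + 1) / N) ^ δ * (Real.sqrt N * Real.sqrt N)⁻¹ := by
                rw [mul_inv]; ring
            _ = _ := by rw [Real.mul_self_sqrt hN0.le]
      _ = C * (((n : ℝ) + 1) / N) ^ δ := by
          rw [Finset.sum_const, Nat.card_Ico, nsmul_eq_mul, two_mul, Nat.add_sub_cancel]
          field_simp
  have hlim := tendsto_zero_of_isCompactOperator hcpt hnorm hcoord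
  refine tendsto_average_of_dyadic (fun n => sq_nonneg _) ?_
  have hlim2 : Tendsto (fun N => (16 * C) ^ 2 * ‖T (x N)‖ ^ 2) atTop (𝓝 0) := by
    simpa using ((hlim.norm.pow 2).const_mul ((16 * C) ^ 2))
  refine squeeze_zero (fun N => div_nonneg (Finset.sum_nonneg fun n _ => sq_nonneg _)
    N.cast_nonneg) (fun N => ?_) hlim2
  rcases N.eq_zero_or_pos with rfl | hNpos
  · simp only [CharP.cast_eq_zero, div_zero]
    positivity
  have hN0 : (0 : ℝ) < N := by exact_mod_cast hNpos
  have hs : 0 < Real.sqrt N := Real.sqrt_pos.2 hN0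
  have hsum := lp.sum_rpow_le_norm_rpow (p := 2) (by norm_num) (T (x N)) (Finset.Ico N (2 * N))
  simp only [ENNReal.toReal_ofNat, Real.rpow_two] at hsum
  rw [Finset.sum_div]
  refine le_trans ?_ (mul_le_mul_of_nonneg_left hsum (by positivity))
  rw [Finset.mul_sum]
  refine Finset.sum_le_sum fun n hn => ?_
  obtain ⟨hn1, hn2⟩ := Finset.mem_Ico.1 hn
  have hlow : (16 * C * Real.sqrt N)⁻¹ ≤ ∑ m ∈ Finset.Ico N (2 * N),
      Real.sqrt (W n) / (Real.sqrt (W m) * (n + m + 1)) * (Real.sqrt N)⁻¹ := by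
    calc (16 * C * Real.sqrt N)⁻¹ = ∑ m ∈ Finset.Ico N (2 * N), (16 * C * N)⁻¹ * (Real.sqrt N)⁻¹ := by
          rw [Finset.sum_const, Nat.card_Ico, nsmul_eq_mul, two_mul, Nat.add_sub_cancel]
          field_simp
      _ ≤ _ := by
          refine Finset.sum_le_sum fun m hm => ?_
          obtain ⟨hm1, hm2⟩ := Finset.mem_Ico.1 hm
          have hn1' : (N : ℝ) ≤ n := by exact_mod_cast hn1
          have hm1' : (N : ℝ) ≤ m := by exact_mod_cast hm1
          have hnm : (n : ℝ) + m + 1 ≤ 4 * N := by exact_mod_cast (by omega : n + m + 1 ≤ 4 * N)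
          have hWn := Real.sqrt_pos.2 (hpos n)
          have hWm := Real.sqrt_pos.2 (hpos m)
          gcongr
          -- With the indices exchanged, the upper bound controls `√(W m) / √(W n)` and so becomes a
          -- lower bound for the entry at `(n, m)`. The constant `16` comes from `(n + m + 1)² ≤
          -- (4N)²`.
          have h1 := hK m n
          have h2 : C * (ratioKernel δ m n / (Real.sqrt (m + 1) * Real.sqrt (n + 1))) ≤
              C * (1 / N) := by
            gcongr
            · exact ratioKernel_le_one hδ0.le m n
            · calc (N : ℝ) = Real.sqrt N * Real.sqrt N := (Real.mul_self_sqrt hN0.le).symm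
                _ ≤ _ := by gcongr <;> linarith
          have h3 := h1.trans h2
          rw [div_le_iff₀ (by positivity)] at h3
          rw [le_div_iff₀ (by positivity), inv_mul_le_iff₀ (by positivity)]
          have hD : (0 : ℝ) < (n : ℝ) + m + 1 := by positivity
          have e : (m : ℝ) + n + 1 = n + m + 1 := by ring
          rw [e] at h3
          calc Real.sqrt (W m) * ((n : ℝ) + m + 1)
              ≤ C * (1 / N) * (Real.sqrt (W n) * (n + m + 1)) * (n + m + 1) := by gcongr
            _ ≤ C * (1 / N) * (Real.sqrt (W n) * (4 * N)) * (4 * N) := by gcongr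
            _ = 16 * C * N * Real.sqrt (W n) := by field_simp; norm_num
  rw [hTx, norm_mul, Complex.norm_real, Real.norm_of_nonneg (hnonneg N n)]
  calc ‖c n‖ ^ 2 / N = (16 * C) ^ 2 * ((16 * C * Real.sqrt N)⁻¹ * ‖c n‖) ^ 2 := by
        rw [mul_pow _ ‖c n‖, inv_pow, mul_pow _ (Real.sqrt N), Real.sq_sqrt hN0.le]
        field_simp
    _ ≤ _ := by gcongr

/-! ### Taylor coefficients on the disc -/

/-- The Taylor coefficients at the origin. -/
noncomputable def taylorCoeff (f : ℂ → ℂ) (n : ℕ) : ℂ := iteratedDeriv n f 0 / n.factorial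

theorem mem_disc {z : ℂ} : z ∈ disc ↔ ‖z‖ < 1 := mem_ball_zero_iff

theorem hasSum_taylorCoeff {f : ℂ → ℂ} (hf : DifferentiableOn ℂ f disc) {z : ℂ} (hz : z ∈ disc) :
    HasSum (fun n => taylorCoeff f n * z ^ n) (f z) := by
  have h := Complex.hasSum_taylorSeries_on_ball (c := 0) (r := 1) hf hz
  refine h.congr_fun fun n => ?_
  simp only [taylorCoeff, sub_zero, smul_eq_mul]
  ring

theorem taylorCoeff_deriv (f : ℂ → ℂ) (n : ℕ) :
    taylorCoeff (deriv f) n = (n + 1) * taylorCoeff f (n + 1) := by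
  have h : ((n.factorial : ℕ) : ℂ) ≠ 0 := by exact_mod_cast n.factorial_ne_zero
  have h1 : (n : ℂ) + 1 ≠ 0 := by exact_mod_cast n.succ_ne_zero
  rw [taylorCoeff, taylorCoeff, iteratedDeriv_succ', Nat.factorial_succ]
  push_cast
  field_simp

theorem differentiableOn_deriv {f : ℂ → ℂ} (hf : DifferentiableOn ℂ f disc) :
    DifferentiableOn ℂ (deriv f) disc := hf.deriv isOpen_disc

/-- Convergence at every real radius below `1` forces the radius of convergence to be at least `1`.
Analyticity of a pointwise sum and uniqueness of its coefficients both come from here. -/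
theorem hasFPowerSeriesOnBall_of_hasSum {f : ℂ → ℂ} {a : ℕ → ℂ}
    (h : ∀ z ∈ disc, HasSum (fun n => a n * z ^ n) (f z)) :
    HasFPowerSeriesOnBall f (FormalMultilinearSeries.ofScalars ℂ a) 0 1 where
  r_le := by
    refine ENNReal.le_of_forall_nnreal_lt fun r hr => ?_
    refine FormalMultilinearSeries.le_radius_of_summable_norm _ ?_
    have hr1 : ((r : ℝ) : ℂ) ∈ disc := ofReal_mem_disc r.2 (by exact_mod_cast hr)
    have := (h _ hr1).summable.norm
    simpa [FormalMultilinearSeries.ofScalars_norm] using this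
  r_pos := one_pos
  hasSum := fun {y} hy => by
    have hy' : y ∈ disc := by
      rwa [disc, ← Metric.eball_ofReal, ENNReal.ofReal_one]
    simpa [FormalMultilinearSeries.ofScalars_apply_eq, mul_comm] using h y hy'

theorem differentiableOn_of_hasSum {f : ℂ → ℂ} {a : ℕ → ℂ}
    (h : ∀ z ∈ disc, HasSum (fun n => a n * z ^ n) (f z)) : DifferentiableOn ℂ f disc := by
  have := (hasFPowerSeriesOnBall_of_hasSum h).differentiableOn
  rwa [← ENNReal.ofReal_one, Metric.eball_ofReal] at this

theorem taylorCoeff_eq_of_hasSum {f : ℂ → ℂ} {a : ℕ → ℂ}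
    (h : ∀ z ∈ disc, HasSum (fun n => a n * z ^ n) (f z)) : taylorCoeff f = a := by
  have h1 := (hasFPowerSeriesOnBall_of_hasSum h).hasFPowerSeriesAt
  have h2 := h1.analyticAt.hasFPowerSeriesAt
  exact FormalMultilinearSeries.ofScalars_series_injective ℂ (E := ℂ)
    (h2.eq_formalMultilinearSeries h1)

theorem taylorCoeff_zero (f : ℂ → ℂ) : taylorCoeff f 0 = f 0 := by simp [taylorCoeff]

theorem taylorCoeff_add {f h : ℂ → ℂ} (hf : DifferentiableOn ℂ f disc)
    (hh : DifferentiableOn ℂ h disc) (n : ℕ) :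
    taylorCoeff (f + h) n = taylorCoeff f n + taylorCoeff h n := by
  refine congrFun (taylorCoeff_eq_of_hasSum (a := fun n => taylorCoeff f n + taylorCoeff h n)
    fun z hz => ?_) n
  simp only [add_mul]
  exact (hasSum_taylorCoeff hf hz).add (hasSum_taylorCoeff hh hz)

theorem taylorCoeff_smul {f : ℂ → ℂ} (hf : DifferentiableOn ℂ f disc) (c : ℂ) (n : ℕ) :
    taylorCoeff (c • f) n = c * taylorCoeff f n := by
  refine congrFun (taylorCoeff_eq_of_hasSum (a := fun n => c * taylorCoeff f n)
    fun z hz => ?_) n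
  simp only [mul_assoc]
  exact (hasSum_taylorCoeff hf hz).mul_left c

/-! ### Parseval on circles and the mean Lipschitz condition -/

theorem circle_mem_disc {r : ℝ} (h0 : 0 ≤ r) (h1 : r < 1) (θ : ℝ) :
    (r : ℂ) * Complex.exp (Complex.I * θ) ∈ disc := by
  rw [mem_disc, norm_mul, mul_comm Complex.I, Complex.norm_exp_ofReal_mul_I, mul_one,
    Complex.norm_real, Real.norm_of_nonneg h0]
  exact h1

theorem integral_exp_int_mul (k : ℤ) :
    ∫ θ in (-Real.pi)..Real.pi, Complex.exp (k * (Complex.I * θ)) =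
      if k = 0 then (2 * Real.pi : ℂ) else 0 := by
  split_ifs with h
  · subst h
    simp only [Int.cast_zero, zero_mul, Complex.exp_zero, intervalIntegral.integral_const]
    rw [sub_neg_eq_add, Complex.real_smul]
    push_cast
    ring
  · have hc : (k : ℂ) * Complex.I ≠ 0 := mul_ne_zero (by exact_mod_cast h) Complex.I_ne_zero
    have := integral_exp_mul_complex (a := -Real.pi) (b := Real.pi) hc
    simp only [← mul_assoc]
    rw [this]
    have e : Complex.exp (k * Complex.I * (Real.pi : ℝ)) =
        Complex.exp (k * Complex.I * ((-Real.pi : ℝ) : ℂ)) := by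
      rw [Complex.exp_eq_exp_iff_exists_int]
      exact ⟨k, by push_cast; ring⟩
    rw [e, sub_self, zero_div]

section Parseval

variable {F : ℂ → ℂ} {r : ℝ}

theorem summable_norm_taylorCoeff (hF : DifferentiableOn ℂ F disc) (h0 : 0 ≤ r) (h1 : r < 1) :
    Summable fun n => ‖taylorCoeff F n‖ * r ^ n := by
  have := (hasSum_taylorCoeff hF (ofReal_mem_disc h0 h1)).summable.norm
  simpa [abs_of_nonneg h0] using this

theorem continuous_circle (hF : DifferentiableOn ℂ F disc) (h0 : 0 ≤ r) (h1 : r < 1) :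
    Continuous fun θ : ℝ => F (r * Complex.exp (Complex.I * θ)) :=
  hF.continuousOn.comp_continuous (by fun_prop) (circle_mem_disc h0 h1)

/-- Used twice for Parseval: `G` an exponential extracts the Fourier coefficients, then `G` the
conjugate of `F` gives the square mean. -/
theorem hasSum_circle_mul (hF : DifferentiableOn ℂ F disc) (h0 : 0 ≤ r) (h1 : r < 1)
    {G : ℝ → ℂ} (hG : Continuous G) :
    HasSum (fun n => taylorCoeff F n * r ^ n *
        ∫ θ in (-Real.pi)..Real.pi, Complex.exp ((n : ℤ) * (Complex.I * θ)) * G θ)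
      (∫ θ in (-Real.pi)..Real.pi, F (r * Complex.exp (Complex.I * θ)) * G θ) := by
  have hs := summable_norm_taylorCoeff hF h0 h1
  have key := intervalIntegral.hasSum_integral_of_dominated_convergence (μ := volume)
    (a := -Real.pi) (b := Real.pi)
    (F := fun (n : ℕ) (θ : ℝ) => taylorCoeff F n * r ^ n *
      (Complex.exp ((n : ℤ) * (Complex.I * θ)) * G θ))
    (f := fun θ => F (r * Complex.exp (Complex.I * θ)) * G θ)
    (fun n θ => ‖taylorCoeff F n‖ * r ^ n * ‖G θ‖) ?_ ?_ ?_ ?_ ?_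
  · simpa only [intervalIntegral.integral_const_mul] using key
  · intro n
    exact (by fun_prop : Continuous _).aestronglyMeasurable
  · refine fun n => Eventually.of_forall fun θ _ => le_of_eq ?_
    have : Complex.exp ((n : ℤ) * (Complex.I * θ)) = Complex.exp (((n * θ : ℝ) : ℂ) * Complex.I) := by
      congr 1; push_cast; ring
    rw [this, norm_mul, norm_mul, norm_mul, Complex.norm_exp_ofReal_mul_I, one_mul, norm_pow,
      Complex.norm_real, Real.norm_of_nonneg h0]
  · exact Eventually.of_forall fun θ _ => hs.mul_right _
  · simp only [tsum_mul_right]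
    exact (by fun_prop : Continuous _).intervalIntegrable _ _
  · refine Eventually.of_forall fun θ _ => ?_
    have h := (hasSum_taylorCoeff hF (circle_mem_disc h0 h1 θ)).mul_right (G θ)
    refine h.congr_fun fun n => ?_
    rw [mul_pow, ← Complex.exp_nat_mul]
    push_cast
    ring

theorem hasSum_sq_taylorCoeff (hF : DifferentiableOn ℂ F disc) (h0 : 0 ≤ r) (h1 : r < 1) :
    HasSum (fun n => ‖taylorCoeff F n‖ ^ 2 * r ^ (2 * n))
      ((1 / (2 * Real.pi)) *
        ∫ θ in (-Real.pi)..Real.pi, ‖F (r * Complex.exp (Complex.I * θ))‖ ^ 2) := by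
  have hcont := continuous_circle hF h0 h1
  have hcoef : ∀ n : ℕ, ∫ θ in (-Real.pi)..Real.pi, Complex.exp ((n : ℤ) * (Complex.I * θ)) *
      starRingEnd ℂ (F (r * Complex.exp (Complex.I * θ))) =
      2 * Real.pi * starRingEnd ℂ (taylorCoeff F n) * r ^ n := by
    intro n
    have h := hasSum_circle_mul hF h0 h1
      (G := fun θ => Complex.exp ((-n : ℤ) * (Complex.I * θ))) (by fun_prop)
    have e : ∀ m : ℕ, ∫ θ in (-Real.pi)..Real.pi, Complex.exp ((m : ℤ) * (Complex.I * θ)) *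
        Complex.exp ((-n : ℤ) * (Complex.I * θ)) = if m = n then (2 * Real.pi : ℂ) else 0 := by
      intro m
      have h3 := integral_exp_int_mul ((m : ℤ) - n)
      simp only [sub_eq_zero, Nat.cast_inj] at h3
      rw [← h3]
      congr 1
      funext θ
      rw [← Complex.exp_add]
      congr 1; push_cast; ring
    simp only [e, mul_ite, mul_zero] at h
    have h4 := h.unique (hasSum_single n fun m hm => if_neg hm)
    rw [if_pos rfl] at h4
    have h5 : ∫ θ in (-Real.pi)..Real.pi, Complex.exp ((n : ℤ) * (Complex.I * θ)) *
        starRingEnd ℂ (F (r * Complex.exp (Complex.I * θ))) =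
        ∫ θ in (-Real.pi)..Real.pi, starRingEnd ℂ (F (r * Complex.exp (Complex.I * θ)) *
          Complex.exp ((-n : ℤ) * (Complex.I * θ))) := by
      refine intervalIntegral.integral_congr fun θ _ => ?_
      simp only [map_mul, ← Complex.exp_conj, Complex.conj_ofReal, Complex.conj_I, map_intCast]
      rw [mul_comm]
      congr 2
      push_cast; ring
    rw [h5, intervalIntegral.intervalIntegral_conj, h4]
    simp only [map_mul, map_pow, Complex.conj_ofReal, map_ofNat]
    ring
  have h := hasSum_circle_mul hF h0 h1
    (G := fun θ => starRingEnd ℂ (F (r * Complex.exp (Complex.I * θ))))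
    (Complex.continuous_conj.comp hcont)
  simp only [hcoef, Complex.mul_conj'] at h
  have h6 := h.mul_left (1 / (2 * Real.pi : ℂ))
  rw [← Complex.hasSum_ofReal]
  have hpi : (Real.pi : ℂ) ≠ 0 := by exact_mod_cast Real.pi_ne_zero
  convert! h6 using 1
  · funext n
    push_cast
    rw [← Complex.mul_conj']
    field_simp
    ring
  · push_cast
    congr 1
    rw [← intervalIntegral.integral_ofReal]
    push_cast
    rfl

end Parseval

theorem isLittleMeanLipschitz_iff {g : ℂ → ℂ} (hg : DifferentiableOn ℂ g disc) :
    IsLittleMeanLipschitz g ↔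
      Tendsto (fun N : ℕ => (∑ n ∈ Finset.range N, ‖taylorCoeff (deriv g) n‖ ^ 2) / N)
        atTop (𝓝 0) := by
  have hd := differentiableOn_deriv hg
  have hF : ∀ r ∈ Ioo (0 : ℝ) 1, HasSum (fun n => ‖taylorCoeff (deriv g) n‖ ^ 2 * r ^ (2 * n))
      (integralMean r (deriv g) ^ 2) := by
    intro r hr
    have h := hasSum_sq_taylorCoeff hd hr.1.le hr.2
    rwa [integralMean, Real.sq_sqrt (h.nonneg fun n => by have := hr.1; positivity)]
  rw [← tendsto_abel_iff (fun n => sq_nonneg _) hF, IsLittleMeanLipschitz, and_iff_right hg]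
  have hIoo : ∀ᶠ r : ℝ in 𝓝[<] 1, r ∈ Ioo (0 : ℝ) 1 := Ioo_mem_nhdsLT (by norm_num)
  have hsq : (fun r : ℝ => (integralMean r (deriv g) * (1 - r) ^ (1 / 2 : ℝ)) ^ 2) =ᶠ[𝓝[<] 1]
      fun r => integralMean r (deriv g) ^ 2 * (1 - r) := by
    filter_upwards [hIoo] with r hr
    rw [mul_pow, ← Real.sqrt_eq_rpow, Real.sq_sqrt (by linarith [hr.2])]
  rw [← tendsto_congr' hsq]
  constructor
  · intro h
    simpa using h.pow 2
  · intro h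
    have h2 := h.sqrt
    rw [Real.sqrt_zero] at h2
    refine h2.congr' ?_
    filter_upwards [hIoo] with r hr
    exact Real.sqrt_sq (mul_nonneg (Real.sqrt_nonneg _)
      (Real.rpow_nonneg (by linarith [hr.2]) _))

/-! ### The Dirichlet norm in terms of coefficients -/

theorem polarCoord_symm_eq_exp (p : ℝ × ℝ) :
    Complex.polarCoord.symm p = p.1 * Complex.exp (Complex.I * p.2) := by
  rw [Complex.polarCoord_symm_apply, mul_comm Complex.I, Complex.exp_mul_I]
  push_cast
  rfl

theorem lintegral_circle_sq {F : ℂ → ℂ} (hF : DifferentiableOn ℂ F disc) {r : ℝ} (h0 : 0 ≤ r)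
    (h1 : r < 1) :
    ∫⁻ θ in Ioo (-Real.pi) Real.pi,
        ENNReal.ofReal (‖F (r * Complex.exp (Complex.I * θ))‖ ^ 2) =
      ∑' n, ENNReal.ofReal (2 * Real.pi * ‖taylorCoeff F n‖ ^ 2) *
        ENNReal.ofReal (r ^ (2 * n)) := by
  have hc : Continuous fun θ : ℝ => ‖F (r * Complex.exp (Complex.I * θ))‖ ^ 2 :=
    (continuous_circle hF h0 h1).norm.pow 2
  rw [restrict_Ioo_eq_restrict_Ioc, ← ofReal_integral_eq_lintegral_ofReal
    (hc.integrableOn_Icc.mono_set Ioc_subset_Icc_self) (Eventually.of_forall fun θ => sq_nonneg _),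
    ← intervalIntegral.integral_of_le (by linarith [Real.pi_pos])]
  have h := (hasSum_sq_taylorCoeff hF h0 h1).mul_left (2 * Real.pi)
  rw [← mul_assoc, mul_one_div_cancel (by positivity), one_mul] at h
  rw [← h.tsum_eq, ENNReal.ofReal_tsum_of_nonneg (fun n => by positivity) h.summable]
  refine tsum_congr fun n => ?_
  rw [← ENNReal.ofReal_mul (by positivity), mul_assoc (2 * Real.pi)]

/-- Parseval on each circle, then integration in the radius. Working in `[0, ∞]` makes this an
identity without any finiteness assumption, so it also characterizes membership in the space. -/
theorem RadialWeight.lintegral_sq_mul_eq (v : RadialWeight) {F : ℂ → ℂ}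
    (hF : DifferentiableOn ℂ F disc) :
    ∫⁻ z in disc, ENNReal.ofReal (‖F z‖ ^ 2 * v.toFun z) =
      ENNReal.ofReal Real.pi * ∑' n, ENNReal.ofReal (‖taylorCoeff F n‖ ^ 2) * v.moment n := by
  have hcont : ContinuousOn (fun p : ℝ × ℝ => F (p.1 * Complex.exp (Complex.I * p.2)))
      (Ioo (0 : ℝ) 1 ×ˢ Ioo (-Real.pi) Real.pi) :=
    hF.continuousOn.comp (by fun_prop) fun p hp => circle_mem_disc hp.1.1.le hp.1.2 p.2
  have hmeas : AEMeasurable (fun p : ℝ × ℝ =>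
      ENNReal.ofReal (‖F (p.1 * Complex.exp (Complex.I * p.2))‖ ^ 2))
      ((volume.restrict (Ioo (0 : ℝ) 1)).prod (volume.restrict (Ioo (-Real.pi) Real.pi))) := by
    rw [← volume_restrict_polarRect]
    exact ((hcont.norm.pow 2).aemeasurable
      (measurableSet_Ioo.prod measurableSet_Ioo)).ennreal_ofReal
  rw [lintegral_disc_eq_polar, setLIntegral_congr_fun (g := fun p : ℝ × ℝ =>
      (ENNReal.ofReal p.1 * v.ray p.1) *
        ENNReal.ofReal (‖F (p.1 * Complex.exp (Complex.I * p.2))‖ ^ 2))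
      (measurableSet_Ioo.prod measurableSet_Ioo) ?_, volume_restrict_polarRect, lintegral_prod]
  · have hrow : ∀ r ∈ Ioo (0 : ℝ) 1, ∫⁻ θ in Ioo (-Real.pi) Real.pi,
        (ENNReal.ofReal r * v.ray r) *
          ENNReal.ofReal (‖F (r * Complex.exp (Complex.I * θ))‖ ^ 2) =
        ∑' n, ENNReal.ofReal (2 * Real.pi * ‖taylorCoeff F n‖ ^ 2) *
          (ENNReal.ofReal (r ^ (2 * n + 1)) * v.ray r) := by
      intro r hr
      rw [lintegral_const_mul' _ _ (show ENNReal.ofReal r * v.ray r ≠ ⊤ from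
          ENNReal.mul_ne_top ENNReal.ofReal_ne_top ENNReal.ofReal_ne_top),
        lintegral_circle_sq hF hr.1.le hr.2, ← ENNReal.tsum_mul_left]
      refine tsum_congr fun n => ?_
      rw [pow_succ r, ENNReal.ofReal_mul (p := r ^ (2 * n)) (by have := hr.1; positivity)]
      ring
    rw [setLIntegral_congr_fun measurableSet_Ioo hrow, lintegral_tsum, ← ENNReal.tsum_mul_left]
    · refine tsum_congr fun n => ?_
      rw [lintegral_const_mul' _ _ ENNReal.ofReal_ne_top, RadialWeight.moment,
        ENNReal.ofReal_mul (by positivity), ENNReal.ofReal_mul (by positivity),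
        ENNReal.ofReal_ofNat]
      ring
    · intro n
      exact ((by fun_prop : Measurable fun r : ℝ => ENNReal.ofReal (r ^ (2 * n + 1))).aemeasurable.mul
        v.aemeasurable_ray).const_mul _
  · exact ((ENNReal.measurable_ofReal.aemeasurable.mul v.aemeasurable_ray).comp_fst).mul hmeas
  · intro p hp
    simp only
    rw [ENNReal.ofReal_mul (sq_nonneg _), v.ofReal_toFun_polar hp.1, polarCoord_symm_eq_exp]
    ring

/-- The weights of the squared Taylor coefficients in the norm of `D_v`. -/
noncomputable def RadialWeight.weight (v : RadialWeight) : ℕ → ℝ :=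
  coeffWeight fun n => (v.moment n).toReal

theorem RadialWeight.moment_toReal_pos (v : RadialWeight) (n : ℕ) : 0 < (v.moment n).toReal :=
  ENNReal.toReal_pos (v.moment_pos n).ne' (v.moment_ne_top n)

theorem RadialWeight.weight_pos (v : RadialWeight) (n : ℕ) : 0 < v.weight n :=
  coeffWeight_pos v.moment_toReal_pos n

theorem RadialWeight.lintegral_deriv_sq_mul_eq (v : RadialWeight) {f : ℂ → ℂ}
    (hf : DifferentiableOn ℂ f disc) :
    ∫⁻ z in disc, ENNReal.ofReal (‖deriv f z‖ ^ 2 * v.toFun z) =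
      ENNReal.ofReal Real.pi *
        ∑' n, ENNReal.ofReal (v.weight (n + 1) * ‖taylorCoeff f (n + 1)‖ ^ 2) := by
  rw [v.lintegral_sq_mul_eq (differentiableOn_deriv hf)]
  congr 1
  refine tsum_congr fun n => ?_
  have e : ‖((n : ℂ) + 1)‖ = n + 1 := by
    rw [show (n : ℂ) + 1 = ((n + 1 : ℕ) : ℂ) by push_cast; rfl, Complex.norm_natCast]
    push_cast; rfl
  rw [← ENNReal.ofReal_toReal (v.moment_ne_top n), ← ENNReal.ofReal_mul (sq_nonneg _),
    taylorCoeff_deriv, norm_mul, e]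
  congr 1
  simp only [RadialWeight.weight, coeffWeight]
  ring

theorem RadialWeight.integrableOn_iff_summable (v : RadialWeight) {f : ℂ → ℂ}
    (hf : DifferentiableOn ℂ f disc) :
    IntegrableOn (fun z => ‖deriv f z‖ ^ 2 * v.toFun z) disc ↔
      Summable fun n => v.weight n * ‖taylorCoeff f n‖ ^ 2 := by
  have hw := v.weight_pos
  have hnn : ∀ n, 0 ≤ v.weight n * ‖taylorCoeff f n‖ ^ 2 := fun n => by have := hw n; positivity
  have hmeas : AEStronglyMeasurable (fun z => ‖deriv f z‖ ^ 2 * v.toFun z) (volume.restrict disc) :=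
    ((measurable_deriv f).norm.pow_const 2).aestronglyMeasurable.mul v.integrable.aestronglyMeasurable
  have hpos : 0 ≤ᵐ[volume.restrict disc] fun z => ‖deriv f z‖ ^ 2 * v.toFun z := by
    filter_upwards [ae_restrict_mem measurableSet_disc] with z hz
    exact mul_nonneg (sq_nonneg _) (v.pos z hz).le
  rw [IntegrableOn, Integrable, and_iff_right hmeas, hasFiniteIntegral_iff_ofReal hpos,
    v.lintegral_deriv_sq_mul_eq hf, ← summable_nat_add_iff 1]
  constructor
  · intro h
    have h2 := ENNReal.lt_top_of_mul_ne_top_right h.ne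
      (ENNReal.ofReal_pos.2 Real.pi_pos).ne'
    exact (ENNReal.summable_toReal h2.ne).congr fun n => ENNReal.toReal_ofReal (hnn _)
  · intro h
    exact ENNReal.mul_lt_top ENNReal.ofReal_lt_top
      (by rw [← ENNReal.ofReal_tsum_of_nonneg (fun n => hnn _) h]; exact ENNReal.ofReal_lt_top)

namespace DirichletSpace

variable {v : RadialWeight}

theorem hasSum_weight_mul (f : DirichletSpace v) :
    HasSum (fun n => v.weight n * ‖taylorCoeff f.fn n‖ ^ 2) (‖f‖ ^ 2) := by
  have hw := v.weight_pos
  have hnn : ∀ n, 0 ≤ v.weight n * ‖taylorCoeff f.fn n‖ ^ 2 := fun n => by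
    have := hw n; positivity
  have hs := (v.integrableOn_iff_summable f.differentiableOn).1 f.integrableOn
  have hpos : 0 ≤ᵐ[volume.restrict disc] fun z => ‖deriv f.fn z‖ ^ 2 * v.toFun z := by
    filter_upwards [ae_restrict_mem measurableSet_disc] with z hz
    exact mul_nonneg (sq_nonneg _) (v.pos z hz).le
  rw [norm_sq_eq, integral_eq_lintegral_of_nonneg_ae hpos f.integrableOn.aestronglyMeasurable,
    v.lintegral_deriv_sq_mul_eq f.differentiableOn,
    ← ENNReal.ofReal_tsum_of_nonneg (fun n => hnn _) ((summable_nat_add_iff 1).2 hs),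
    ← ENNReal.ofReal_mul Real.pi_pos.le, ENNReal.toReal_ofReal
      (mul_nonneg Real.pi_pos.le (tsum_nonneg fun n => hnn _)), ← mul_assoc,
    one_div_mul_cancel Real.pi_ne_zero, one_mul]
  have h0 : v.weight 0 * ‖taylorCoeff f.fn 0‖ ^ 2 = ‖f.fn 0‖ ^ 2 := by
    rw [taylorCoeff_zero, RadialWeight.weight, coeffWeight, one_mul]
  rw [← h0, ← hs.tsum_eq_zero_add]
  exact hs.hasSum

end DirichletSpace

theorem RadialWeight.exists_isHilbertRegular_weight {v : RadialWeight} (hv : v.IsDoubling)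
    (hM1 : v.muckenhouptOne < ⊤) (hM2 : v.muckenhouptTwo < ⊤) :
    ∃ C δ, IsHilbertRegular v.weight C δ := by
  obtain ⟨D, hD, h1⟩ := v.exists_moment_le_double hv hM2
  obtain ⟨A, hA, h2⟩ := v.exists_sum_moment_le hv hM1 hM2
  obtain ⟨B, hB, h3⟩ := v.exists_sum_sq_moment_le hM2
  have hne := v.moment_ne_top
  -- The factors `2` and `8 = 2³` pay for replacing `n + 2` by `2 (n + 1)`.
  refine exists_isHilbertRegular (A := 2 * A.toReal) (B := 8 * B.toReal) (D := D.toReal)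
    v.moment_toReal_pos (fun m n h => ENNReal.toReal_mono (hne m) (v.moment_antitone h)) ?_ ?_ ?_
  · intro n
    rw [← ENNReal.toReal_mul]
    exact ENNReal.toReal_mono (ENNReal.mul_ne_top hD (hne _)) (h1 n)
  · intro n N
    have h := ENNReal.toReal_mono (by have := hne n; finiteness) (h2 n N)
    rw [ENNReal.toReal_sum fun m _ => hne m, ENNReal.toReal_mul, ENNReal.toReal_mul,
      ENNReal.toReal_ofReal (by positivity)] at h
    refine h.trans ?_
    calc A.toReal * ((n + 2) * (v.moment n).toReal)
        ≤ A.toReal * ((2 * (n + 1)) * (v.moment n).toReal) := by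
          gcongr
          linarith [(n.cast_nonneg : (0 : ℝ) ≤ n)]
      _ = _ := by ring
  · intro n
    have h := ENNReal.toReal_mono (by have := hne n; finiteness) (h3 n)
    rw [ENNReal.toReal_sum fun m _ => ENNReal.mul_ne_top ENNReal.ofReal_ne_top (hne m),
      ENNReal.toReal_mul, ENNReal.toReal_mul, ENNReal.toReal_ofReal (by positivity)] at h
    have e : ∀ m : ℕ, (ENNReal.ofReal (((m : ℝ) + 1) ^ 2) * v.moment m).toReal =
        ((m : ℝ) + 1) ^ 2 * (v.moment m).toReal := fun m => by
      rw [ENNReal.toReal_mul, ENNReal.toReal_ofReal (by positivity)]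
    simp only [e] at h
    refine h.trans ?_
    calc B.toReal * (((n : ℝ) + 2) ^ 3 * (v.moment n).toReal)
        ≤ B.toReal * ((2 * ((n : ℝ) + 1)) ^ 3 * (v.moment n).toReal) := by
          gcongr
          linarith [(n.cast_nonneg : (0 : ℝ) ≤ n)]
      _ = _ := by ring

/-! ### Summability of the coefficients -/

theorem IsHilbertRegular.inv_sqrt_le {W : ℕ → ℝ} {C δ : ℝ} (hW : IsHilbertRegular W C δ) (m : ℕ) :
    Real.sqrt (W 0) / (Real.sqrt (W m) * ((m : ℝ) + 1)) ≤ C * ((m : ℝ) + 1) ^ (-(δ + 1 / 2)) := by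
  have h := hW.2.2.2.2 0 m
  have hm : (0 : ℝ) < m + 1 := by positivity
  have e : ratioKernel δ 0 m / (Real.sqrt ((0 : ℕ) + 1) * Real.sqrt (m + 1)) =
      ((m : ℝ) + 1) ^ (-(δ + 1 / 2)) := by
    rw [ratioKernel, if_pos m.zero_le, Real.rpow_neg hm.le, Real.rpow_add hm,
      ← Real.sqrt_eq_rpow, Real.div_rpow (by positivity) hm.le]
    simp only [Nat.cast_zero, zero_add, Real.one_rpow, Real.sqrt_one, one_mul]
    rw [one_div, mul_inv, div_eq_mul_inv]
  rw [e] at h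
  simpa using h

/-- Row `0` of the kernel bound dominates the terms by a multiple of `(m+1)^(-1-2δ)`. Paired with
the norm, this makes `∑ |a m|/(m+1)` finite, which yields integrability of `f` on `(0, 1)`. -/
theorem IsHilbertRegular.summable_inv {W : ℕ → ℝ} {C δ : ℝ} (hW : IsHilbertRegular W C δ) :
    Summable fun m : ℕ => (1 / (Real.sqrt (W m) * ((m : ℝ) + 1))) ^ 2 := by
  have hW0 := Real.sqrt_pos.2 (hW.1 0)
  have hs : Summable fun m : ℕ => ((m : ℝ) + 1) ^ (-(1 + 2 * δ)) := by
    have h := (summable_nat_add_iff 1).2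
      (Real.summable_nat_rpow.2 (by linarith [hW.2.2.1] : -(1 + 2 * δ) < -1))
    simpa using h
  refine Summable.of_nonneg_of_le (fun m => sq_nonneg _) (fun m => ?_)
    (hs.mul_left ((C / Real.sqrt (W 0)) ^ 2))
  have h := hW.inv_sqrt_le m
  have hm : (0 : ℝ) < m + 1 := by positivity
  have h2 : 1 / (Real.sqrt (W m) * ((m : ℝ) + 1)) ≤
      C / Real.sqrt (W 0) * ((m : ℝ) + 1) ^ (-(δ + 1 / 2)) := by
    rw [div_mul_eq_mul_div, le_div_iff₀ hW0]
    refine le_trans (le_of_eq ?_) h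
    ring
  calc (1 / (Real.sqrt (W m) * ((m : ℝ) + 1))) ^ 2
      ≤ (C / Real.sqrt (W 0) * ((m : ℝ) + 1) ^ (-(δ + 1 / 2))) ^ 2 := by gcongr
    _ = _ := by
        rw [mul_pow, ← Real.rpow_mul_natCast hm.le]
        congr 2
        push_cast
        ring

theorem IsHilbertRegular.summable_coeff {W : ℕ → ℝ} {C δ : ℝ} (hW : IsHilbertRegular W C δ)
    {a : ℕ → ℂ} (ha : Summable fun n => W n * ‖a n‖ ^ 2) :
    Summable fun m : ℕ => ‖a m‖ / ((m : ℝ) + 1) := by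
  refine Summable.of_nonneg_of_le (fun m => by positivity) (fun m => ?_) (ha.add hW.summable_inv)
  have hWm := Real.sqrt_pos.2 (hW.1 m)
  have e : ‖a m‖ / ((m : ℝ) + 1) =
      (Real.sqrt (W m) * ‖a m‖) * (1 / (Real.sqrt (W m) * ((m : ℝ) + 1))) := by field_simp
  have e2 : W m * ‖a m‖ ^ 2 = (Real.sqrt (W m) * ‖a m‖) ^ 2 := by
    rw [mul_pow, Real.sq_sqrt (hW.1 m).le]
  rw [e, e2]
  set x := Real.sqrt (W m) * ‖a m‖
  set y := 1 / (Real.sqrt (W m) * ((m : ℝ) + 1))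
  nlinarith [sq_nonneg (x - y), sq_nonneg x, sq_nonneg y]

theorem summable_mul_pow_of_summable_div {a : ℕ → ℂ}
    (ha : Summable fun m : ℕ => ‖a m‖ / ((m : ℝ) + 1)) {z : ℂ} (hz : z ∈ disc) :
    Summable fun n => a n * z ^ n := by
  rw [mem_disc] at hz
  obtain ⟨M, hM⟩ := ha.tendsto_atTop_zero.bddAbove_range
  have h1 : Summable fun n : ℕ => M * (((n : ℝ) + 1) * ‖z‖ ^ n) := by
    have h2 := summable_pow_mul_geometric_of_norm_lt_one 1 (r := ‖z‖) (by simpa using hz)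
    have h3 := summable_geometric_of_lt_one (norm_nonneg z) hz
    refine ((h2.add h3).congr fun n => ?_).mul_left M
    ring
  refine Summable.of_norm_bounded h1 fun n => ?_
  have h2 : ‖a n‖ / ((n : ℝ) + 1) ≤ M := hM ⟨n, rfl⟩
  rw [div_le_iff₀ (by positivity)] at h2
  rw [norm_mul, norm_pow, ← mul_assoc]
  gcongr

/-! ### Identification of the Dirichlet space with square summable sequences -/

namespace DirichletSpace

variable {v : RadialWeight}

theorem summable_coeff {C δ : ℝ} (hW : IsHilbertRegular v.weight C δ) (f : DirichletSpace v) :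
    Summable fun m : ℕ => ‖taylorCoeff f.fn m‖ / ((m : ℝ) + 1) :=
  hW.summable_coeff f.hasSum_weight_mul.summable

theorem norm_sqrt_weight_mul_sq (a : ℂ) (n : ℕ) :
    ‖(Real.sqrt (v.weight n) : ℂ) * a‖ ^ 2 = v.weight n * ‖a‖ ^ 2 := by
  rw [norm_mul, Complex.norm_real, Real.norm_of_nonneg (Real.sqrt_nonneg _), mul_pow,
    Real.sq_sqrt (v.weight_pos n).le]

/-- The normalized Taylor coefficients, as an isometry into the square summable sequences. -/
noncomputable def seqIsometry (v : RadialWeight) : DirichletSpace v →ₗᵢ[ℂ] SeqSpace where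
  toFun f := ⟨fun n => (Real.sqrt (v.weight n) : ℂ) * taylorCoeff f.fn n, by
    refine memℓp_gen ?_
    simp only [ENNReal.toReal_ofNat, Real.rpow_two, norm_sqrt_weight_mul_sq]
    exact f.hasSum_weight_mul.summable⟩
  map_add' f h := by
    refine lp.ext (funext fun n => ?_)
    simp only [lp.coeFn_add, Pi.add_apply, fn_add,
      taylorCoeff_add f.differentiableOn h.differentiableOn, mul_add]
  map_smul' c f := by
    refine lp.ext (funext fun n => ?_)
    simp only [lp.coeFn_smul, Pi.smul_apply, fn_smul, taylorCoeff_smul f.differentiableOn,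
      smul_eq_mul, RingHom.id_apply]
    ring
  norm_map' f := by
    refine (sq_eq_sq₀ (norm_nonneg _) (norm_nonneg _)).1 ?_
    have h := lp.hasSum_norm (p := 2) (by norm_num)
      (⟨fun n => (Real.sqrt (v.weight n) : ℂ) * taylorCoeff f.fn n, by
        refine memℓp_gen ?_
        simp only [ENNReal.toReal_ofNat, Real.rpow_two, norm_sqrt_weight_mul_sq]
        exact f.hasSum_weight_mul.summable⟩ : SeqSpace)
    simp only [ENNReal.toReal_ofNat, Real.rpow_two, norm_sqrt_weight_mul_sq] at h
    exact h.unique f.hasSum_weight_mul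

theorem seqIsometry_apply (f : DirichletSpace v) (n : ℕ) :
    seqIsometry v f n = (Real.sqrt (v.weight n) : ℂ) * taylorCoeff f.fn n := rfl

theorem exists_fn_eq {C δ : ℝ} (hW : IsHilbertRegular v.weight C δ) {a : ℕ → ℂ}
    (ha : Summable fun n => v.weight n * ‖a n‖ ^ 2) :
    ∃ f : DirichletSpace v, taylorCoeff f.fn = a := by
  let F : ℂ → ℂ := disc.indicator fun z => ∑' n, a n * z ^ n
  have hF : ∀ z ∈ disc, HasSum (fun n => a n * z ^ n) (F z) := by
    intro z hz
    simp only [F, indicator_of_mem hz]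
    exact (summable_mul_pow_of_summable_div (hW.summable_coeff ha) hz).hasSum
  have hd := differentiableOn_of_hasSum hF
  have ht := taylorCoeff_eq_of_hasSum hF
  refine ⟨⟨F, hd, fun z hz => indicator_of_notMem hz _, ?_⟩, ht⟩
  rw [v.integrableOn_iff_summable hd, ht]
  exact ha

/-- Kernel regularity ensures that every admissible coefficient sequence has a power series
converging on the whole disc. Surjectivity lets compactness be transferred in both directions. -/
theorem seqIsometry_surjective {C δ : ℝ} (hW : IsHilbertRegular v.weight C δ) :
    Function.Surjective (seqIsometry v) := by
  intro x
  have hne : ∀ n, (Real.sqrt (v.weight n) : ℂ) ≠ 0 := fun n => by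
    exact_mod_cast (Real.sqrt_pos.2 (v.weight_pos n)).ne'
  have hx := (lp.hasSum_norm (p := 2) (by norm_num) x).summable
  simp only [ENNReal.toReal_ofNat, Real.rpow_two] at hx
  obtain ⟨f, hf⟩ := exists_fn_eq hW (a := fun n => x n / (Real.sqrt (v.weight n) : ℂ)) (by
    refine hx.congr fun n => ?_
    rw [← norm_sqrt_weight_mul_sq, mul_div_cancel₀ _ (hne n)])
  refine ⟨f, lp.ext (funext fun n => ?_)⟩
  rw [seqIsometry_apply, hf]
  exact mul_div_cancel₀ _ (hne n)

end DirichletSpace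

/-! ### Term-by-term integration and the coefficients of the Hilbert operator -/

theorem integrable_of_hasSum_of_summable_integral_norm {α : Type*} [MeasurableSpace α]
    {μ : Measure α} {F : ℕ → α → ℂ} {f : α → ℂ} (hF : ∀ n, Integrable (F n) μ)
    (hs : Summable fun n => ∫ a, ‖F n a‖ ∂μ) (hf : ∀ᵐ a ∂μ, HasSum (fun n => F n a) (f a)) :
    Integrable f μ := by
  refine ⟨aestronglyMeasurable_of_tendsto_ae atTop
    (f := fun N a => ∑ n ∈ Finset.range N, F n a)
    (fun N => (integrable_finsetSum _ fun n _ => hF n).1)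
    (hf.mono fun a ha => ha.tendsto_sum_nat), ?_⟩
  have h1 : ∫⁻ a, ‖f a‖ₑ ∂μ ≤ ∫⁻ a, ∑' n, ‖F n a‖ₑ ∂μ :=
    lintegral_mono_ae (hf.mono fun a ha => ha.tsum_eq ▸ enorm_tsum_le_tsum_enorm)
  refine lt_of_le_of_lt h1 ?_
  rw [lintegral_tsum fun n => (hF n).1.enorm]
  simp only [← ofReal_integral_norm_eq_lintegral_enorm (hF _)]
  exact hs.tsum_ofReal_lt_top

theorem hasSum_integral_of_hasSum_of_summable_integral_norm {α : Type*} [MeasurableSpace α]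
    {μ : Measure α} {F : ℕ → α → ℂ} {f : α → ℂ} (hF : ∀ n, Integrable (F n) μ)
    (hs : Summable fun n => ∫ a, ‖F n a‖ ∂μ) (hf : ∀ᵐ a ∂μ, HasSum (fun n => F n a) (f a)) :
    HasSum (fun n => ∫ a, F n a ∂μ) (∫ a, f a ∂μ) := by
  rw [← integral_congr_ae (hf.mono fun a ha => ha.tsum_eq)]
  exact hasSum_integral_of_summable_integral_norm hF hs

theorem setIntegral_pow (k : ℕ) : ∫ t in Ioo (0 : ℝ) 1, t ^ k = 1 / ((k : ℝ) + 1) := by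
  rw [← integral_Ioc_eq_integral_Ioo, ← intervalIntegral.integral_of_le zero_le_one, integral_pow]
  simp

theorem ofReal_mem_disc_of_mem_Ioo {t : ℝ} (ht : t ∈ Ioo (0 : ℝ) 1) : (t : ℂ) ∈ disc := by
  rw [mem_disc, Complex.norm_real, Real.norm_of_nonneg ht.1.le]
  exact ht.2

section PowerSeries

variable {a : ℕ → ℂ} {f : ℂ → ℂ}

theorem integrableOn_const_mul_pow (b : ℂ) (k : ℕ) :
    IntegrableOn (fun t : ℝ => b * (t : ℂ) ^ k) (Ioo 0 1) :=
  ((by fun_prop : Continuous fun t : ℝ => b * (t : ℂ) ^ k).integrableOn_Icc).mono_set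
    Ioo_subset_Icc_self

theorem setIntegral_norm_const_mul_pow (b : ℂ) (k : ℕ) :
    ∫ t in Ioo (0 : ℝ) 1, ‖b * (t : ℂ) ^ k‖ = ‖b‖ / ((k : ℝ) + 1) := by
  rw [setIntegral_congr_fun (g := fun t => ‖b‖ * t ^ k) measurableSet_Ioo, integral_const_mul,
    setIntegral_pow, mul_one_div]
  intro t ht
  simp only [norm_mul, norm_pow, Complex.norm_real, Real.norm_of_nonneg ht.1.le]

theorem setIntegral_const_mul_pow (b : ℂ) (k : ℕ) :
    ∫ t in Ioo (0 : ℝ) 1, b * (t : ℂ) ^ k = b / ((k : ℂ) + 1) := by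
  have h : ∫ t in Ioo (0 : ℝ) 1, (t : ℂ) ^ k = ((1 / ((k : ℝ) + 1) : ℝ) : ℂ) := by
    rw [← setIntegral_pow, ← integral_complex_ofReal]
    simp
  rw [integral_const_mul, h]
  push_cast
  ring

theorem summable_setIntegral_norm (ha : Summable fun m : ℕ => ‖a m‖ / ((m : ℝ) + 1)) (n : ℕ) :
    Summable fun m : ℕ => ∫ t in Ioo (0 : ℝ) 1, ‖a m * (t : ℂ) ^ (n + m)‖ := by
  refine Summable.of_nonneg_of_le (fun m => integral_nonneg fun t => norm_nonneg _) (fun m => ?_) ha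
  rw [setIntegral_norm_const_mul_pow]
  push_cast
  gcongr
  linarith [(n.cast_nonneg : (0 : ℝ) ≤ n)]

theorem ae_hasSum_pow_mul (hf : ∀ z ∈ disc, HasSum (fun m => a m * z ^ m) (f z)) (n : ℕ) :
    ∀ᵐ t : ℝ ∂volume.restrict (Ioo 0 1),
      HasSum (fun m => a m * (t : ℂ) ^ (n + m)) ((t : ℂ) ^ n * f t) := by
  filter_upwards [ae_restrict_mem measurableSet_Ioo] with t ht
  refine ((hf t (ofReal_mem_disc_of_mem_Ioo ht)).mul_left ((t : ℂ) ^ n)).congr_fun fun m => ?_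
  ring

theorem integrableOn_of_summable_div (ha : Summable fun m : ℕ => ‖a m‖ / ((m : ℝ) + 1))
    (hf : ∀ z ∈ disc, HasSum (fun m => a m * z ^ m) (f z)) :
    IntegrableOn (fun t : ℝ => f t) (Ioo 0 1) := by
  have h := integrable_of_hasSum_of_summable_integral_norm
    (fun m => integrableOn_const_mul_pow (a m) (0 + m)) (summable_setIntegral_norm ha 0)
    (ae_hasSum_pow_mul hf 0)
  simpa [IntegrableOn] using h

theorem hasSum_setIntegral_pow_mul (ha : Summable fun m : ℕ => ‖a m‖ / ((m : ℝ) + 1))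
    (hf : ∀ z ∈ disc, HasSum (fun m => a m * z ^ m) (f z)) (n : ℕ) :
    HasSum (fun m : ℕ => a m / ((n : ℂ) + m + 1)) (∫ t in Ioo (0 : ℝ) 1, (t : ℂ) ^ n * f t) := by
  have h := hasSum_integral_of_hasSum_of_summable_integral_norm
    (fun m => integrableOn_const_mul_pow (a m) (n + m)) (summable_setIntegral_norm ha n)
    (ae_hasSum_pow_mul hf n)
  simpa only [setIntegral_const_mul_pow, Nat.cast_add] using h

end PowerSeries

theorem ofReal_mul_mem_disc {t : ℝ} (ht : t ∈ Icc (0 : ℝ) 1) {z : ℂ} (hz : z ∈ disc) :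
    (t : ℂ) * z ∈ disc := by
  rw [mem_disc] at hz ⊢
  rw [norm_mul, Complex.norm_real, Real.norm_of_nonneg ht.1]
  exact (mul_le_of_le_one_left (norm_nonneg z) ht.2).trans_lt hz

theorem intervalIntegrable_iff_Ioo {f : ℝ → ℂ} :
    IntervalIntegrable f volume 0 1 ↔ IntegrableOn f (Ioo 0 1) := by
  rw [intervalIntegrable_iff_integrableOn_Ioc_of_le zero_le_one,
    integrableOn_Ioc_iff_integrableOn_Ioo]

section Operator

variable {g f : ℂ → ℂ}

theorem intervalIntegrable_mul_deriv (hg : DifferentiableOn ℂ g disc)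
    (hf : IntegrableOn (fun t : ℝ => f t) (Ioo 0 1)) {z : ℂ} (hz : z ∈ disc) :
    IntervalIntegrable (fun t : ℝ => f t * deriv g (t * z)) volume 0 1 := by
  refine IntervalIntegrable.mul_continuousOn (intervalIntegrable_iff_Ioo.2 hf) ?_
  rw [uIcc_of_le zero_le_one]
  exact (differentiableOn_deriv hg).continuousOn.comp
    (by fun_prop : Continuous fun t : ℝ => (t : ℂ) * z).continuousOn
    fun t ht => ofReal_mul_mem_disc ht hz

/-- Expand `g'(tz)` in powers of `tz` and integrate; since `|t| ≤ 1`, the series is dominated by the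
absolutely convergent one for `g'` at radius `‖z‖`, times the integral of `|f|`. -/
theorem hasSum_hilbertOp (hg : DifferentiableOn ℂ g disc)
    (hf : IntegrableOn (fun t : ℝ => f t) (Ioo 0 1)) {z : ℂ} (hz : z ∈ disc) :
    HasSum (fun n => taylorCoeff (deriv g) n *
      (∫ t in Ioo (0 : ℝ) 1, (t : ℂ) ^ n * f t) * z ^ n) (hilbertOp g f z) := by
  have hint : ∀ n, IntegrableOn (fun t : ℝ => (t : ℂ) ^ n * f t) (Ioo 0 1) := fun n => by
    refine Integrable.mono hf ((by fun_prop : Continuous fun t : ℝ =>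
      (t : ℂ) ^ n).aestronglyMeasurable.mul hf.1) ?_
    filter_upwards [ae_restrict_mem measurableSet_Ioo] with t ht
    rw [norm_mul, norm_pow, Complex.norm_real, Real.norm_of_nonneg ht.1.le]
    exact mul_le_of_le_one_left (norm_nonneg _) (pow_le_one₀ ht.1.le ht.2.le)
  have hz1 := mem_disc.1 hz
  have hs : Summable fun n => ∫ t in Ioo (0 : ℝ) 1,
      ‖(taylorCoeff (deriv g) n * z ^ n) * ((t : ℂ) ^ n * f t)‖ := by
    refine Summable.of_nonneg_of_le (fun n => integral_nonneg fun t => norm_nonneg _) (fun n => ?_)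
      ((summable_norm_taylorCoeff (differentiableOn_deriv hg) (norm_nonneg z) hz1).mul_right
        (∫ t in Ioo (0 : ℝ) 1, ‖f t‖))
    rw [← integral_const_mul]
    refine setIntegral_mono_on ((hint n).const_mul _).norm (hf.norm.const_mul _)
      measurableSet_Ioo fun t ht => ?_
    rw [norm_mul, norm_mul, norm_mul, norm_pow, norm_pow, Complex.norm_real,
      Real.norm_of_nonneg ht.1.le]
    refine mul_le_mul_of_nonneg_left ?_ (by positivity)
    exact mul_le_of_le_one_left (norm_nonneg _) (pow_le_one₀ ht.1.le ht.2.le)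
  have h := hasSum_integral_of_hasSum_of_summable_integral_norm
    (fun n => (hint n).const_mul (taylorCoeff (deriv g) n * z ^ n)) hs
    (f := fun t : ℝ => f t * deriv g (t * z)) (by
      filter_upwards [ae_restrict_mem measurableSet_Ioo] with t ht
      refine ((hasSum_taylorCoeff (differentiableOn_deriv hg)
        (ofReal_mul_mem_disc (Ioo_subset_Icc_self ht) hz)).mul_left (f t)).congr_fun fun n => ?_
      ring)
  rw [hilbertOp, intervalIntegral.integral_of_le zero_le_one, integral_Ioc_eq_integral_Ioo]
  refine h.congr_fun fun n => ?_
  rw [integral_const_mul]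
  ring

end Operator

namespace DirichletSpace

variable {v : RadialWeight} {C δ : ℝ}

theorem integrableOn_Ioo (hW : IsHilbertRegular v.weight C δ) (f : DirichletSpace v) :
    IntegrableOn (fun t : ℝ => f.fn t) (Ioo 0 1) :=
  integrableOn_of_summable_div (summable_coeff hW f) fun _ => hasSum_taylorCoeff f.differentiableOn

theorem hasSum_hilbertMatrix (hW : IsHilbertRegular v.weight C δ) (f : DirichletSpace v)
    (c : ℕ → ℂ) (n : ℕ) :
    HasSum (fun m => hilbertMatrix v.weight c n m * seqIsometry v f m)
      ((Real.sqrt (v.weight n) : ℂ) * (c n * ∫ t in Ioo (0 : ℝ) 1, (t : ℂ) ^ n * f.fn t)) := by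
  have h := hasSum_setIntegral_pow_mul (summable_coeff hW f)
    (fun _ => hasSum_taylorCoeff f.differentiableOn) n
  refine ((h.mul_left (c n)).mul_left (Real.sqrt (v.weight n) : ℂ)).congr_fun fun m => ?_
  have hm : (Real.sqrt (v.weight m) : ℂ) ≠ 0 := by
    exact_mod_cast (Real.sqrt_pos.2 (v.weight_pos m)).ne'
  have hnm : (n : ℂ) + m + 1 ≠ 0 := by exact_mod_cast (n + m).succ_ne_zero
  rw [seqIsometry_apply, hilbertMatrix]
  push_cast
  field_simp

end DirichletSpace

/-! ### Compactness transferred to the matrix, and the conclusion -/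

open DirichletSpace

theorem isCompactHilbertOp_iff {v : RadialWeight} {C δ : ℝ} (hW : IsHilbertRegular v.weight C δ)
    {g : ℂ → ℂ} (hg : DifferentiableOn ℂ g disc) :
    IsCompactHilbertOp g v ↔ Tendsto (fun N : ℕ =>
      (∑ n ∈ Finset.range N, ‖taylorCoeff (deriv g) n‖ ^ 2) / N) atTop (𝓝 0) := by
  let Φ := LinearIsometryEquiv.ofSurjective (seqIsometry v) (seqIsometry_surjective hW)
  have hΦ : ∀ f, Φ f = seqIsometry v f := fun f => rfl
  have hsum : ∀ (f : DirichletSpace v) {z : ℂ}, z ∈ disc → _ := fun f _ hz =>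
    hasSum_hilbertOp hg (integrableOn_Ioo hW f) hz
  constructor
  · rintro ⟨T, hT, hcpt⟩
    refine tendsto_average_of_isCompactOperator hW (T := (Φ : DirichletSpace v →L[ℂ] SeqSpace) ∘L T
      ∘L (Φ.symm : SeqSpace →L[ℂ] DirichletSpace v)) (fun x n => ?_)
      ((hcpt.comp_clm (Φ.symm : SeqSpace →L[ℂ] DirichletSpace v)).clm_comp
        (Φ : DirichletSpace v →L[ℂ] SeqSpace))
    have h := hasSum_hilbertMatrix hW (Φ.symm x) (taylorCoeff (deriv g)) n
    rw [← hΦ, Φ.apply_symm_apply] at h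
    -- The operator is prescribed only by its values on the disc; uniqueness of Taylor coefficients
    -- turns this into the matrix form.
    have ht := taylorCoeff_eq_of_hasSum (f := (T (Φ.symm x)).fn) fun z hz => by
      rw [hT _ z hz]
      exact hsum (Φ.symm x) hz
    rw [← congrFun ht n, ← seqIsometry_apply, ← hΦ] at h
    exact h
  · intro hc
    obtain ⟨T, hT, hcpt⟩ := isCompactOperator_of_tendsto_zero hW hc
    refine ⟨(Φ.symm : SeqSpace →L[ℂ] DirichletSpace v) ∘L T
      ∘L (Φ : DirichletSpace v →L[ℂ] SeqSpace), fun f z hz => ?_,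
      (hcpt.comp_clm (Φ : DirichletSpace v →L[ℂ] SeqSpace)).clm_comp
        (Φ.symm : SeqSpace →L[ℂ] DirichletSpace v)⟩
    have h : ∀ n, taylorCoeff (Φ.symm (T (Φ f))).fn n = taylorCoeff (deriv g) n *
        ∫ t in Ioo (0 : ℝ) 1, (t : ℂ) ^ n * f.fn t := fun n => by
      have h1 := (hT (Φ f) n).unique (hasSum_hilbertMatrix hW f (taylorCoeff (deriv g)) n)
      rw [← Φ.apply_symm_apply (T (Φ f)), hΦ, seqIsometry_apply] at h1
      exact mul_left_cancel₀
        (by exact_mod_cast (Real.sqrt_pos.2 (v.weight_pos n)).ne') h1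
    have h2 := hasSum_taylorCoeff (Φ.symm (T (Φ f))).differentiableOn hz
    simp only [h] at h2
    exact h2.unique (hsum f hz)

end DirichletHilbert

theorem mainTheorem5 (g : ℂ → ℂ) (hg : DifferentiableOn ℂ g DirichletHilbert.disc)
    (v : DirichletHilbert.RadialWeight) (hv : v.IsDoubling)
    (hM1 : v.muckenhouptOne < ⊤) (hM2 : v.muckenhouptTwo < ⊤) :
    (∀ f : DirichletHilbert.DirichletSpace v, ∀ z ∈ DirichletHilbert.disc,
      IntervalIntegrable (fun t : ℝ => f.fn t * deriv g (t * z)) MeasureTheory.volume 0 1) ∧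
    (DirichletHilbert.IsCompactHilbertOp g v ↔ DirichletHilbert.IsLittleMeanLipschitz g) := by
  obtain ⟨C, δ, hW⟩ := DirichletHilbert.RadialWeight.exists_isHilbertRegular_weight hv hM1 hM2
  refine ⟨fun f z hz => DirichletHilbert.intervalIntegrable_mul_deriv hg
    (DirichletHilbert.DirichletSpace.integrableOn_Ioo hW f) hz, ?_⟩
  rw [DirichletHilbert.isCompactHilbertOp_iff hW hg, DirichletHilbert.isLittleMeanLipschitz_iff hg]
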